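/- **Setting.** Let $\omega,k_1,k_2,\tau_1,\tau_2>0$, $P_1=k_1(1,\tau_1)$, $P_2=k_2(1,-\tau_2)$, and $p=p(n)=n_1P_1+n_2P_2$ for $n\in\mathbb Z^2$. Consider the rescaled two-dimensional Boussinesq system for $U=(\eta,\mathbf v)$, $$\eta_t+\beta\nabla\cdot\mathbf v+\beta\nabla\cdot(\eta\mathbf v)-\omega\Delta\eta_t=0,\qquad \mathbf v_t+\beta\nabla\eta+\tfrac{\beta}{2}\nabla|\mathbf v|^2-\omega\Delta\mathbf v_t=0 .\tag{1}$$ $H^s_{\natural,e}$ (resp. $H^s_{\natural,o}$) is the space of functions $\sum_{n\in\mathbb Z^2,m\ge0}u_{nm}e^{ip\cdot x}\cos mt$ (resp. $\sum_{n\in\mathbb Z^2,m>0} u_{nm}e^{ip\cdot x}\sin mt$) with $\sum(1+|p|^2+m^2)^s|u_{nm}|^2<\infty$; $Q_s=H^s_{\natural,e}\times H^s_{\natural,o}\times H^s_{\natural,o}$ with the norm given by the square root of the sum of these three sums. So elements of $Q_s$ are $2\pi$-periodic in $t$ and, in $x$, periodic with respect to the lattice dual to $\mathbb ZP_1+\mathbb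 ZP_2$. Solutions of (1) in $Q_s$ are understood in the sense of periodic distributions. Let $\beta_0>0$ be such that the resonance set $$\Omega_{\beta_0}=\{(n_1,n_2,m)\in\mathbb Z^2\times\mathbb Z^+:\ m(1+\omega|p|^2)-\beta_0|p|=0\}$$ equals $\{(\pm1,0,q),(0,\pm1,q)\}$ for some $q\in\mathbb Z^+$. *The operators.* $B(U,U)=(\tfrac12|\mathbf v|^2,\eta\mathbf v)$. For $F=(g,\mathbf f)$ with coefficients $g_{nm},\mathbf f_{nm}$, $\mathcal TF=(\eta,\mathbf v)$ has the coefficients, with $\Delta=m^2(1+\omega|p|^2)^2-\beta_0^2|p|^2$: if $m\ne0$ and $\Delta\neq0$, $\eta_{nm}=-\Delta^{-1}[im(1+\omega|p|^2)\,p\cdot\mathbf f_{nm}+\beta_0|p|^2g_{nm}]$ and $\mathbf v_{nm}=-\Delta^{-1}p\,[-im(1+\omega|p|^2)g_{nm}+\beta_0\,p\cdot\mathbf f_{nm}]$; if $(n,m)=(0,0)$, $0$; otherwise $(g_{nm}/\beta_0,0,0)$. *The coefficients.* Put $s_j=\sqrt{1+\tau_j^2}$, $N_\pm=(k_1\pm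 k_2)^2+(k_1\tau_1\mp k_2\tau_2)^2$, $d_1=4q^2(1+\omega N_+)^2-\beta_0^2N_+$, $d_2=4q^2(1+\omega N_-)^2-\beta_0^2N_-$, $$e_\pm=k_1k_2(k_1\pm k_2)(s_1\pm s_2)-k_1k_2(k_1\tau_1\mp k_2\tau_2)(\tau_2s_1\mp\tau_1s_2),$$ $$a_{2j-1}=-\frac{\beta_0k_j^4s_j^4+2qk_j^3s_j^3(1+4\omega k_j^2s_j^2)}{4q^2(1+4\omega k_j^2s_j^2)^2-4\beta_0^2k_j^2s_j^2},\quad a_{2j}=\frac{2\beta_0k_j^4s_j^3+qk_j^3s_j^2(1+4\omega k_j^2s_j^2)}{4q^2(1+4\omega k_j^2s_j^2)^2-4\beta_0^2k_j^2s_j^2}\quad(j=1,2),$$ $$b_1=\frac{-2q(1+\omega N_+)e_+-\beta_0k_1k_2(1-\tau_1\tau_2)N_+}{2d_1},\qquad b_4=\frac{2q(1+\omega N_-)e_-+\beta_0k_1k_2(1-\tau_1\tau_2)N_-}{2d_2},$$ $$r_+=\frac{2qk_1k_2(1-\tau_1\tau_2)(1+\omega N_+)+\beta_0e_+}{2d_1},\qquad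 r_-=\frac{2qk_1k_2(\tau_1\tau_2-1)(1+\omega N_-)-\beta_0e_-}{2d_2},$$ $b_2=(k_1+k_2)r_+$, $b_3=(k_1\tau_1-k_2\tau_2)r_+$, $b_5=(k_1-k_2)r_-$, $b_6=(k_1\tau_1+k_2\tau_2)r_-$, and $$l_1=\tfrac14k_1^4s_1^4-\beta_0a_2k_1^2s_1^3+\tfrac12\beta_0a_1k_1^2s_1^2,\qquad l_3=\tfrac14k_2^4s_2^4-\beta_0a_4k_2^2s_2^3+\tfrac12\beta_0a_3k_2^2s_2^2,$$ $$l_2=k_1^2k_2^2(1-\tau_1\tau_2)^2+\tfrac12\beta_0k_1k_2\big[(b_1-b_4)(1-\tau_1\tau_2)-b_2(s_1+s_2)-b_3(\tau_1s_2-\tau_2s_1)+b_5(s_1-s_2)-b_6(\tau_1s_2+\tau_2s_1)\big].$$ Assume $l_1l_3-l_2^2\neq0$. For real $\mu,C$ put $$\alpha_1=\frac{(2\mu+C\beta_0)\,[\,l_3k_1^2s_1^2-l_2k_2^2s_2^2\,]}{\beta_0(l_1l_3-l_2^2)},\qquad \alpha_2=\frac{(2\mu+C\beta_0)\,[\,l_1k_2^2s_2^2-l_2k_1^2s_1^2\,]}{\beta_0(l_1l_3-l_2^2)}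 .$$ *The leading part.* With $\theta_1=k_1x_1+k_1\tau_1x_2$ and $\theta_2=k_2x_1-k_2\tau_2x_2$, let $X=X(C,A_1,A_2)=(X^\eta,X^{v_1},X^{v_2})$ be $$X^\eta=C+2k_1s_1A_1\cos\theta_1\cos qt+2k_2s_2A_2\cos\theta_2\cos qt,$$ $$X^{v_1}=2k_1A_1\sin\theta_1\sin qt+2k_2A_2\sin\theta_2\sin qt,\qquad X^{v_2}=2k_1\tau_1A_1\sin\theta_1\sin qt-2k_2\tau_2A_2\sin\theta_2\sin qt .$$ **Theorem.** Let $s\ge2$. There are $\varepsilon,\delta,M>0$, depending only on $\omega,k_1,k_2,\tau_1,\tau_2,\beta_0,q,s$, such that for all real $\mu,C$ with $|\mu|+|C|<\varepsilon$, $\alpha_1\ge0$ and $\alpha_2\ge0$ there are real numbers $A_1,A_2\ge0$ and a real-valued $U\in Q_s$ with the following properties. 1. *Amplitudes.* $|A_j^2-\alpha_j|\le M(|\mu|+|C|)^2$ for $j=1,2$. In particular $A_j>0$ whenever $\alpha_j>M(|\mu|+|C|)^2$; and if $A_1>0$ or $A_2>0$, then the velocity of $U$ is not identically zero, so that $U$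 is nontrivial. 2. *Solutions.* For every $\sigma\in\mathbb R^2$ the shifted function $U(x+\sigma,t)$ lies in $Q_s$ and solves (1) with $\beta=\beta_0+\mu$. Moreover $\|U\|_{Q_s}<\delta$, the mean of the elevation $\eta$ of $U$ over a period cell is $C$, and the velocity components of $U-X(C,A_1,A_2)$ have zero Fourier coefficients at the modes in $\Omega_{\beta_0}$. 3. *Expansion.* $U=X-V_1-V_2+R$, where $X=X(C,A_1,A_2)$, $V_1=\mu\,\mathcal TX$, $V_2=\beta_0\,\mathcal TB(X,X)$, $R\in Q_s$ and, with $\rho=|C|+A_1+A_2$, $$\|R\|_{Q_s}\le M\big(|\mu|^2\rho+|\mu|\rho^2+\rho^3\big).$$ 4. *Uniqueness up to a spatial shift.* If $W\in Q_s$ is a real-valued solution of (1) with $\beta=\beta_0+\mu$, mean elevation $C$ and $\|W\|_{Q_s}<\delta$, and the Fourier coefficients of its first velocity component at the modes $(1,0,q)$ and $(0,1,q)$ are both nonzero, then $W(x,t)=U(x+\sigma,t)$ for some $\sigma\in\mathbb R^2$. -/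

import Mathlib

open Complex

noncomputable section

namespace Boussinesq

/-- The real parameters: the dispersion parameter `ω` of the rescaled Boussinesq system, and the
data of the lattice generated by `P₁ = k₁(1, τ₁)` and `P₂ = k₂(1, -τ₂)`. -/
structure Params where
  ω : ℝ
  k₁ : ℝ
  k₂ : ℝ
  τ₁ : ℝ
  τ₂ : ℝ

/-- First coordinate of the wave vector `p = n₁ P₁ + n₂ P₂`. -/
def p₁ (D : Params) (n : ℤ × ℤ) : ℝ := D.k₁ * n.1 + D.k₂ * n.2

/-- Second coordinate of the wave vector `p = n₁ P₁ + n₂ P₂`. -/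
def p₂ (D : Params) (n : ℤ × ℤ) : ℝ := D.τ₁ * D.k₁ * n.1 - D.τ₂ * D.k₂ * n.2

/-- `|p|²`. -/
def psq (D : Params) (n : ℤ × ℤ) : ℝ := p₁ D n ^ 2 + p₂ D n ^ 2

/-- A mode `(n, m)`: the lattice index `n ∈ ℤ²` and the time frequency `m ≥ 0`. -/
abbrev Mode := (ℤ × ℤ) × ℕ

/-- The resonance set `Ω_β`: modes with `m > 0` and `m (1 + ω |p|²) - β |p| = 0`. -/
def resonanceSet (D : Params) (β : ℝ) : Set Mode :=
  {k | 0 < k.2 ∧ (k.2 : ℝ) * (1 + D.ω * psq D k.1) - β * √(psq D k.1) = 0}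

/-- `Δ(p, m) = m² (1 + ω |p|²)² - β² |p|²`. -/
def disc (D : Params) (β : ℝ) (k : Mode) : ℝ :=
  (k.2 : ℝ) ^ 2 * (1 + D.ω * psq D k.1) ^ 2 - β ^ 2 * psq D k.1

/-! ### Functions and triples of functions -/

/-- Scalar functions of `(x, t)`, `x = (x₁, x₂)`. -/
abbrev Scalar := ℝ × ℝ → ℝ → ℂ

/-- Triples `U = (η, v₁, v₂)` of functions of `(x, t)`. -/
abbrev Field := ℝ × ℝ → ℝ → ℂ × ℂ × ℂ

def eta (U : Field) : Scalar := fun x t => (U x t).1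
def vel₁ (U : Field) : Scalar := fun x t => (U x t).2.1
def vel₂ (U : Field) : Scalar := fun x t => (U x t).2.2

/-- All three components are real valued. -/
def IsRealField (U : Field) : Prop :=
  ∀ x t, (eta U x t).im = 0 ∧ (vel₁ U x t).im = 0 ∧ (vel₂ U x t).im = 0

/-- Translation in space, `(x, t) ↦ U (x + σ, t)`. -/
def shift (σ : ℝ × ℝ) (U : Field) : Field := fun x t => U (x + σ) t

/-- The spatial mode `exp(i p·x)`. -/
def expMode (D : Params) (n : ℤ × ℤ) (x : ℝ × ℝ) : ℂ :=
  Complex.exp (I * ((p₁ D n * x.1 + p₂ D n * x.2 : ℝ) : ℂ))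

/-- The point `x` with `P₁·x = y₁` and `P₂·x = y₂`; the period cell in space is the image of
`[0, 2π]²`. -/
def cellPoint (D : Params) (y₁ y₂ : ℝ) : ℝ × ℝ :=
  ((D.τ₂ * (y₁ / D.k₁) + D.τ₁ * (y₂ / D.k₂)) / (D.τ₁ + D.τ₂),
    (y₁ / D.k₁ - y₂ / D.k₂) / (D.τ₁ + D.τ₂))

/-- Mean value over one period cell in space and one period `2π` in time. -/
def cellMean (D : Params) (u : Scalar) : ℂ :=
  ((2 * Real.pi) ^ 3 : ℝ)⁻¹ •
    ∫ y₁ in (0 : ℝ)..(2 * Real.pi), ∫ y₂ in (0 : ℝ)..(2 * Real.pi),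
      ∫ t in (0 : ℝ)..(2 * Real.pi), u (cellPoint D y₁ y₂) t

/-- Coefficient of `exp(i p·x) cos(m t)` in the Fourier series of a function even in `t`. -/
def cosCoeff (D : Params) (u : Scalar) (k : Mode) : ℂ :=
  (if k.2 = 0 then 1 else 2) *
    cellMean D (fun x t => u x t * expMode D (-k.1) x * (Real.cos (k.2 * t) : ℂ))

/-- Coefficient of `exp(i p·x) sin(m t)` in the Fourier series of a function odd in `t`. -/
def sinCoeff (D : Params) (u : Scalar) (k : Mode) : ℂ :=
  2 * cellMean D (fun x t => u x t * expMode D (-k.1) x * (Real.sin (k.2 * t) : ℂ))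

/-- The Sobolev weight `(1 + |p|² + m²)^s`. -/
def weight (D : Params) (s : ℝ) (k : Mode) : ℝ := (1 + psq D k.1 + (k.2 : ℝ) ^ 2) ^ s

/-- `H^s_{♮,e}` for `s > 3/2`, where the elements are continuous functions, equal everywhere to
their absolutely convergent Fourier series `∑ u_k exp(i p·x) cos(m t)`. -/
def MemEven (D : Params) (s : ℝ) (u : Scalar) : Prop :=
  Summable (fun k : Mode => weight D s k * ‖cosCoeff D u k‖ ^ 2) ∧
    ∀ x t, HasSum (fun k : Mode => cosCoeff D u k * expMode D k.1 x * (Real.cos (k.2 * t) : ℂ))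
      (u x t)

/-- `H^s_{♮,o}` for `s > 3/2`, series `∑ u_k exp(i p·x) sin(m t)`. -/
def MemOdd (D : Params) (s : ℝ) (u : Scalar) : Prop :=
  Summable (fun k : Mode => weight D s k * ‖sinCoeff D u k‖ ^ 2) ∧
    ∀ x t, HasSum (fun k : Mode => sinCoeff D u k * expMode D k.1 x * (Real.sin (k.2 * t) : ℂ))
      (u x t)

/-- `Q_s = H^s_{♮,e} × H^s_{♮,o} × H^s_{♮,o}`. -/
def MemQ (D : Params) (s : ℝ) (U : Field) : Prop :=
  MemEven D s (eta U) ∧ MemOdd D s (vel₁ U) ∧ MemOdd D s (vel₂ U)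

/-- The norm of `Q_s`. -/
def normQ (D : Params) (s : ℝ) (U : Field) : ℝ :=
  √(∑' k : Mode, weight D s k *
    (‖cosCoeff D (eta U) k‖ ^ 2 + ‖sinCoeff D (vel₁ U) k‖ ^ 2 + ‖sinCoeff D (vel₂ U) k‖ ^ 2))

/-! ### The Boussinesq system -/

/-- Fourier coefficient with respect to the character `exp(i (p·x + m t))`, `m ∈ ℤ`. -/
def fourier (D : Params) (u : Scalar) (n : ℤ × ℤ) (m : ℤ) : ℂ :=
  cellMean D (fun x t => u x t * expMode D (-n) x * Complex.exp (-(I * (m * t : ℝ))))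

/-- The quadratic map `B(U,U) = (|v|²/2, η v)`. -/
def quad (U : Field) : Field := fun x t =>
  (((vel₁ U x t) ^ 2 + (vel₂ U x t) ^ 2) / 2, eta U x t * vel₁ U x t, eta U x t * vel₂ U x t)

/-- `U = (η, v)` solves
`η_t + β ∇·v + β ∇·(η v) - ω Δη_t = 0`, `v_t + β ∇η + (β/2) ∇|v|² - ω Δv_t = 0`
in the sense of periodic distributions: each equation is tested against every character
`φ = exp(-i (p·x + m t))`, all derivatives being moved to `φ`
(`-∂_t φ = i m φ`, `-∇φ = i p φ`, `ω Δ∂_t φ = i m ω |p|² φ`). -/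
def IsSolution (D : Params) (β : ℝ) (U : Field) : Prop :=
  ∀ (n : ℤ × ℤ) (m : ℤ),
    (I * m * (1 + D.ω * psq D n) * fourier D (eta U) n m
      + I * β * (p₁ D n * (fourier D (vel₁ U) n m + fourier D (vel₁ (quad U)) n m)
        + p₂ D n * (fourier D (vel₂ U) n m + fourier D (vel₂ (quad U)) n m)) = 0) ∧
    (I * m * (1 + D.ω * psq D n) * fourier D (vel₁ U) n m
      + I * β * p₁ D n * (fourier D (eta U) n m + fourier D (eta (quad U)) n m) = 0) ∧
    (I * m * (1 + D.ω * psq D n) * fourier D (vel₂ U) n m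
      + I * β * p₂ D n * (fourier D (eta U) n m + fourier D (eta (quad U)) n m) = 0)

/-! ### The partial inverse `𝒯` of the linearized operator -/

/-- The triple of coefficients of `𝒯 F` at the mode `k`, for `F = (g, f₁, f₂)`. -/
def invCoeff (D : Params) (β : ℝ) (F : Field) (k : Mode) : ℂ × ℂ × ℂ :=
  let g := cosCoeff D (eta F) k
  let pf := p₁ D k.1 * sinCoeff D (vel₁ F) k + p₂ D k.1 * sinCoeff D (vel₂ F) k
  let e : ℂ := k.2 * (1 + D.ω * psq D k.1)
  let w := -(-I * e * g + β * pf) / disc D β k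
  open Classical in
  if k.2 ≠ 0 ∧ disc D β k ≠ 0 then
    (-(I * e * pf + β * psq D k.1 * g) / disc D β k, p₁ D k.1 * w, p₂ D k.1 * w)
  else if k = ((0, 0), 0) then (0, 0, 0)
  else (g / β, 0, 0)

/-- The operator `𝒯`. -/
def linInv (D : Params) (β : ℝ) (F : Field) : Field := fun x t =>
  (∑' k : Mode, (invCoeff D β F k).1 * expMode D k.1 x * (Real.cos (k.2 * t) : ℂ),
   ∑' k : Mode, (invCoeff D β F k).2.1 * expMode D k.1 x * (Real.sin (k.2 * t) : ℂ),
   ∑' k : Mode, (invCoeff D β F k).2.2 * expMode D k.1 x * (Real.sin (k.2 * t) : ℂ))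

/-! ### The leading part and its amplitudes -/

/-- The element `X = C ζ₀ + A₁ (ξ₁ + conj ξ₁) + A₂ (ξ₂ + conj ξ₂)` of the kernel of the linearized
operator, for real `A₁`, `A₂`, `C`, where `ζ₀ = (1, 0, 0)` and, for `p = P₁` and `p = P₂`,
`ξ = (|p| cos(q t), -i p sin(q t)) exp(i p·x)`. -/
def leading (D : Params) (q : ℕ) (C A₁ A₂ : ℝ) : Field := fun x t =>
  let θ₁ := D.k₁ * x.1 + D.k₁ * D.τ₁ * x.2
  let θ₂ := D.k₂ * x.1 - D.k₂ * D.τ₂ * x.2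
  (((C + 2 * D.k₁ * √(1 + D.τ₁ ^ 2) * A₁ * Real.cos θ₁ * Real.cos (q * t)
      + 2 * D.k₂ * √(1 + D.τ₂ ^ 2) * A₂ * Real.cos θ₂ * Real.cos (q * t) : ℝ) : ℂ),
   ((2 * D.k₁ * A₁ * Real.sin θ₁ * Real.sin (q * t)
      + 2 * D.k₂ * A₂ * Real.sin θ₂ * Real.sin (q * t) : ℝ) : ℂ),
   ((2 * D.k₁ * D.τ₁ * A₁ * Real.sin θ₁ * Real.sin (q * t)
      - 2 * D.k₂ * D.τ₂ * A₂ * Real.sin θ₂ * Real.sin (q * t) : ℝ) : ℂ))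

/-- `a₁` (for `(k, τ) = (k₁, τ₁)`) and `a₃` (for `(k₂, τ₂)`). -/
def aEta (ω β q k τ : ℝ) : ℝ :=
  -(β * k ^ 4 * (1 + τ ^ 2) ^ 2
      + 2 * q * k ^ 3 * √(1 + τ ^ 2) ^ 3 * (1 + 4 * ω * k ^ 2 * (1 + τ ^ 2))) /
    (4 * q ^ 2 * (1 + 4 * ω * k ^ 2 * (1 + τ ^ 2)) ^ 2 - 4 * β ^ 2 * k ^ 2 * (1 + τ ^ 2))

/-- `a₂` (for `(k, τ) = (k₁, τ₁)`) and `a₄` (for `(k₂, τ₂)`). -/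
def aVel (ω β q k τ : ℝ) : ℝ :=
  (2 * β * k ^ 4 * √(1 + τ ^ 2) ^ 3
      + q * k ^ 3 * (1 + τ ^ 2) * (1 + 4 * ω * k ^ 2 * (1 + τ ^ 2))) /
    (4 * q ^ 2 * (1 + 4 * ω * k ^ 2 * (1 + τ ^ 2)) ^ 2 - 4 * β ^ 2 * k ^ 2 * (1 + τ ^ 2))

/-- `|P₁ + P₂|²`. -/
def nPlus (D : Params) : ℝ := (D.k₁ + D.k₂) ^ 2 + (D.k₁ * D.τ₁ - D.k₂ * D.τ₂) ^ 2

/-- `|P₁ - P₂|²`. -/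
def nMinus (D : Params) : ℝ := (D.k₁ - D.k₂) ^ 2 + (D.k₁ * D.τ₁ + D.k₂ * D.τ₂) ^ 2

def d₁ (D : Params) (β q : ℝ) : ℝ :=
  4 * q ^ 2 * (1 + D.ω * nPlus D) ^ 2 - β ^ 2 * nPlus D

def d₂ (D : Params) (β q : ℝ) : ℝ :=
  4 * q ^ 2 * (1 + D.ω * nMinus D) ^ 2 - β ^ 2 * nMinus D

/-- `k₁k₂(k₁+k₂)(√(1+τ₁²) + √(1+τ₂²)) - k₁k₂(k₁τ₁-k₂τ₂)(τ₂√(1+τ₁²) - τ₁√(1+τ₂²))`. -/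
def ePlus (D : Params) : ℝ :=
  D.k₁ * D.k₂ * (D.k₁ + D.k₂) * (√(1 + D.τ₁ ^ 2) + √(1 + D.τ₂ ^ 2))
    - D.k₁ * D.k₂ * (D.k₁ * D.τ₁ - D.k₂ * D.τ₂)
      * (D.τ₂ * √(1 + D.τ₁ ^ 2) - D.τ₁ * √(1 + D.τ₂ ^ 2))

/-- `k₁k₂(k₁-k₂)(√(1+τ₁²) - √(1+τ₂²)) - k₁k₂(k₁τ₁+k₂τ₂)(τ₂√(1+τ₁²) + τ₁√(1+τ₂²))`. -/
def eMinus (D : Params) : ℝ :=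
  D.k₁ * D.k₂ * (D.k₁ - D.k₂) * (√(1 + D.τ₁ ^ 2) - √(1 + D.τ₂ ^ 2))
    - D.k₁ * D.k₂ * (D.k₁ * D.τ₁ + D.k₂ * D.τ₂)
      * (D.τ₂ * √(1 + D.τ₁ ^ 2) + D.τ₁ * √(1 + D.τ₂ ^ 2))

def b₁ (D : Params) (β q : ℝ) : ℝ :=
  (-(2 * q * (1 + D.ω * nPlus D) * ePlus D)
    - β * D.k₁ * D.k₂ * (1 - D.τ₁ * D.τ₂) * nPlus D) / (2 * d₁ D β q)

/-- The common factor `r₊` of `b₂ = (k₁ + k₂) r₊` and `b₃ = (k₁τ₁ - k₂τ₂) r₊`. -/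
def rPlus (D : Params) (β q : ℝ) : ℝ :=
  (2 * q * D.k₁ * D.k₂ * (1 - D.τ₁ * D.τ₂) * (1 + D.ω * nPlus D) + β * ePlus D)
    / (2 * d₁ D β q)

def b₂ (D : Params) (β q : ℝ) : ℝ := (D.k₁ + D.k₂) * rPlus D β q
def b₃ (D : Params) (β q : ℝ) : ℝ := (D.k₁ * D.τ₁ - D.k₂ * D.τ₂) * rPlus D β q

def b₄ (D : Params) (β q : ℝ) : ℝ :=
  (2 * q * (1 + D.ω * nMinus D) * eMinus D
    + β * D.k₁ * D.k₂ * (1 - D.τ₁ * D.τ₂) * nMinus D) / (2 * d₂ D β q)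

/-- The common factor `r₋` of `b₅ = (k₁ - k₂) r₋` and `b₆ = (k₁τ₁ + k₂τ₂) r₋`. -/
def rMinus (D : Params) (β q : ℝ) : ℝ :=
  (2 * q * D.k₁ * D.k₂ * (D.τ₁ * D.τ₂ - 1) * (1 + D.ω * nMinus D) - β * eMinus D)
    / (2 * d₂ D β q)

def b₅ (D : Params) (β q : ℝ) : ℝ := (D.k₁ - D.k₂) * rMinus D β q
def b₆ (D : Params) (β q : ℝ) : ℝ := (D.k₁ * D.τ₁ + D.k₂ * D.τ₂) * rMinus D β q

/-- The self-interaction coefficient: `l₁` for `(k₁, τ₁)`, `l₃` for `(k₂, τ₂)`. -/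
def lSelf (ω β q k τ : ℝ) : ℝ :=
  k ^ 4 * (1 + τ ^ 2) ^ 2 / 4 - β * aVel ω β q k τ * k ^ 2 * √(1 + τ ^ 2) ^ 3
    + β * aEta ω β q k τ * k ^ 2 * (1 + τ ^ 2) / 2

def l₁ (D : Params) (β q : ℝ) : ℝ := lSelf D.ω β q D.k₁ D.τ₁
def l₃ (D : Params) (β q : ℝ) : ℝ := lSelf D.ω β q D.k₂ D.τ₂

/-- The cross-interaction coefficient. -/
def l₂ (D : Params) (β q : ℝ) : ℝ :=
  D.k₁ ^ 2 * D.k₂ ^ 2 * (1 - D.τ₁ * D.τ₂) ^ 2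
    + β / 2 * D.k₁ * D.k₂ *
      ((b₁ D β q - b₄ D β q) * (1 - D.τ₁ * D.τ₂)
        - b₂ D β q * (√(1 + D.τ₁ ^ 2) + √(1 + D.τ₂ ^ 2))
        - b₃ D β q * (D.τ₁ * √(1 + D.τ₂ ^ 2) - D.τ₂ * √(1 + D.τ₁ ^ 2))
        + b₅ D β q * (√(1 + D.τ₁ ^ 2) - √(1 + D.τ₂ ^ 2))
        - b₆ D β q * (D.τ₁ * √(1 + D.τ₂ ^ 2) + D.τ₂ * √(1 + D.τ₁ ^ 2)))

/-- `l₁ l₃ - l₂²`. -/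
def lDet (D : Params) (β q : ℝ) : ℝ := l₁ D β q * l₃ D β q - l₂ D β q ^ 2

/-- Leading value of `|A₁|²`, from Cramer's rule. -/
def ampSq₁ (D : Params) (β₀ q μ C : ℝ) : ℝ :=
  (2 * μ + C * β₀) * (l₃ D β₀ q * D.k₁ ^ 2 * (1 + D.τ₁ ^ 2)
    - l₂ D β₀ q * D.k₂ ^ 2 * (1 + D.τ₂ ^ 2)) / (β₀ * lDet D β₀ q)

/-- Leading value of `|A₂|²`, from Cramer's rule. -/
def ampSq₂ (D : Params) (β₀ q μ C : ℝ) : ℝ :=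
  (2 * μ + C * β₀) * (l₁ D β₀ q * D.k₂ ^ 2 * (1 + D.τ₂ ^ 2)
    - l₂ D β₀ q * D.k₁ ^ 2 * (1 + D.τ₁ ^ 2)) / (β₀ * lDet D β₀ q)

end Boussinesq

end

open Complex

noncomputable section

namespace Boussinesq

/-! The proof is a Lyapunov–Schmidt reduction on Fourier coefficients, in an algebra of absolutely
convergent series; the symmetries of the system make the bifurcation equations real and divisible by
the amplitudes.

Write β = β₀ + μ. A solution u satisfies u = X - 𝒯(μu + (β₀ + μ)B(u,u)) with X in the kernel of the
linearization at β₀ (`fixed_of_seqSol`); conversely, such a fixed point solves the system once its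
right-hand side obeys the solvability condition at the resonant frequencies (`seqSol_of_fixed`).
There are no small divisors: for m ≠ 0, |m|(1 + ω|p|²) dominates β₀|p| at all but finitely many
frequencies, so 𝒯 is bounded (`exists_norm_tk_le`). B is a convolution, bounded on ℓ¹ with a
submultiplicative weight. Weighted ℓ¹ lies inside Q_s (`memQ_of_series`), and Q_s with s ≥ 2 lies
inside unweighted ℓ¹ (`series_of_memQ`). Existence is therefore proved in the smaller space, and
uniqueness, a contraction estimate (`fixed_unique`), in the larger one.

For given (μ, C, A₁, A₂) the fixed point is sought as E + A₁O₁ + A₂O₂ + A₁A₂D, split by parity in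
the amplitudes. The components depend only on μ, C and a_j = A_j², and are C² by the implicit
function theorem (`exists_components`); in these variables a_j = 0 is an interior point.

By uniqueness u inherits the symmetries of X (`act_assemble`). Conjugation, time reversal and point
reflection reduce the conditions at the eight resonant frequencies to one real number for each of
the two waves. Translations by half periods, which flip the signs of the amplitudes, show that this
number is A_j times a function of (μ, C, a₁, a₂) (`solvE_assemble`). What remains is h = 0 for a C²
map h with h(0) = 0, whose derivative in (a₁, a₂) is -β₀/2 times the symmetric matrix with entries
l₁, l₂, l₃ (`fderiv_bif_waves`, from `self_interaction`, `square_interaction` and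
`mixed_interaction_eq`). Since l₁l₃ ≠ l₂², the zero is a function of (μ, C), within a quadratic
error of (α₁, α₂). As squares of amplitudes must be nonnegative, `exists_amplitudes` handles
separately the case where this zero leaves the open quadrant.

For uniqueness, a translation gives the two resonant velocity coefficients of W the phases of a
leading part with positive amplitudes. The shifted W is then the fixed point for these amplitudes
and satisfies h = 0, so its amplitudes are those of U. The expansion comes from substituting the
fixed point equation into itself (`norm_remainder_le`). -/

/-- All the parameters are positive. -/
structure Params.IsPos (D : Params) : Prop where
  ω : 0 < D.ω
  k₁ : 0 < D.k₁
  k₂ : 0 < D.k₂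
  τ₁ : 0 < D.τ₁
  τ₂ : 0 < D.τ₂

/-! ### Space-time characters -/

/-- Indices `(n, m) ∈ ℤ² × ℤ` of the characters `exp(i (p·x + m t))`. -/
abbrev Freq := (ℤ × ℤ) × ℤ

/-- Fourier coefficients of a triple of functions. -/
abbrev Coef := ℂ × ℂ × ℂ

/-- The character `exp(i (p·x + m t))`. -/
def char (D : Params) (k : Freq) (x : ℝ × ℝ) (t : ℝ) : ℂ :=
  expMode D k.1 x * Complex.exp (I * (k.2 * t : ℝ))

lemma expMode_add (D : Params) (n n' : ℤ × ℤ) (x : ℝ × ℝ) :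
    expMode D (n + n') x = expMode D n x * expMode D n' x := by
  unfold expMode p₁ p₂
  rw [← Complex.exp_add]
  congr 1
  push_cast [Prod.fst_add, Prod.snd_add]
  ring

lemma expMode_add_right (D : Params) (n : ℤ × ℤ) (x σ : ℝ × ℝ) :
    expMode D n (x + σ) = expMode D n x * expMode D n σ := by
  unfold expMode
  rw [← Complex.exp_add]
  congr 1
  push_cast [Prod.fst_add, Prod.snd_add]
  ring

lemma char_add (D : Params) (k l : Freq) (x : ℝ × ℝ) (t : ℝ) :
    char D (k + l) x t = char D k x t * char D l x t := by
  unfold char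
  rw [Prod.fst_add, expMode_add, Prod.snd_add, Int.cast_add, add_mul]
  push_cast
  rw [mul_add, Complex.exp_add]
  ring

lemma norm_expMode (D : Params) (n : ℤ × ℤ) (x : ℝ × ℝ) : ‖expMode D n x‖ = 1 := by
  rw [expMode, mul_comm, Complex.norm_exp_ofReal_mul_I]

lemma norm_char (D : Params) (k : Freq) (x : ℝ × ℝ) (t : ℝ) : ‖char D k x t‖ = 1 := by
  rw [char, norm_mul, norm_expMode, mul_comm I, Complex.norm_exp_ofReal_mul_I, one_mul]

lemma expMode_zero (D : Params) (x : ℝ × ℝ) : expMode D 0 x = 1 := by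
  simp [expMode, p₁, p₂]

lemma char_zero (D : Params) (x : ℝ × ℝ) (t : ℝ) : char D 0 x t = 1 := by
  simp [char, expMode_zero]

/-- In the cell coordinates P_j·x = y_j, so p·x = n₁y₁ + n₂y₂ and the character splits into three
one-variable exponentials. Inverting the lattice basis needs τ₁ + τ₂ ≠ 0. -/
lemma char_cellPoint {D : Params} (hD : D.IsPos) (k : Freq) (y₁ y₂ t : ℝ) :
    char D k (cellPoint D y₁ y₂) t =
      Complex.exp (I * (k.1.1 * y₁ : ℝ)) * Complex.exp (I * (k.1.2 * y₂ : ℝ)) *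
        Complex.exp (I * (k.2 * t : ℝ)) := by
  unfold char expMode
  congr 1
  rw [← Complex.exp_add, ← mul_add, ← Complex.ofReal_add]
  congr 3
  have := hD.k₁.ne'
  have := hD.k₂.ne'
  have : D.τ₁ + D.τ₂ ≠ 0 := (add_pos hD.τ₁ hD.τ₂).ne'
  simp only [cellPoint, p₁, p₂]
  field_simp
  ring

/-! ### Absolutely convergent Fourier series -/

section Series

variable {G : Type*} [NormedAddCommGroup G] [NormedSpace ℂ G]

/-- `u` is the sum of the absolutely convergent Fourier series with coefficients `c`. -/
def HasSeries (D : Params) (u : ℝ × ℝ → ℝ → G) (c : Freq → G) : Prop :=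
  Summable (fun k => ‖c k‖) ∧ ∀ x t, HasSum (fun k => char D k x t • c k) (u x t)

lemma summable_char_smul [CompleteSpace G] {D : Params} {c : Freq → G}
    (hc : Summable fun k => ‖c k‖) (x : ℝ × ℝ) (t : ℝ) :
    Summable fun k => char D k x t • c k := by
  refine Summable.of_norm ?_
  simpa [norm_smul, norm_char] using hc

lemma hasSeries_tsum [CompleteSpace G] {D : Params} {c : Freq → G}
    (hc : Summable fun k => ‖c k‖) :
    HasSeries D (fun x t => ∑' k, char D k x t • c k) c :=
  ⟨hc, fun x t => (summable_char_smul hc x t).hasSum⟩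

namespace HasSeries

variable {D : Params} {u v : ℝ × ℝ → ℝ → G} {c d : Freq → G}

lemma add (hu : HasSeries D u c) (hv : HasSeries D v d) :
    HasSeries D (u + v) (c + d) := by
  refine ⟨Summable.of_nonneg_of_le (fun _ => norm_nonneg _) (fun k => norm_add_le _ _)
    (hu.1.add hv.1), fun x t => ?_⟩
  simpa [smul_add] using (hu.2 x t).add (hv.2 x t)

lemma const_smul (a : ℂ) (hu : HasSeries D u c) : HasSeries D (a • u) (a • c) := by
  refine ⟨by simpa [norm_smul] using hu.1.mul_left ‖a‖, fun x t => ?_⟩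
  simpa [smul_comm a] using (hu.2 x t).const_smul a

lemma neg (hu : HasSeries D u c) : HasSeries D (-u) (-c) := by
  simpa using hu.const_smul (-1)

lemma sub (hu : HasSeries D u c) (hv : HasSeries D v d) :
    HasSeries D (u - v) (c - d) := by
  simpa [sub_eq_add_neg] using hu.add hv.neg

lemma map {G' : Type*} [NormedAddCommGroup G'] [NormedSpace ℂ G'] (f : G →L[ℂ] G')
    (hu : HasSeries D u c) : HasSeries D (fun x t => f (u x t)) (fun k => f (c k)) := by
  refine ⟨Summable.of_nonneg_of_le (fun _ => norm_nonneg _) (fun k => f.le_opNorm _)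
    (hu.1.mul_left ‖f‖), fun x t => ?_⟩
  simpa using (hu.2 x t).mapL f

lemma shift (hu : HasSeries D u c) (σ : ℝ × ℝ) :
    HasSeries D (fun x t => u (x + σ) t) (fun k => expMode D k.1 σ • c k) := by
  refine ⟨by simpa [norm_smul, norm_expMode] using hu.1, fun x t => ?_⟩
  convert! hu.2 (x + σ) t using 2 with k
  rw [smul_smul, char, char, expMode_add_right]
  congr 1
  ring

/-- Modulation translates the coefficient family. It serves to bring a given coefficient to
frequency zero, where it is a mean value. -/
lemma mul_char (hu : HasSeries D u c) (l : Freq) :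
    HasSeries D (fun x t => char D l x t • u x t) (fun k => c (k - l)) := by
  have e : Summable fun k => ‖c (k - l)‖ :=
    ((Equiv.subRight l).summable_iff (f := fun k => ‖c k‖)).2 hu.1
  refine ⟨e, fun x t => ?_⟩
  rw [← (Equiv.addRight l).hasSum_iff]
  convert! (hu.2 x t).const_smul (char D l x t) using 2 with k
  simp [char_add, mul_smul, smul_comm (char D l x t)]

end HasSeries
end Series

/-! ### Fourier coefficients as mean values over a period cell -/

/-- Mean value of `exp(i m t)`. -/
lemma integral_exp_int (m : ℤ) :
    ∫ t in (0 : ℝ)..(2 * Real.pi), Complex.exp (I * (m * t : ℝ)) =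
      if m = 0 then ((2 * Real.pi : ℝ) : ℂ) else 0 := by
  split_ifs with h
  · simp [h]
  · have hm : I * (m : ℂ) ≠ 0 := mul_ne_zero I_ne_zero (by exact_mod_cast h)
    have := integral_exp_mul_complex (a := 0) (b := 2 * Real.pi) hm
    have e : ∀ t : ℝ, Complex.exp (I * (m * t : ℝ)) = Complex.exp (I * m * t) := fun t => by
      push_cast; ring_nf
    simp_rw [e]
    have e2 : Complex.exp (I * m * ((2 * Real.pi : ℝ) : ℂ)) = 1 := by
      rw [Complex.exp_eq_one_iff]
      exact ⟨m, by push_cast; ring⟩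
    rw [this, e2]
    simp

/-- Integration over a period, term by term, of an absolutely convergent series. -/
lemma hasSum_integral_exp {ι : Type*} [Countable ι] {c : ι → ℂ} (hc : Summable fun i => ‖c i‖)
    (f : ι → ℤ) {g : ℝ → ℂ}
    (hg : ∀ t, HasSum (fun i => c i * Complex.exp (I * (f i * t : ℝ))) (g t)) :
    HasSum (fun i => if f i = 0 then c i * ((2 * Real.pi : ℝ) : ℂ) else 0)
      (∫ t in (0 : ℝ)..(2 * Real.pi), g t) := by
  have key := intervalIntegral.hasSum_integral_of_dominated_convergence (a := 0)
    (b := 2 * Real.pi) (μ := MeasureTheory.volume)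
    (F := fun i t => c i * Complex.exp (I * (f i * t : ℝ))) (f := g) (fun i _ => ‖c i‖)
    (fun i => by
      have : Continuous fun t : ℝ => c i * Complex.exp (I * (f i * t : ℝ)) := by fun_prop
      exact this.aestronglyMeasurable)
    (fun i => Filter.Eventually.of_forall fun t _ => by
      rw [norm_mul, mul_comm I, Complex.norm_exp_ofReal_mul_I, mul_one])
    (Filter.Eventually.of_forall fun _ _ => hc) intervalIntegrable_const
    (Filter.Eventually.of_forall fun t _ => hg t)
  convert! key using 2 with i
  rw [intervalIntegral.integral_const_mul, integral_exp_int]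
  split_ifs <;> simp

/-- The iterated integral is evaluated from the inside out. Each one-variable integration removes
the frequencies that oscillate in that variable and produces a factor 2π, so that only the zero
frequency survives all three. -/
lemma HasSeries.cellMean_eq {D : Params} (hD : D.IsPos) {u : Scalar} {c : Freq → ℂ}
    (h : HasSeries D u c) : cellMean D u = c 0 := by
  obtain ⟨hc, hs⟩ := h
  set P : ℂ := ((2 * Real.pi : ℝ) : ℂ) with hP
  have h3 : ∀ y₁ y₂ : ℝ, HasSum (fun k : Freq =>
      (if k.2 = 0 then c k * P else 0) * Complex.exp (I * (k.1.1 * y₁ : ℝ)) *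
        Complex.exp (I * (k.1.2 * y₂ : ℝ)))
      (∫ t in (0 : ℝ)..(2 * Real.pi), u (cellPoint D y₁ y₂) t) := by
    intro y₁ y₂
    have := hasSum_integral_exp
      (c := fun k : Freq => c k * Complex.exp (I * (k.1.1 * y₁ : ℝ)) *
        Complex.exp (I * (k.1.2 * y₂ : ℝ)))
      (by simpa only [norm_mul, mul_comm I, Complex.norm_exp_ofReal_mul_I, mul_one] using hc)
      (fun k => k.2) (g := fun t => u (cellPoint D y₁ y₂) t)
      (fun t => by
        convert! hs (cellPoint D y₁ y₂) t using 2 with k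
        rw [char_cellPoint hD, smul_eq_mul]
        ring)
    convert! this using 2 with k
    split_ifs <;> ring
  have hc3 : Summable fun k : Freq => ‖if k.2 = 0 then c k * P else 0‖ := by
    refine Summable.of_nonneg_of_le (fun _ => norm_nonneg _) (fun k => ?_) (hc.mul_right ‖P‖)
    split_ifs
    · rw [norm_mul]
    · rw [norm_zero]; positivity
  have h2 : ∀ y₁ : ℝ, HasSum (fun k : Freq =>
      (if k.1.2 = 0 then (if k.2 = 0 then c k * P else 0) * P else 0) *
        Complex.exp (I * (k.1.1 * y₁ : ℝ)))
      (∫ y₂ in (0 : ℝ)..(2 * Real.pi), ∫ t in (0 : ℝ)..(2 * Real.pi),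
        u (cellPoint D y₁ y₂) t) := by
    intro y₁
    have := hasSum_integral_exp
      (c := fun k : Freq => (if k.2 = 0 then c k * P else 0) *
        Complex.exp (I * (k.1.1 * y₁ : ℝ)))
      (by simpa only [norm_mul, mul_comm I, Complex.norm_exp_ofReal_mul_I, mul_one] using hc3)
      (fun k => k.1.2) (h3 y₁)
    convert! this using 2 with k
    split_ifs <;> ring
  have hc2 : Summable fun k : Freq =>
      ‖if k.1.2 = 0 then (if k.2 = 0 then c k * P else 0) * P else 0‖ := by
    refine Summable.of_nonneg_of_le (fun _ => norm_nonneg _) (fun k => ?_) (hc3.mul_right ‖P‖)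
    split_ifs <;> simp <;> positivity
  have h1 := hasSum_integral_exp hc2 (fun k => k.1.1) h2
  have h0 : HasSum (fun k : Freq =>
      if k.1.1 = 0 then (if k.1.2 = 0 then (if k.2 = 0 then c k * P else 0) * P else 0) * P else 0)
      (c 0 * P * P * P) := by
    have := hasSum_single (0 : Freq) (f := fun k : Freq => if k.1.1 = 0 then
      (if k.1.2 = 0 then (if k.2 = 0 then c k * P else 0) * P else 0) * P else 0) (by
      rintro ⟨⟨a, b⟩, m⟩ hk
      simp only [ne_eq, Prod.mk_eq_zero, not_and] at hk
      dsimp only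
      split_ifs <;> simp_all)
    simpa using this
  rw [cellMean, h1.unique h0, hP, Complex.real_smul]
  have : (Real.pi : ℂ) ≠ 0 := by exact_mod_cast Real.pi_ne_zero
  push_cast
  field_simp

namespace HasSeries

variable {D : Params} {u : Scalar} {c : Freq → ℂ}

lemma fourier_eq (hD : D.IsPos) (h : HasSeries D u c) (n : ℤ × ℤ) (m : ℤ) :
    fourier D u n m = c (n, m) := by
  have := (h.mul_char (-n, -m)).cellMean_eq hD
  simp only [zero_sub, Prod.neg_mk, neg_neg] at this
  rw [← this, fourier]
  congr 1
  funext x t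
  rw [char, smul_eq_mul]
  push_cast
  ring_nf

lemma cellMean_cos (hD : D.IsPos) (h : HasSeries D u c) (k : Mode) :
    cellMean D (fun x t => u x t * expMode D (-k.1) x * (Real.cos (k.2 * t) : ℂ)) =
      (c (k.1, k.2) + c (k.1, -k.2)) / 2 := by
  have := (((h.mul_char (-k.1, -(k.2 : ℤ))).add (h.mul_char (-k.1, (k.2 : ℤ)))).const_smul
    (1 / 2)).cellMean_eq hD
  simp only [Pi.smul_apply, Pi.add_apply, zero_sub, Prod.neg_mk, neg_neg, smul_eq_mul] at this
  rw [div_eq_inv_mul, ← one_div, ← this]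
  congr 1
  funext x t
  simp only [Pi.smul_apply, Pi.add_apply, smul_eq_mul, char, Complex.ofReal_cos, Complex.cos]
  push_cast
  ring_nf

lemma cellMean_sin (hD : D.IsPos) (h : HasSeries D u c) (k : Mode) :
    cellMean D (fun x t => u x t * expMode D (-k.1) x * (Real.sin (k.2 * t) : ℂ)) =
      I * (c (k.1, k.2) - c (k.1, -k.2)) / 2 := by
  have := (((h.mul_char (-k.1, -(k.2 : ℤ))).sub (h.mul_char (-k.1, (k.2 : ℤ)))).const_smul
    (I / 2)).cellMean_eq hD
  simp only [Pi.smul_apply, Pi.sub_apply, zero_sub, Prod.neg_mk, neg_neg, smul_eq_mul] at this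
  rw [mul_div_right_comm, ← this]
  congr 1
  funext x t
  simp only [Pi.smul_apply, Pi.sub_apply, smul_eq_mul, char, Complex.ofReal_sin, Complex.sin]
  push_cast
  ring_nf

lemma cosCoeff_eq (hD : D.IsPos) (h : HasSeries D u c) (k : Mode) :
    cosCoeff D u k = (if k.2 = 0 then 1 else 2) * ((c (k.1, k.2) + c (k.1, -k.2)) / 2) := by
  rw [cosCoeff, h.cellMean_cos hD]

lemma sinCoeff_eq (hD : D.IsPos) (h : HasSeries D u c) (k : Mode) :
    sinCoeff D u k = I * (c (k.1, k.2) - c (k.1, -k.2)) := by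
  rw [sinCoeff, h.cellMean_sin hD]
  ring

end HasSeries

/-! ### Products of series -/

lemma norm_triple_le {x : Coef} {r : ℝ} (h₁ : ‖x.1‖ ≤ r) (h₂ : ‖x.2.1‖ ≤ r) (h₃ : ‖x.2.2‖ ≤ r) :
    ‖x‖ ≤ r :=
  max_le h₁ (max_le h₂ h₃)

lemma norm_eta_le (x : Coef) : ‖x.1‖ ≤ ‖x‖ := norm_fst_le x
lemma norm_vel₁_le (x : Coef) : ‖x.2.1‖ ≤ ‖x‖ := (norm_fst_le x.2).trans (norm_snd_le x)
lemma norm_vel₂_le (x : Coef) : ‖x.2.2‖ ≤ ‖x‖ := (norm_snd_le x.2).trans (norm_snd_le x)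

/-- The bilinear map on `ℂ³` underlying `B`. -/
def bilₗ : Coef →ₗ[ℂ] Coef →ₗ[ℂ] Coef :=
  LinearMap.mk₂ ℂ (fun x y : Coef =>
    ((x.2.1 * y.2.1 + x.2.2 * y.2.2) / 2, x.1 * y.2.1, x.1 * y.2.2))
    (fun x x' y => by ext <;> simp <;> ring) (fun a x y => by ext <;> simp <;> ring)
    (fun x y y' => by ext <;> simp <;> ring) (fun a x y => by ext <;> simp <;> ring)

/-- In the maximum norm the factor 1/2 in the first component pays for its two products, which gives
the constant 1. -/
lemma norm_bilₗ_le (x y : Coef) : ‖bilₗ x y‖ ≤ ‖x‖ * ‖y‖ := by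
  have h1 := mul_le_mul (norm_vel₁_le x) (norm_vel₁_le y) (norm_nonneg _) (norm_nonneg _)
  have h2 := mul_le_mul (norm_vel₂_le x) (norm_vel₂_le y) (norm_nonneg _) (norm_nonneg _)
  refine norm_triple_le ?_ ?_ ?_
  · simp only [bilₗ, LinearMap.mk₂_apply, norm_div, Complex.norm_ofNat]
    have h := norm_add_le (x.2.1 * y.2.1) (x.2.2 * y.2.2)
    rw [norm_mul, norm_mul] at h
    linarith
  · simp only [bilₗ, LinearMap.mk₂_apply, norm_mul]
    exact mul_le_mul (norm_eta_le x) (norm_vel₁_le y) (norm_nonneg _) (norm_nonneg _)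
  · simp only [bilₗ, LinearMap.mk₂_apply, norm_mul]
    exact mul_le_mul (norm_eta_le x) (norm_vel₂_le y) (norm_nonneg _) (norm_nonneg _)

/-- `bilₗ` as a continuous bilinear map. -/
def bil : Coef →L[ℂ] Coef →L[ℂ] Coef :=
  bilₗ.mkContinuous₂ 1 (fun x y => by simpa using norm_bilₗ_le x y)

lemma bil_apply (x y : Coef) :
    bil x y = ((x.2.1 * y.2.1 + x.2.2 * y.2.2) / 2, x.1 * y.2.1, x.1 * y.2.2) := rfl

lemma norm_bil_le (x y : Coef) : ‖bil x y‖ ≤ ‖x‖ * ‖y‖ := norm_bilₗ_le x y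

/-- Convolution of coefficient families, with respect to `bil`. -/
def cconv (u v : Freq → Coef) (k : Freq) : Coef := ∑' j, bil (u j) (v (k - j))

/-- The shear `(k, j) ↦ (j, k - j)`. -/
def shear : Freq × Freq ≃ Freq × Freq where
  toFun q := (q.2, q.1 - q.2)
  invFun q := (q.1 + q.2, q.1)
  left_inv q := by simp
  right_inv q := by simp

/-- The substitution (k, j) ↦ (j, k - j) turns a product of two series into a double series whose
fibres over k are convolutions. -/
lemma hasSum_shear {u v : Freq → ℝ} (hu : Summable u) (hv : Summable v)
    (hu0 : ∀ k, 0 ≤ u k) (hv0 : ∀ k, 0 ≤ v k) :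
    HasSum (fun q : Freq × Freq => u q.2 * v (q.1 - q.2)) ((∑' k, u k) * ∑' k, v k) := by
  have h := (hu.mul_of_nonneg hv hu0 hv0)
  have h2 := hu.hasSum.mul hv.hasSum h
  exact (shear.hasSum_iff (f := fun q : Freq × Freq => u q.1 * v q.2)).2 h2

section Weighted

variable {W : Freq → ℝ} {u v : Freq → Coef}

/-- Since k = j + (k - j), submultiplicativity distributes the weight at k over the two factors. -/
lemma summable_weighted_prod (hW : ∀ k, 0 ≤ W k) (hm : ∀ k l, W (k + l) ≤ W k * W l)
    (hu : Summable fun k => W k * ‖u k‖) (hv : Summable fun k => W k * ‖v k‖) :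
    Summable (fun q : Freq × Freq => W q.1 * ‖bil (u q.2) (v (q.1 - q.2))‖) ∧
      ∑' q : Freq × Freq, W q.1 * ‖bil (u q.2) (v (q.1 - q.2))‖ ≤
        (∑' k, W k * ‖u k‖) * ∑' k, W k * ‖v k‖ := by
  have h := hasSum_shear hu hv (fun k => mul_nonneg (hW k) (norm_nonneg _))
    (fun k => mul_nonneg (hW k) (norm_nonneg _))
  have le : ∀ q : Freq × Freq, W q.1 * ‖bil (u q.2) (v (q.1 - q.2))‖ ≤
      W q.2 * ‖u q.2‖ * (W (q.1 - q.2) * ‖v (q.1 - q.2)‖) := fun q => by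
    have h1 := hm q.2 (q.1 - q.2)
    rw [add_sub_cancel] at h1
    calc _ ≤ (W q.2 * W (q.1 - q.2)) * (‖u q.2‖ * ‖v (q.1 - q.2)‖) :=
          mul_le_mul h1 (norm_bil_le _ _) (norm_nonneg _) (mul_nonneg (hW _) (hW _))
      _ = _ := by ring
  have hs : Summable (fun q : Freq × Freq => W q.1 * ‖bil (u q.2) (v (q.1 - q.2))‖) :=
    Summable.of_nonneg_of_le (fun q => mul_nonneg (hW _) (norm_nonneg _)) le h.summable
  exact ⟨hs, (hs.tsum_le_tsum le h.summable).trans_eq h.tsum_eq⟩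

/-- Weighted absolute convergence of a convolution. -/
lemma cconv_weighted (hW : ∀ k, 0 ≤ W k) (hm : ∀ k l, W (k + l) ≤ W k * W l)
    (hu : Summable fun k => W k * ‖u k‖) (hv : Summable fun k => W k * ‖v k‖)
    (hsum : ∀ k, Summable fun j => ‖bil (u j) (v (k - j))‖) :
    Summable (fun k => W k * ‖cconv u v k‖) ∧
      ∑' k, W k * ‖cconv u v k‖ ≤ (∑' k, W k * ‖u k‖) * ∑' k, W k * ‖v k‖ := by
  obtain ⟨hs, hle⟩ := summable_weighted_prod hW hm hu hv
  have hfib := hs.prod_factor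
  have h1 := hs.prod
  have le : ∀ k, W k * ‖cconv u v k‖ ≤ ∑' j, W k * ‖bil (u j) (v (k - j))‖ := fun k => by
    rw [tsum_mul_left]
    exact mul_le_mul_of_nonneg_left (norm_tsum_le_tsum_norm (hsum k)) (hW k)
  have hS : Summable (fun k => W k * ‖cconv u v k‖) :=
    Summable.of_nonneg_of_le (fun q => mul_nonneg (hW _) (norm_nonneg _)) le h1
  refine ⟨hS, (hS.tsum_le_tsum le h1).trans ?_⟩
  rw [← hs.tsum_prod]
  exact hle

end Weighted

section Unweighted

variable {u v : Freq → Coef}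

lemma summable_prod_bil (hu : Summable fun k => ‖u k‖) (hv : Summable fun k => ‖v k‖) :
    Summable (fun q : Freq × Freq => ‖bil (u q.2) (v (q.1 - q.2))‖) := by
  have := (summable_weighted_prod (W := fun _ => 1) (u := u) (v := v) (by simp) (by simp)
    (by simpa using hu) (by simpa using hv)).1
  simpa using this

lemma summable_bil (hu : Summable fun k => ‖u k‖) (hv : Summable fun k => ‖v k‖) (k : Freq) :
    Summable fun j => ‖bil (u j) (v (k - j))‖ :=
  (summable_prod_bil hu hv).prod_factor k

lemma summable_cconv (hu : Summable fun k => ‖u k‖) (hv : Summable fun k => ‖v k‖) :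
    Summable fun k => ‖cconv u v k‖ := by
  simpa using (cconv_weighted (W := fun _ => 1) (by simp) (by simp) (by simpa using hu)
    (by simpa using hv) (summable_bil hu hv)).1

lemma tsum_cconv_le (hu : Summable fun k => ‖u k‖) (hv : Summable fun k => ‖v k‖) :
    ∑' k, ‖cconv u v k‖ ≤ (∑' k, ‖u k‖) * ∑' k, ‖v k‖ := by
  simpa using (cconv_weighted (W := fun _ => 1) (by simp) (by simp) (by simpa using hu)
    (by simpa using hv) (summable_bil hu hv)).2

/-- One absolutely convergent double series is summed in two ways: over the product indices it gives
the product of the two values, and along the fibres of the shear it gives the series with the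
convolution as coefficients. -/
lemma HasSeries.bil {D : Params} {U V : Field} (hU : HasSeries D U u) (hV : HasSeries D V v) :
    HasSeries D (fun x t => Boussinesq.bil (U x t) (V x t)) (cconv u v) := by
  refine ⟨summable_cconv hU.1 hV.1, fun x t => ?_⟩
  have hs : Summable (fun q : Freq × Freq =>
      Boussinesq.bil (char D q.2 x t • u q.2) (char D (q.1 - q.2) x t • v (q.1 - q.2))) := by
    refine Summable.of_norm ((summable_prod_bil hU.1 hV.1).congr fun q => ?_)
    simp [norm_smul, norm_char]
  have h2 : HasSum (fun q : Freq × Freq =>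
      Boussinesq.bil (char D q.1 x t • u q.1) (char D q.2 x t • v q.2))
      (Boussinesq.bil (U x t) (V x t)) := by
    have hs' := (shear.summable_iff (f := fun q : Freq × Freq =>
      Boussinesq.bil (char D q.1 x t • u q.1) (char D q.2 x t • v q.2))).1 hs
    have e := hs'.hasSum.prod_fiberwise
      (fun j => (hV.2 x t).mapL (Boussinesq.bil (char D j x t • u j)))
    have e' : HasSum (fun j => Boussinesq.bil (char D j x t • u j) (V x t))
        (Boussinesq.bil (U x t) (V x t)) := (hU.2 x t).mapL (Boussinesq.bil.flip (V x t))
    rw [← e.unique e']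
    exact hs'.hasSum
  have h3 := (shear.hasSum_iff (f := fun q : Freq × Freq =>
      Boussinesq.bil (char D q.1 x t • u q.1) (char D q.2 x t • v q.2))).2 h2
  refine h3.prod_fiberwise (fun k => ?_)
  have := (((summable_bil hU.1 hV.1 k).of_norm).hasSum).const_smul (char D k x t)
  convert! this using 2 with j
  simp only [Function.comp_apply, shear, Equiv.coe_fn_mk, map_smul, _root_.smul_apply,
    smul_smul, ← char_add]
  simp

lemma HasSeries.quad {D : Params} {U : Field} (hU : HasSeries D U u) :
    HasSeries D (quad U) (cconv u u) := by
  convert! hU.bil hU using 3 with x t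
  simp only [Boussinesq.quad, bil_apply, eta, vel₁, vel₂]
  ring_nf

end Unweighted

/-! ### Series in `cos (m t)` and `sin (m t)` -/

/-- The mode `(n, |m|)` of the frequency `(n, m)`. -/
def absMode (k : Freq) : Mode := (k.1, k.2.natAbs)

/-- A mode comes from at most two frequencies, one with m ≥ 0 and one with m ≤ 0. Counting m = 0 on
both sides only weakens the bound. -/
lemma summable_comp_absMode {c : Mode → ℝ} (hc : Summable c) (h0 : ∀ k, 0 ≤ c k) :
    Summable (fun k : Freq => c (absMode k)) ∧ ∑' k : Freq, c (absMode k) ≤ 2 * ∑' k, c k := by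
  classical
  let i₁ : Mode → Freq := fun k => (k.1, (k.2 : ℤ))
  let i₂ : Mode → Freq := fun k => (k.1, -(k.2 : ℤ))
  have hi₁ : Function.Injective i₁ := by
    rintro ⟨a, b⟩ ⟨a', b'⟩ h
    simpa [i₁] using h
  have hi₂ : Function.Injective i₂ := by
    rintro ⟨a, b⟩ ⟨a', b'⟩ h
    simpa [i₂] using h
  let f₁ : Freq → ℝ := fun k => if 0 ≤ k.2 then c (absMode k) else 0
  let f₂ : Freq → ℝ := fun k => if k.2 ≤ 0 then c (absMode k) else 0
  have s₁ : HasSum f₁ (∑' k, c k) := by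
    rw [← hi₁.hasSum_iff]
    · have : f₁ ∘ i₁ = c := by
        funext k
        simp [f₁, i₁, absMode]
      rw [this]
      exact hc.hasSum
    · rintro ⟨n, m⟩ hx
      simp only [f₁]
      rw [if_neg]
      intro hm
      exact hx ⟨(n, m.natAbs), by simp only [i₁, Prod.mk.injEq, true_and]; omega⟩
  have s₂ : HasSum f₂ (∑' k, c k) := by
    rw [← hi₂.hasSum_iff]
    · have : f₂ ∘ i₂ = c := by
        funext k
        simp [f₂, i₂, absMode]
      rw [this]
      exact hc.hasSum
    · rintro ⟨n, m⟩ hx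
      simp only [f₂]
      rw [if_neg]
      intro hm
      exact hx ⟨(n, m.natAbs), by simp only [i₂, Prod.mk.injEq, true_and]; omega⟩
  have le : ∀ k : Freq, c (absMode k) ≤ f₁ k + f₂ k := fun k => by
    have := h0 (absMode k)
    simp only [f₁, f₂]
    split_ifs <;> linarith
  have hs := Summable.of_nonneg_of_le (fun k => h0 (absMode k)) le (s₁.add s₂).summable
  refine ⟨hs, (hs.tsum_le_tsum le (s₁.add s₂).summable).trans_eq ?_⟩
  rw [(s₁.add s₂).tsum_eq]
  ring

/-- Summation along the fibres {m, -m} of `absMode`; the two points coincide for m = 0, hence the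
case distinction. -/
lemma hasSum_fold {G : Type*} [NormedAddCommGroup G] [CompleteSpace G] {f : Freq → G} {a : G}
    (hf : HasSum f a) :
    HasSum (fun k : Mode => if k.2 = 0 then f (k.1, 0) else f (k.1, k.2) + f (k.1, -k.2)) a := by
  classical
  have h := hf.tsum_fiberwise absMode
  convert! h using 2 with k
  obtain ⟨n, m⟩ := k
  have hset : absMode ⁻¹' {(n, m)} = (({(n, (m : ℤ)), (n, -(m : ℤ))} : Finset Freq) : Set Freq) := by
    ext ⟨n', m'⟩
    simp only [absMode, Set.mem_preimage, Set.mem_singleton_iff, Prod.mk.injEq, Finset.coe_insert,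
      Finset.coe_singleton, Set.mem_insert_iff, ← and_or_left]
    refine and_congr_right fun _ => ?_
    omega
  rw [hset, Finset.tsum_subtype']
  dsimp only
  split_ifs with hm
  · simp [hm]
  · rw [Finset.sum_pair]
    simp only [ne_eq, Prod.mk.injEq, true_and]
    omega

/-- Coefficients, with respect to the characters, of `∑ a_k exp(i p·x) cos(m t)`. -/
def evenExt (a : Mode → ℂ) (k : Freq) : ℂ := (if k.2 = 0 then 1 else 1 / 2) * a (absMode k)

/-- Coefficients, with respect to the characters, of `∑ a_k exp(i p·x) sin(m t)`. -/
def oddExt (a : Mode → ℂ) (k : Freq) : ℂ := -(I / 2) * (k.2.sign : ℂ) * a (absMode k)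

lemma norm_evenExt_le (a : Mode → ℂ) (k : Freq) : ‖evenExt a k‖ ≤ ‖a (absMode k)‖ := by
  rw [evenExt, norm_mul]
  refine mul_le_of_le_one_left (norm_nonneg _) ?_
  split_ifs <;> norm_num

lemma norm_oddExt_le (a : Mode → ℂ) (k : Freq) : ‖oddExt a k‖ ≤ ‖a (absMode k)‖ := by
  rw [oddExt, norm_mul]
  refine mul_le_of_le_one_left (norm_nonneg _) ?_
  rcases Int.sign_trichotomy k.2 with h | h | h <;> rw [h] <;> norm_num

/-- The character series converges absolutely because its coefficients are dominated by those of the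
modes. Folding ±m together turns it into the cosine series, and uniqueness of sums identifies the
values. -/
lemma hasSeries_even {D : Params} {u : Scalar} {a : Mode → ℂ} (ha : Summable fun k => ‖a k‖)
    (h : ∀ x t, HasSum (fun k : Mode => a k * expMode D k.1 x * (Real.cos (k.2 * t) : ℂ)) (u x t)) :
    HasSeries D u (evenExt a) := by
  have hs : Summable fun k => ‖evenExt a k‖ := Summable.of_nonneg_of_le (fun _ => norm_nonneg _)
    (norm_evenExt_le a) (summable_comp_absMode ha fun _ => norm_nonneg _).1
  refine ⟨hs, fun x t => ?_⟩
  have h1 := (summable_char_smul (D := D) hs x t).hasSum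
  have h2 := hasSum_fold h1
  convert! h1 using 1
  refine (h x t).unique ?_
  convert! h2 using 2 with k
  obtain ⟨n, m⟩ := k
  by_cases hm : m = 0
  · subst hm
    simp [evenExt, absMode, char, mul_comm]
  · simp only [evenExt, absMode, char, hm, if_false, Int.natAbs_natCast, Int.natAbs_neg,
      Nat.cast_eq_zero, neg_eq_zero, Complex.ofReal_cos, Complex.cos, smul_eq_mul]
    push_cast
    ring_nf

lemma hasSeries_odd {D : Params} {u : Scalar} {a : Mode → ℂ} (ha : Summable fun k => ‖a k‖)
    (h : ∀ x t, HasSum (fun k : Mode => a k * expMode D k.1 x * (Real.sin (k.2 * t) : ℂ)) (u x t)) :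
    HasSeries D u (oddExt a) := by
  have hs : Summable fun k => ‖oddExt a k‖ := Summable.of_nonneg_of_le (fun _ => norm_nonneg _)
    (norm_oddExt_le a) (summable_comp_absMode ha fun _ => norm_nonneg _).1
  refine ⟨hs, fun x t => ?_⟩
  have h1 := (summable_char_smul (D := D) hs x t).hasSum
  have h2 := hasSum_fold h1
  convert! h1 using 1
  refine (h x t).unique ?_
  convert! h2 using 2 with k
  obtain ⟨n, m⟩ := k
  by_cases hm : m = 0
  · subst hm
    simp [oddExt]
  · have hp : (m : ℤ).sign = 1 := Int.sign_eq_one_of_pos (by omega)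
    have hn : (-(m : ℤ)).sign = -1 := Int.sign_eq_neg_one_of_neg (by omega)
    simp only [oddExt, absMode, char, hm, if_false, Int.natAbs_natCast, Int.natAbs_neg, hp, hn,
      Complex.ofReal_sin, Complex.sin, smul_eq_mul]
    push_cast
    ring_nf

lemma hasSum_cos_of_even {D : Params} {u : Scalar} {c : Freq → ℂ} (h : HasSeries D u c)
    (hc : ∀ n m, c (n, -m) = c (n, m)) (x : ℝ × ℝ) (t : ℝ) :
    HasSum (fun k : Mode => (if k.2 = 0 then 1 else 2) * c (k.1, k.2) * expMode D k.1 x *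
      (Real.cos (k.2 * t) : ℂ)) (u x t) := by
  convert! hasSum_fold (h.2 x t) using 2 with k
  rw [hc]
  obtain ⟨n, m⟩ := k
  by_cases hm : m = 0
  · subst hm
    simp [char, mul_comm]
  · simp only [char, hm, if_false, Complex.ofReal_cos, Complex.cos, smul_eq_mul]
    push_cast
    ring_nf

lemma hasSum_sin_of_odd {D : Params} {u : Scalar} {c : Freq → ℂ} (h : HasSeries D u c)
    (hc : ∀ n m, c (n, -m) = -c (n, m)) (x : ℝ × ℝ) (t : ℝ) :
    HasSum (fun k : Mode => 2 * I * c (k.1, k.2) * expMode D k.1 x *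
      (Real.sin (k.2 * t) : ℂ)) (u x t) := by
  convert! hasSum_fold (h.2 x t) using 2 with k
  rw [hc]
  obtain ⟨n, m⟩ := k
  by_cases hm : m = 0
  · subst hm
    have e : c (n, 0) = 0 := by
      have := hc n 0
      rwa [neg_zero, self_eq_neg] at this
    simp [e]
  · simp only [char, hm, if_false, Complex.ofReal_sin, Complex.sin, smul_eq_mul]
    push_cast
    ring_nf
    simp only [I_sq]
    ring_nf

/-- `(η, v) ↦ (η, -v)`. -/
def refl (x : Coef) : Coef := (x.1, -x.2.1, -x.2.2)

/-- The coefficients of a triple whose first component is even in `t`, and the others odd. -/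
def TimeSym (c : Freq → Coef) : Prop := ∀ n m, c (n, -m) = refl (c (n, m))

namespace HasSeries

variable {D : Params} {U : Field} {c : Freq → Coef}

lemma eta (h : HasSeries D U c) : HasSeries D (eta U) (fun k => (c k).1) :=
  h.map (ContinuousLinearMap.fst ℂ ℂ (ℂ × ℂ))

lemma vel₁ (h : HasSeries D U c) : HasSeries D (vel₁ U) (fun k => (c k).2.1) :=
  h.map ((ContinuousLinearMap.fst ℂ ℂ ℂ).comp (ContinuousLinearMap.snd ℂ ℂ (ℂ × ℂ)))

lemma vel₂ (h : HasSeries D U c) : HasSeries D (vel₂ U) (fun k => (c k).2.2) :=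
  h.map ((ContinuousLinearMap.snd ℂ ℂ ℂ).comp (ContinuousLinearMap.snd ℂ ℂ (ℂ × ℂ)))

lemma ofComponents {c₁ c₂ c₃ : Freq → ℂ} (h₁ : HasSeries D (Boussinesq.eta U) c₁)
    (h₂ : HasSeries D (Boussinesq.vel₁ U) c₂) (h₃ : HasSeries D (Boussinesq.vel₂ U) c₃) :
    HasSeries D U (fun k => (c₁ k, c₂ k, c₃ k)) := by
  refine ⟨Summable.of_nonneg_of_le (fun _ => norm_nonneg _) (fun k => ?_)
    ((h₁.1.add h₂.1).add h₃.1), fun x t => ?_⟩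
  · have := norm_nonneg (c₁ k)
    have := norm_nonneg (c₂ k)
    have := norm_nonneg (c₃ k)
    refine norm_triple_le ?_ ?_ ?_ <;> dsimp only <;> linarith
  · exact (h₁.2 x t).prodMk ((h₂.2 x t).prodMk (h₃.2 x t))

lemma unique_fun {U' : Field} (h : HasSeries D U c) (h' : HasSeries D U' c) : U = U' := by
  funext x t
  exact (h.2 x t).unique (h'.2 x t)

lemma cosCoeff_eta (hD : D.IsPos) (h : HasSeries D U c) (hc : TimeSym c) (k : Mode) :
    cosCoeff D (Boussinesq.eta U) k = (if k.2 = 0 then 1 else 2) * (c (k.1, k.2)).1 := by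
  rw [h.eta.cosCoeff_eq hD, hc]
  simp [refl]

lemma sinCoeff_vel₁ (hD : D.IsPos) (h : HasSeries D U c) (hc : TimeSym c) (k : Mode) :
    sinCoeff D (Boussinesq.vel₁ U) k = 2 * I * (c (k.1, k.2)).2.1 := by
  rw [h.vel₁.sinCoeff_eq hD, hc]
  simp only [refl]
  ring

lemma sinCoeff_vel₂ (hD : D.IsPos) (h : HasSeries D U c) (hc : TimeSym c) (k : Mode) :
    sinCoeff D (Boussinesq.vel₂ U) k = 2 * I * (c (k.1, k.2)).2.2 := by
  rw [h.vel₂.sinCoeff_eq hD, hc]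
  simp only [refl]
  ring

lemma hasSum_cos (hD : D.IsPos) (h : HasSeries D U c) (hc : TimeSym c) (x : ℝ × ℝ) (t : ℝ) :
    HasSum (fun k : Mode => cosCoeff D (Boussinesq.eta U) k * expMode D k.1 x *
      (Real.cos (k.2 * t) : ℂ)) (Boussinesq.eta U x t) := by
  simp only [h.cosCoeff_eta hD hc]
  exact hasSum_cos_of_even h.eta (fun n m => by rw [hc]; rfl) x t

lemma hasSum_sin₁ (hD : D.IsPos) (h : HasSeries D U c) (hc : TimeSym c) (x : ℝ × ℝ) (t : ℝ) :
    HasSum (fun k : Mode => sinCoeff D (Boussinesq.vel₁ U) k * expMode D k.1 x *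
      (Real.sin (k.2 * t) : ℂ)) (Boussinesq.vel₁ U x t) := by
  simp only [h.sinCoeff_vel₁ hD hc]
  exact hasSum_sin_of_odd h.vel₁ (fun n m => by rw [hc]; rfl) x t

lemma hasSum_sin₂ (hD : D.IsPos) (h : HasSeries D U c) (hc : TimeSym c) (x : ℝ × ℝ) (t : ℝ) :
    HasSum (fun k : Mode => sinCoeff D (Boussinesq.vel₂ U) k * expMode D k.1 x *
      (Real.sin (k.2 * t) : ℂ)) (Boussinesq.vel₂ U x t) := by
  simp only [h.sinCoeff_vel₂ hD hc]
  exact hasSum_sin_of_odd h.vel₂ (fun n m => by rw [hc]; rfl) x t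

end HasSeries

/-! ### Weights -/

/-- The submultiplicative weight `(1 + |n₁| + |n₂| + |m|)^s`. -/
def wt (s : ℝ) (k : Freq) : ℝ := (1 + |(k.1.1 : ℝ)| + |(k.1.2 : ℝ)| + |(k.2 : ℝ)|) ^ s

lemma one_le_wt_base (k : Freq) : 1 ≤ 1 + |(k.1.1 : ℝ)| + |(k.1.2 : ℝ)| + |(k.2 : ℝ)| := by
  have := abs_nonneg (k.1.1 : ℝ)
  have := abs_nonneg (k.1.2 : ℝ)
  have := abs_nonneg (k.2 : ℝ)
  linarith

lemma wt_pos (s : ℝ) (k : Freq) : 0 < wt s k :=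
  Real.rpow_pos_of_pos (zero_lt_one.trans_le (one_le_wt_base k)) s

lemma one_le_wt {s : ℝ} (hs : 0 ≤ s) (k : Freq) : 1 ≤ wt s k :=
  Real.one_le_rpow (one_le_wt_base k) hs

/-- The triangle inequality in each index and 1 + x + y ≤ (1 + x)(1 + y) for x, y ≥ 0. This makes
the weighted ℓ¹ space a convolution algebra with constant 1. -/
lemma wt_add_le {s : ℝ} (hs : 0 ≤ s) (k l : Freq) : wt s (k + l) ≤ wt s k * wt s l := by
  rw [wt, wt, wt, ← Real.mul_rpow (zero_le_one.trans (one_le_wt_base k))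
    (zero_le_one.trans (one_le_wt_base l))]
  refine Real.rpow_le_rpow (zero_le_one.trans (one_le_wt_base _)) ?_ hs
  have h1 := abs_add_le (k.1.1 : ℝ) l.1.1
  have h2 := abs_add_le (k.1.2 : ℝ) l.1.2
  have h3 := abs_add_le (k.2 : ℝ) l.2
  have a1 := abs_nonneg (k.1.1 : ℝ)
  have a2 := abs_nonneg (k.1.2 : ℝ)
  have a3 := abs_nonneg (k.2 : ℝ)
  have b1 := abs_nonneg (l.1.1 : ℝ)
  have b2 := abs_nonneg (l.1.2 : ℝ)
  have b3 := abs_nonneg (l.2 : ℝ)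
  simp only [Prod.fst_add, Prod.snd_add, Int.cast_add]
  nlinarith [mul_nonneg (add_nonneg (add_nonneg a1 a2) a3) (add_nonneg (add_nonneg b1 b2) b3)]

lemma psq_nonneg (D : Params) (n : ℤ × ℤ) : 0 ≤ psq D n := by
  unfold psq
  positivity

lemma one_le_weight_base (D : Params) (k : Mode) : 1 ≤ 1 + psq D k.1 + (k.2 : ℝ) ^ 2 := by
  have := psq_nonneg D k.1
  have := sq_nonneg (k.2 : ℝ)
  linarith

lemma weight_pos (D : Params) (s : ℝ) (k : Mode) : 0 < weight D s k :=
  Real.rpow_pos_of_pos (zero_lt_one.trans_le (one_le_weight_base D k)) s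

/-- |p|² is a quadratic form in n, so the Sobolev weight is dominated by the square of the ℓ¹
weight. This direction serves the embedding of weighted ℓ¹ into Q_s. -/
lemma exists_weight_le (D : Params) {s : ℝ} (hs : 0 ≤ s) :
    ∃ K > 0, ∀ k : Mode, weight D s k ≤ K * wt s (k.1, k.2) ^ 2 := by
  set K₀ := 1 + 2 * (D.k₁ ^ 2 * (1 + D.τ₁ ^ 2) + D.k₂ ^ 2 * (1 + D.τ₂ ^ 2)) with hK
  have hK0 : 0 < K₀ := by positivity
  refine ⟨K₀ ^ s, Real.rpow_pos_of_pos hK0 s, fun k => ?_⟩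
  obtain ⟨⟨a, b⟩, m⟩ := k
  have hb := one_le_wt_base ((a, b), (m : ℤ))
  have e : wt s ((a, b), (m : ℤ)) ^ 2 =
      ((1 + |(a : ℝ)| + |(b : ℝ)| + |((m : ℤ) : ℝ)|) ^ 2) ^ s := by
    rw [wt, ← Real.rpow_natCast, ← Real.rpow_natCast, ← Real.rpow_mul (zero_le_one.trans hb),
      ← Real.rpow_mul (zero_le_one.trans hb), mul_comm]
  rw [e, ← Real.mul_rpow hK0.le (by positivity)]
  refine Real.rpow_le_rpow (zero_le_one.trans (one_le_weight_base D _)) ?_ hs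
  have hsq : 1 + (a : ℝ) ^ 2 + (b : ℝ) ^ 2 + (m : ℝ) ^ 2 ≤
      (1 + |(a : ℝ)| + |(b : ℝ)| + |((m : ℤ) : ℝ)|) ^ 2 := by
    have h1 := abs_nonneg (a : ℝ)
    have h2 := abs_nonneg (b : ℝ)
    have h3 := abs_nonneg ((m : ℤ) : ℝ)
    have e3 : ((m : ℤ) : ℝ) = (m : ℝ) := by simp
    rw [← sq_abs (a : ℝ), ← sq_abs (b : ℝ), ← e3, ← sq_abs ((m : ℤ) : ℝ)]
    nlinarith [mul_nonneg h1 h2, mul_nonneg h1 h3, mul_nonneg h2 h3]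
  refine le_trans ?_ (mul_le_mul_of_nonneg_left hsq hK0.le)
  have hp : psq D (a, b) ≤ 2 * (D.k₁ ^ 2 * (1 + D.τ₁ ^ 2) * (a : ℝ) ^ 2 +
      D.k₂ ^ 2 * (1 + D.τ₂ ^ 2) * (b : ℝ) ^ 2) := by
    simp only [psq, p₁, p₂]
    nlinarith [sq_nonneg (D.k₁ * a - D.k₂ * b), sq_nonneg (D.τ₁ * D.k₁ * a + D.τ₂ * D.k₂ * b)]
  have c1 : 0 ≤ D.k₁ ^ 2 * (1 + D.τ₁ ^ 2) := by positivity
  have c2 : 0 ≤ D.k₂ ^ 2 * (1 + D.τ₂ ^ 2) := by positivity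
  have d1 := sq_nonneg (a : ℝ)
  have d2 := sq_nonneg (b : ℝ)
  have d3 := sq_nonneg (m : ℝ)
  dsimp only
  rw [hK]
  nlinarith [mul_nonneg c1 d1, mul_nonneg c1 d2, mul_nonneg c1 d3, mul_nonneg c2 d1,
    mul_nonneg c2 d2, mul_nonneg c2 d3]

/-- The exponent is chosen so that three such factors, one for each of n₁, n₂ and m, make up the
power -2, while |n|^(-4/3) is still summable over ℤ. -/
lemma summable_int_aux : Summable fun n : ℤ => (1 + (n : ℝ) ^ 2) ^ (-(2 / 3) : ℝ) := by
  have h1 : Summable fun n : ℤ => |(n : ℝ)| ^ (-(4 / 3) : ℝ) :=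
    Real.summable_abs_int_rpow (by norm_num)
  have h2 : Summable fun n : ℤ => if n = 0 then (1 : ℝ) else 0 :=
    (hasSum_ite_eq (0 : ℤ) (1 : ℝ)).summable
  refine Summable.of_nonneg_of_le (fun n => by positivity) (fun n => ?_) (h1.add h2)
  by_cases h : n = 0
  · subst h
    simp
  · rw [if_neg h, add_zero]
    have hn : 0 < |(n : ℝ)| := abs_pos.2 (by exact_mod_cast h)
    have e : |(n : ℝ)| ^ (-(4 / 3) : ℝ) = ((n : ℝ) ^ 2) ^ (-(2 / 3) : ℝ) := by
      rw [← sq_abs, ← Real.rpow_natCast, ← Real.rpow_mul hn.le]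
      norm_num
    rw [e]
    refine Real.rpow_le_rpow_of_nonpos ?_ (by linarith) (by norm_num)
    rw [← sq_abs]
    positivity

/-- Nondegeneracy of the lattice: n₁ and n₂ are linear in p, with denominators containing τ₁ + τ₂,
and Cauchy–Schwarz bounds their squares by |p|². -/
lemma sq_int_le {D : Params} (hD : D.IsPos) :
    ∃ K ≥ 1, ∀ n : ℤ × ℤ, (n.1 : ℝ) ^ 2 ≤ K * psq D n ∧ (n.2 : ℝ) ^ 2 ≤ K * psq D n := by
  have h1 := hD.k₁
  have h2 := hD.k₂
  have h3 := add_pos hD.τ₁ hD.τ₂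
  set K₁ := (1 + D.τ₂ ^ 2) / (D.k₁ * (D.τ₁ + D.τ₂)) ^ 2 with hK₁
  set K₂ := (1 + D.τ₁ ^ 2) / (D.k₂ * (D.τ₁ + D.τ₂)) ^ 2 with hK₂
  have k1 : 0 ≤ K₁ := by positivity
  have k2 : 0 ≤ K₂ := by positivity
  refine ⟨1 + K₁ + K₂, by linarith, fun n => ?_⟩
  have hp := psq_nonneg D n
  constructor
  · have : (n.1 : ℝ) ^ 2 ≤ K₁ * psq D n := by
      rw [hK₁, div_mul_eq_mul_div, le_div_iff₀ (by positivity)]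
      have e : (n.1 : ℝ) * (D.k₁ * (D.τ₁ + D.τ₂)) = D.τ₂ * p₁ D n + p₂ D n := by
        simp only [p₁, p₂]; ring
      rw [← mul_pow, e, psq]
      nlinarith [sq_nonneg (p₁ D n - D.τ₂ * p₂ D n)]
    nlinarith [mul_nonneg k2 hp]
  · have : (n.2 : ℝ) ^ 2 ≤ K₂ * psq D n := by
      rw [hK₂, div_mul_eq_mul_div, le_div_iff₀ (by positivity)]
      have e : (n.2 : ℝ) * (D.k₂ * (D.τ₁ + D.τ₂)) = D.τ₁ * p₁ D n - p₂ D n := by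
        simp only [p₁, p₂]; ring
      rw [← mul_pow, e, psq]
      nlinarith [sq_nonneg (p₁ D n + D.τ₁ * p₂ D n)]
    nlinarith [mul_nonneg k1 hp]

/-- For s ≥ 2 the inverse weight is at most the power -2 of its base Y, and each of three factors
Y^(-2/3) is dominated by a summable function of a single index. -/
lemma summable_inv_weight {D : Params} (hD : D.IsPos) {s : ℝ} (hs : 2 ≤ s) :
    Summable fun k : Mode => (weight D s k)⁻¹ := by
  obtain ⟨K, hK, hn⟩ := sq_int_le hD
  set f : ℤ → ℝ := fun n => (1 + (n : ℝ) ^ 2) ^ (-(2 / 3) : ℝ) with hf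
  have hfn : ∀ n, 0 ≤ f n := fun n => by positivity
  have hnat : Summable fun m : ℕ => f m :=
    summable_int_aux.comp_injective Nat.cast_injective
  have h3 := (summable_int_aux.mul_of_nonneg summable_int_aux hfn hfn).mul_of_nonneg hnat
    (fun n => mul_nonneg (hfn _) (hfn _)) (fun n => hfn _)
  have hK0 : 0 < K := by linarith
  refine Summable.of_nonneg_of_le (fun k => (inv_pos.2 (weight_pos D s k)).le) (fun k => ?_)
    (h3.mul_left (K ^ (2 : ℝ)))
  obtain ⟨⟨a, b⟩, m⟩ := k
  set Y := 1 + psq D (a, b) + (m : ℝ) ^ 2 with hY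
  have hY1 : 1 ≤ Y := one_le_weight_base D ((a, b), m)
  have hY0 : 0 < Y := by linarith
  have hp := psq_nonneg D (a, b)
  have hm := sq_nonneg (m : ℝ)
  have aux : ∀ z : ℝ, 0 < z → z ≤ K * Y →
      Y ^ (-(2 / 3) : ℝ) ≤ K ^ (2 / 3 : ℝ) * z ^ (-(2 / 3) : ℝ) := by
    intro z hz hzY
    have h := Real.rpow_le_rpow_of_nonpos hz hzY (show (-(2 / 3) : ℝ) ≤ 0 by norm_num)
    rw [Real.mul_rpow hK0.le hY0.le] at h
    calc Y ^ (-(2 / 3) : ℝ)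
        = K ^ (2 / 3 : ℝ) * (K ^ (-(2 / 3) : ℝ) * Y ^ (-(2 / 3) : ℝ)) := by
          rw [← mul_assoc, ← Real.rpow_add hK0]; norm_num
      _ ≤ _ := by gcongr
  have h1 := aux (1 + (a : ℝ) ^ 2) (by positivity) (by
    have := (hn (a, b)).1
    dsimp only at this
    rw [hY]
    nlinarith)
  have h2 := aux (1 + (b : ℝ) ^ 2) (by positivity) (by
    have := (hn (a, b)).2
    dsimp only at this
    rw [hY]
    nlinarith)
  have h4 := aux (1 + (m : ℝ) ^ 2) (by positivity) (by
    rw [hY]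
    nlinarith)
  have e1 : (weight D s ((a, b), m))⁻¹ ≤ Y ^ (-2 : ℝ) := by
    rw [weight, ← Real.rpow_neg hY0.le]
    exact Real.rpow_le_rpow_of_exponent_le hY1 (by linarith)
  have e2 : Y ^ (-2 : ℝ) = Y ^ (-(2 / 3) : ℝ) * Y ^ (-(2 / 3) : ℝ) * Y ^ (-(2 / 3) : ℝ) := by
    rw [← Real.rpow_add hY0, ← Real.rpow_add hY0]
    norm_num
  have e3 : K ^ (2 : ℝ) = K ^ (2 / 3 : ℝ) * K ^ (2 / 3 : ℝ) * K ^ (2 / 3 : ℝ) := by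
    rw [← Real.rpow_add hK0, ← Real.rpow_add hK0]
    norm_num
  refine e1.trans ?_
  rw [e2, e3]
  simp only [hf, Int.cast_natCast]
  have y0 : 0 ≤ Y ^ (-(2 / 3) : ℝ) := by positivity
  calc _ ≤ (K ^ (2 / 3 : ℝ) * (1 + (a : ℝ) ^ 2) ^ (-(2 / 3) : ℝ)) *
        (K ^ (2 / 3 : ℝ) * (1 + (b : ℝ) ^ 2) ^ (-(2 / 3) : ℝ)) *
        (K ^ (2 / 3 : ℝ) * (1 + (m : ℝ) ^ 2) ^ (-(2 / 3) : ℝ)) := by gcongr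
    _ = _ := by ring

/-! ### Membership in `Q_s` in terms of series -/

lemma summable_sq_of_summable {ι : Type*} {f : ι → ℝ} (hf : Summable f) (h0 : ∀ i, 0 ≤ f i) :
    Summable (fun i => f i ^ 2) ∧ ∑' i, f i ^ 2 ≤ (∑' i, f i) ^ 2 := by
  have le : ∀ i, f i ^ 2 ≤ (∑' i, f i) * f i := fun i => by
    rw [sq]
    exact mul_le_mul_of_nonneg_right (hf.le_tsum i fun j _ => h0 j) (h0 i)
  have hs := Summable.of_nonneg_of_le (fun i => sq_nonneg _) le (hf.mul_left _)
  refine ⟨hs, (hs.tsum_le_tsum le (hf.mul_left _)).trans_eq ?_⟩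
  rw [tsum_mul_left, sq]

/-- A sum of squares of nonnegative terms is at most the square of their sum. In the constant, 12 is
three components times the square of the factor 2 between coefficients of modes and of characters.
-/
lemma memQ_of_series {D : Params} (hD : D.IsPos) {s : ℝ} (hs : 0 ≤ s) :
    ∃ K > 0, ∀ (U : Field) (c : Freq → Coef), HasSeries D U c → TimeSym c →
      Summable (fun k => wt s k * ‖c k‖) →
      MemQ D s U ∧ normQ D s U ≤ K * ∑' k, wt s k * ‖c k‖ := by
  obtain ⟨K, hK, hw⟩ := exists_weight_le D hs
  refine ⟨√(12 * K), by positivity, fun U c hU hc hsum => ?_⟩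
  have hi : Function.Injective fun k : Mode => ((k.1, (k.2 : ℤ)) : Freq) := by
    rintro ⟨a, b⟩ ⟨a', b'⟩ h
    simpa using h
  have h0 : ∀ k, 0 ≤ wt s k * ‖c k‖ := fun k => mul_nonneg (wt_pos s k).le (norm_nonneg _)
  have hm : Summable fun k : Mode => wt s (k.1, k.2) * ‖c (k.1, k.2)‖ := hsum.comp_injective hi
  have hle : ∑' k : Mode, wt s (k.1, k.2) * ‖c (k.1, k.2)‖ ≤ ∑' k, wt s k * ‖c k‖ :=
    hm.tsum_le_tsum_of_inj _ hi (fun k _ => h0 k) (fun _ => le_rfl) hsum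
  obtain ⟨hsq, hsqle⟩ := summable_sq_of_summable hm (fun k => h0 _)
  have bound : ∀ (k : Mode) (z : ℂ), ‖z‖ ≤ 2 * ‖c (k.1, k.2)‖ →
      weight D s k * ‖z‖ ^ 2 ≤ 4 * K * (wt s (k.1, k.2) * ‖c (k.1, k.2)‖) ^ 2 := by
    intro k z hz
    calc weight D s k * ‖z‖ ^ 2
        ≤ (K * wt s (k.1, k.2) ^ 2) * (2 * ‖c (k.1, k.2)‖) ^ 2 :=
          mul_le_mul (hw k) (by gcongr) (by positivity) (by positivity)
      _ = _ := by ring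
  have b1 : ∀ k : Mode, ‖cosCoeff D (eta U) k‖ ≤ 2 * ‖c (k.1, k.2)‖ := fun k => by
    rw [hU.cosCoeff_eta hD hc, norm_mul]
    refine mul_le_mul ?_ (norm_eta_le _) (norm_nonneg _) (by norm_num)
    split_ifs <;> norm_num
  have b2 : ∀ k : Mode, ‖sinCoeff D (vel₁ U) k‖ ≤ 2 * ‖c (k.1, k.2)‖ := fun k => by
    rw [hU.sinCoeff_vel₁ hD hc, norm_mul]
    exact mul_le_mul (by simp) (norm_vel₁_le _) (norm_nonneg _) (by norm_num)
  have b3 : ∀ k : Mode, ‖sinCoeff D (vel₂ U) k‖ ≤ 2 * ‖c (k.1, k.2)‖ := fun k => by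
    rw [hU.sinCoeff_vel₂ hD hc, norm_mul]
    exact mul_le_mul (by simp) (norm_vel₂_le _) (norm_nonneg _) (by norm_num)
  have summ : ∀ a : Mode → ℂ, (∀ k, ‖a k‖ ≤ 2 * ‖c (k.1, k.2)‖) →
      Summable fun k => weight D s k * ‖a k‖ ^ 2 := fun a ha =>
    Summable.of_nonneg_of_le (fun k => mul_nonneg (weight_pos D s k).le (by positivity))
      (fun k => bound k (a k) (ha k)) (hsq.mul_left _)
  refine ⟨⟨⟨summ _ b1, hU.hasSum_cos hD hc⟩, ⟨summ _ b2, hU.hasSum_sin₁ hD hc⟩,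
    ⟨summ _ b3, hU.hasSum_sin₂ hD hc⟩⟩, ?_⟩
  have hle2 : ∀ k : Mode, weight D s k * (‖cosCoeff D (eta U) k‖ ^ 2 +
      ‖sinCoeff D (vel₁ U) k‖ ^ 2 + ‖sinCoeff D (vel₂ U) k‖ ^ 2) ≤
      12 * K * (wt s (k.1, k.2) * ‖c (k.1, k.2)‖) ^ 2 := fun k => by
    have := bound k _ (b1 k)
    have := bound k _ (b2 k)
    have := bound k _ (b3 k)
    linarith
  have hS : Summable fun k : Mode => weight D s k * (‖cosCoeff D (eta U) k‖ ^ 2 +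
      ‖sinCoeff D (vel₁ U) k‖ ^ 2 + ‖sinCoeff D (vel₂ U) k‖ ^ 2) :=
    Summable.of_nonneg_of_le (fun k => mul_nonneg (weight_pos D s k).le (by positivity)) hle2
      (hsq.mul_left _)
  have h00 : 0 ≤ ∑' k, wt s k * ‖c k‖ := tsum_nonneg h0
  rw [normQ]
  refine Real.sqrt_le_iff.2 ⟨by positivity, ?_⟩
  rw [mul_pow, Real.sq_sqrt (by positivity)]
  refine (hS.tsum_le_tsum hle2 (hsq.mul_left _)).trans ?_
  rw [tsum_mul_left]
  refine mul_le_mul_of_nonneg_left (hsqle.trans ?_) (by positivity)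
  exact pow_le_pow_left₀ (tsum_nonneg fun k => h0 _) hle 2

/-- Cauchy–Schwarz against the summable inverse weight. The weight is lost, but the uniqueness
argument needs only absolute summability. In the constant, the 2 counts m and -m, and the 1 ensures
positivity. -/
lemma series_of_memQ {D : Params} (hD : D.IsPos) {s : ℝ} (hs : 2 ≤ s) :
    ∃ K > 0, ∀ U : Field, MemQ D s U →
      ∃ c : Freq → Coef, HasSeries D U c ∧ TimeSym c ∧ ∑' k, ‖c k‖ ≤ K * normQ D s U := by
  have hw := summable_inv_weight hD hs
  have hwpos : ∀ k, 0 < weight D s k := weight_pos D s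
  set S := ∑' k : Mode, (weight D s k)⁻¹ with hS
  have hS0 : 0 ≤ S := tsum_nonneg fun k => (inv_pos.2 (hwpos k)).le
  refine ⟨2 * √S + 1, by positivity, fun U hU => ?_⟩
  obtain ⟨⟨s1, h1⟩, ⟨s2, h2⟩, ⟨s3, h3⟩⟩ := hU
  set a₁ := cosCoeff D (eta U)
  set a₂ := sinCoeff D (vel₁ U)
  set a₃ := sinCoeff D (vel₂ U)
  set q : Mode → ℝ := fun k => ‖a₁ k‖ ^ 2 + ‖a₂ k‖ ^ 2 + ‖a₃ k‖ ^ 2 with hq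
  have q0 : ∀ k, 0 ≤ q k := fun k => by positivity
  have sq : Summable fun k => weight D s k * q k := by
    convert! (s1.add s2).add s3 using 2 with k
    simp only [hq]
    ring
  have hcs := Real.summable_mul_of_Lp_Lq_of_nonneg (p := 2) (q := 2) (by constructor <;> norm_num)
    (f := fun k => √(weight D s k)⁻¹) (g := fun k => √(weight D s k * q k))
    (fun k => Real.sqrt_nonneg _) (fun k => Real.sqrt_nonneg _)
    (by
      convert! hw using 2 with k
      rw [Real.rpow_two, Real.sq_sqrt (inv_pos.2 (hwpos k)).le])
    (by
      convert! sq using 2 with k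
      rw [Real.rpow_two, Real.sq_sqrt (mul_nonneg (hwpos k).le (q0 k))])
  have hcs2 := Real.inner_le_Lp_mul_Lq_tsum_of_nonneg (p := 2) (q := 2)
    (by constructor <;> norm_num)
    (f := fun k => √(weight D s k)⁻¹) (g := fun k => √(weight D s k * q k))
    (fun k => Real.sqrt_nonneg _) (fun k => Real.sqrt_nonneg _)
    (by
      convert! hw using 2 with k
      rw [Real.rpow_two, Real.sq_sqrt (inv_pos.2 (hwpos k)).le])
    (by
      convert! sq using 2 with k
      rw [Real.rpow_two, Real.sq_sqrt (mul_nonneg (hwpos k).le (q0 k))])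
  have e : ∀ k, √(weight D s k)⁻¹ * √(weight D s k * q k) = √(q k) := fun k => by
    rw [← Real.sqrt_mul (inv_pos.2 (hwpos k)).le, inv_mul_cancel_left₀ (hwpos k).ne']
  simp only [e] at hcs hcs2
  have hA : ∑' k, √(q k) ≤ √S * normQ D s U := by
    have := hcs2
    simp only [Real.rpow_two, Real.sq_sqrt (inv_pos.2 (hwpos _)).le,
      Real.sq_sqrt (mul_nonneg (hwpos _).le (q0 _)), ← Real.sqrt_eq_rpow] at this
    exact this
  have n1 : ∀ k, ‖a₁ k‖ ≤ √(q k) := fun k => Real.le_sqrt_of_sq_le (by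
    simp only [hq]; nlinarith [sq_nonneg ‖a₂ k‖, sq_nonneg ‖a₃ k‖])
  have n2 : ∀ k, ‖a₂ k‖ ≤ √(q k) := fun k => Real.le_sqrt_of_sq_le (by
    simp only [hq]; nlinarith [sq_nonneg ‖a₁ k‖, sq_nonneg ‖a₃ k‖])
  have n3 : ∀ k, ‖a₃ k‖ ≤ √(q k) := fun k => Real.le_sqrt_of_sq_le (by
    simp only [hq]; nlinarith [sq_nonneg ‖a₁ k‖, sq_nonneg ‖a₂ k‖])
  have su : ∀ a : Mode → ℂ, (∀ k, ‖a k‖ ≤ √(q k)) → Summable fun k => ‖a k‖ := fun a ha =>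
    Summable.of_nonneg_of_le (fun _ => norm_nonneg _) ha hcs
  have H := HasSeries.ofComponents (hasSeries_even (su _ n1) h1) (hasSeries_odd (su _ n2) h2)
    (hasSeries_odd (su _ n3) h3)
  refine ⟨_, H, fun n m => ?_, ?_⟩
  · simp only [refl, evenExt, oddExt, absMode, Int.natAbs_neg, neg_eq_zero, Int.sign_neg]
    push_cast
    ext <;> simp
  · obtain ⟨t1, t2⟩ := summable_comp_absMode hcs fun k => Real.sqrt_nonneg _
    refine (H.1.tsum_le_tsum (fun k => ?_) t1).trans (t2.trans ?_)
    · exact norm_triple_le ((norm_evenExt_le _ _).trans (n1 _)) ((norm_oddExt_le _ _).trans (n2 _))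
        ((norm_oddExt_le _ _).trans (n3 _))
    · have : 0 ≤ normQ D s U := Real.sqrt_nonneg _
      nlinarith

/-! ### The partial inverse on coefficients -/

/-- `m (1 + ω |p|²)`. -/
def mE (D : Params) (k : Freq) : ℝ := k.2 * (1 + D.ω * psq D k.1)

/-- `p·v`. -/
def pdot (D : Params) (k : Freq) (x : Coef) : ℂ := p₁ D k.1 * x.2.1 + p₂ D k.1 * x.2.2

/-- `Δ` at the frequency `k`. -/
def fdisc (D : Params) (β : ℝ) (k : Freq) : ℝ := mE D k ^ 2 - β ^ 2 * psq D k.1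

lemma fdisc_eq_disc (D : Params) (β : ℝ) (k : Freq) : fdisc D β k = disc D β (absMode k) := by
  simp only [fdisc, disc, mE, absMode, Nat.cast_natAbs, Int.cast_abs, sq_abs, mul_pow]

open Classical in
/-- The coefficient at the frequency `k` of `𝒯 F`, in terms of that of `F`. -/
def tk (D : Params) (β : ℝ) (k : Freq) : Coef →ₗ[ℂ] Coef where
  toFun F :=
    if k.2 ≠ 0 ∧ fdisc D β k ≠ 0 then
      ((mE D k * pdot D k F - β * psq D k.1 * F.1) / fdisc D β k,
        p₁ D k.1 * ((mE D k * F.1 - β * pdot D k F) / fdisc D β k),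
        p₂ D k.1 * ((mE D k * F.1 - β * pdot D k F) / fdisc D β k))
    else if k = 0 then 0 else (F.1 / β, 0, 0)
  map_add' F G := by
    split_ifs
    · simp only [pdot, Prod.fst_add, Prod.snd_add, Prod.mk_add_mk, Prod.mk.injEq]
      refine ⟨by ring, by ring, by ring⟩
    · simp
    · simp [add_div]
  map_smul' a F := by
    split_ifs
    · simp only [pdot, Prod.smul_fst, Prod.smul_snd, Prod.smul_mk, smul_eq_mul, RingHom.id_apply,
        Prod.mk.injEq]
      refine ⟨by ring, by ring, by ring⟩
    · simp
    · simp [mul_div_assoc]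

lemma tk_of_ne {D : Params} {β : ℝ} {k : Freq} (h : k.2 ≠ 0) (h' : fdisc D β k ≠ 0) (F : Coef) :
    tk D β k F = ((mE D k * pdot D k F - β * psq D k.1 * F.1) / fdisc D β k,
        p₁ D k.1 * ((mE D k * F.1 - β * pdot D k F) / fdisc D β k),
        p₂ D k.1 * ((mE D k * F.1 - β * pdot D k F) / fdisc D β k)) := by
  change ite _ _ _ = _
  rw [if_pos ⟨h, h'⟩]

lemma tk_of_eq {D : Params} {β : ℝ} {k : Freq} (h : k.2 = 0 ∨ fdisc D β k = 0) (h0 : k ≠ 0)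
    (F : Coef) : tk D β k F = (F.1 / β, 0, 0) := by
  change ite _ _ _ = _
  rw [if_neg (by tauto), if_neg h0]

lemma tk_zero {D : Params} {β : ℝ} (F : Coef) : tk D β 0 F = 0 := by
  simp [tk]

/-- Outside the regime where m(1 + ω|p|²) dominates, only finitely many frequencies with m ≠ 0 are
left, and finitely many finite-dimensional maps have a common bound. -/
lemma finite_small (D : Params) (hD : D.IsPos) (R : ℝ) :
    {k : Freq | psq D k.1 ≤ R ∧ |(k.2 : ℝ)| ≤ R}.Finite := by
  obtain ⟨K, hK, hn⟩ := sq_int_le hD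
  obtain ⟨N, hN⟩ := exists_nat_ge (K * R + |R| + 1)
  have hbox : (Set.Icc ((-(N : ℤ), -(N : ℤ)), -(N : ℤ)) (((N : ℤ), (N : ℤ)), (N : ℤ)) :
      Set Freq).Finite := Set.finite_Icc _ _
  refine hbox.subset ?_
  rintro ⟨⟨a, b⟩, m⟩ ⟨h1, h2⟩
  dsimp only at h1 h2
  have hR0 : 0 ≤ R := (psq_nonneg D _).trans h1
  have sqb : ∀ z : ℤ, (z : ℝ) ^ 2 ≤ K * psq D (a, b) → -(N : ℤ) ≤ z ∧ z ≤ N := by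
    intro z hz
    have h3 : (z : ℝ) ^ 2 ≤ N := by
      have := abs_nonneg R
      nlinarith
    have h4 : z ^ 2 ≤ (N : ℤ) := by exact_mod_cast h3
    constructor <;> nlinarith
  have h5 : |m| ≤ (N : ℤ) := by
    have h6 : |(m : ℝ)| ≤ N := by
      have := le_abs_self R
      have : 0 ≤ K * R := by positivity
      linarith
    exact_mod_cast h6
  obtain ⟨ha1, ha2⟩ := sqb a (hn (a, b)).1
  obtain ⟨hb1, hb2⟩ := sqb b (hn (a, b)).2
  obtain ⟨hm1, hm2⟩ := abs_le.1 h5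
  exact ⟨⟨⟨ha1, hb1⟩, hm1⟩, ⟨⟨ha2, hb2⟩, hm2⟩⟩

lemma norm_p_le (D : Params) (n : ℤ × ℤ) :
    |p₁ D n| ≤ √(psq D n) ∧ |p₂ D n| ≤ √(psq D n) := by
  constructor <;> refine Real.abs_le_sqrt ?_ <;> unfold psq
  · nlinarith [sq_nonneg (p₂ D n)]
  · nlinarith [sq_nonneg (p₁ D n)]

lemma norm_pdot_le (D : Params) (k : Freq) (x : Coef) :
    ‖pdot D k x‖ ≤ 2 * √(psq D k.1) * ‖x‖ := by
  have h := norm_p_le D k.1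
  have h1 := norm_vel₁_le x
  have h2 := norm_vel₂_le x
  have := mul_le_mul h.1 h1 (norm_nonneg _) (Real.sqrt_nonneg _)
  have := mul_le_mul h.2 h2 (norm_nonneg _) (Real.sqrt_nonneg _)
  refine (norm_add_le _ _).trans ?_
  rw [norm_mul, norm_mul, Complex.norm_real, Complex.norm_real, Real.norm_eq_abs, Real.norm_eq_abs]
  linarith

/-- At frequencies with `2 β |p| ≤ |m| (1 + ω |p|²)`, `𝒯` is bounded by a constant. -/
lemma norm_tk_le_of_large {D : Params} (hD : D.IsPos) {β : ℝ} (hβ : 0 < β) {k : Freq}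
    (hk : k.2 ≠ 0) (hl : 2 * β * √(psq D k.1) ≤ |mE D k|) (F : Coef) :
    ‖tk D β k F‖ ≤ (4 + 4 / D.ω + 4 * β * (1 + 1 / D.ω)) * ‖F‖ := by
  set P := √(psq D k.1) with hP
  have hP0 : 0 ≤ P := Real.sqrt_nonneg _
  have hP2 : P ^ 2 = psq D k.1 := Real.sq_sqrt (psq_nonneg D k.1)
  set e := |mE D k| with he
  have hω := hD.ω
  have hm : (1 : ℝ) ≤ |(k.2 : ℝ)| := by
    have : 1 ≤ |k.2| := Int.one_le_abs hk
    exact_mod_cast this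
  have he1 : 1 + D.ω * P ^ 2 ≤ e := by
    rw [he, mE, abs_mul, hP2, abs_of_nonneg (a := 1 + D.ω * psq D k.1)]
    · have := psq_nonneg D k.1
      nlinarith [mul_nonneg hω.le this]
    · have := psq_nonneg D k.1
      positivity
  have he0 : 1 ≤ e := by nlinarith [mul_nonneg hω.le (sq_nonneg P)]
  -- By hypothesis β²|p|² ≤ e²/4. The denominator is thus at least e²/2, and it suffices to bound
  -- the numerators by multiples of e²‖F‖, as `key` records.
  have hd : e ^ 2 / 2 ≤ fdisc D β k := by
    rw [fdisc, ← sq_abs (mE D k), ← he, ← hP2]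
    nlinarith [mul_nonneg hβ.le hP0]
  have hd0 : 0 < fdisc D β k := by
    have : 0 < e ^ 2 / 2 := by positivity
    linarith
  have hpw : P ^ 2 ≤ (1 / D.ω) * e := by
    rw [one_div, ← div_eq_inv_mul, le_div_iff₀ hω]
    nlinarith
  have hpe : P ≤ (1 + 1 / D.ω) * e := by
    have : 0 ≤ 1 / D.ω := by positivity
    nlinarith [sq_nonneg (P - 1)]
  have hp2e : P ^ 2 ≤ (1 / D.ω) * e ^ 2 := by
    have : 0 ≤ 1 / D.ω := by positivity
    nlinarith
  have hF : 0 ≤ ‖F‖ := norm_nonneg _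
  have hpd := norm_pdot_le D k F
  have h1 := norm_eta_le F
  have hpn := norm_p_le D k.1
  rw [tk_of_ne hk hd0.ne']
  set c := 1 / D.ω with hc
  have hc0 : 0 ≤ c := by positivity
  have e4 : (4 : ℝ) / D.ω = 4 * c := by rw [hc]; ring
  rw [e4]
  have key : ∀ z : ℂ, ‖z‖ ≤ (2 + 2 * c + 2 * β * (1 + c)) * e ^ 2 * ‖F‖ →
      ‖z / (fdisc D β k : ℂ)‖ ≤ (4 + 4 * c + 4 * β * (1 + c)) * ‖F‖ := by
    intro z hz
    rw [norm_div, Complex.norm_real, Real.norm_eq_abs, abs_of_pos hd0, div_le_iff₀ hd0]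
    have : 0 ≤ (4 + 4 * c + 4 * β * (1 + c)) * ‖F‖ := by positivity
    nlinarith
  have hPe : e * P ≤ (1 + c) * e ^ 2 := by nlinarith
  have hv : ‖(mE D k * F.1 - β * pdot D k F : ℂ)‖ ≤ (e + 2 * β * P) * ‖F‖ := by
    refine (norm_sub_le _ _).trans ?_
    rw [norm_mul, norm_mul, Complex.norm_real, Complex.norm_real, Real.norm_eq_abs,
      Real.norm_eq_abs, abs_of_pos hβ, ← he]
    nlinarith
  have hvP : P * ((e + 2 * β * P) * ‖F‖) ≤ (2 + 2 * c + 2 * β * (1 + c)) * e ^ 2 * ‖F‖ := by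
    rw [← mul_assoc]
    refine mul_le_mul_of_nonneg_right ?_ hF
    nlinarith [mul_nonneg hβ.le (sq_nonneg e), mul_nonneg hc0 (sq_nonneg e)]
  refine norm_triple_le (key _ ?_) ?_ ?_
  · refine (norm_sub_le _ _).trans ?_
    rw [norm_mul, norm_mul, norm_mul, Complex.norm_real, Complex.norm_real, Complex.norm_real,
      Real.norm_eq_abs, Real.norm_eq_abs, Real.norm_eq_abs, abs_of_pos hβ, ← he, ← hP2,
      abs_of_nonneg (sq_nonneg P)]
    have i1 : e * ‖pdot D k F‖ ≤ 2 * (1 + c) * e ^ 2 * ‖F‖ := by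
      calc e * ‖pdot D k F‖ ≤ e * (2 * P * ‖F‖) := by gcongr
        _ = 2 * (e * P) * ‖F‖ := by ring
        _ ≤ 2 * ((1 + c) * e ^ 2) * ‖F‖ := by gcongr
        _ = _ := by ring
    have i2 : β * P ^ 2 * ‖F.1‖ ≤ β * (c * e ^ 2) * ‖F‖ := by gcongr
    have i3 : 0 ≤ β * e ^ 2 * ‖F‖ := by positivity
    have i4 : 0 ≤ β * (c * e ^ 2) * ‖F‖ := by positivity
    nlinarith
  · dsimp only
    rw [← mul_div_assoc]
    refine key _ ?_
    rw [norm_mul, Complex.norm_real, Real.norm_eq_abs]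
    exact (mul_le_mul hpn.1 hv (norm_nonneg _) hP0).trans hvP
  · dsimp only
    rw [← mul_div_assoc]
    refine key _ ?_
    rw [norm_mul, Complex.norm_real, Real.norm_eq_abs]
    exact (mul_le_mul hpn.2 hv (norm_nonneg _) hP0).trans hvP

lemma exists_norm_tk_le {D : Params} (hD : D.IsPos) {β : ℝ} (hβ : 0 < β) :
    ∃ K > 0, ∀ k F, ‖tk D β k F‖ ≤ K * ‖F‖ := by
  classical
  have hω := hD.ω
  -- If |m|(1 + ω|p|²) < 2β|p| with |m| ≥ 1, then ω|p| < 2β; and |p| ≤ (1 + 1/ω)(1 + ω|p|²) then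
  -- gives |m| ≤ 2β(1 + 1/ω). Each of the two bounds is one summand of R.
  set R := (2 * β / D.ω) ^ 2 + 2 * β * (1 + 1 / D.ω) with hR
  have hfin := finite_small D hD R
  choose Kf hKf using fun k => (LinearMap.toContinuousLinearMap (tk D β k)).bound
  set S := ∑ k ∈ hfin.toFinset, Kf k with hS
  have hS0 : 0 ≤ S := Finset.sum_nonneg fun k _ => (hKf k).1.le
  have hc0 : 0 < 4 + 4 / D.ω + 4 * β * (1 + 1 / D.ω) := by positivity
  refine ⟨S + (4 + 4 / D.ω + 4 * β * (1 + 1 / D.ω)) + 1 / β, by positivity, fun k F => ?_⟩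
  have hF : 0 ≤ ‖F‖ := norm_nonneg _
  have hb : 0 ≤ 1 / β := by positivity
  by_cases hk : k.2 = 0
  · by_cases h0 : k = 0
    · subst h0
      rw [tk_zero, norm_zero]
      positivity
    · rw [tk_of_eq (Or.inl hk) h0]
      have : ‖((F.1 / β, 0, 0) : Coef)‖ ≤ 1 / β * ‖F‖ := by
        refine norm_triple_le ?_ ?_ ?_
        · rw [norm_div, Complex.norm_real, Real.norm_eq_abs, abs_of_pos hβ, div_eq_inv_mul, one_div]
          exact mul_le_mul_of_nonneg_left (norm_eta_le F) (by positivity)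
        · simp only [norm_zero]; positivity
        · simp only [norm_zero]; positivity
      nlinarith
  · by_cases hl : 2 * β * √(psq D k.1) ≤ |mE D k|
    · have := norm_tk_le_of_large hD hβ hk hl F
      nlinarith
    · push Not at hl
      have hmem : k ∈ hfin.toFinset := by
        rw [Set.Finite.mem_toFinset]
        set P := √(psq D k.1) with hP
        have hP0 : 0 ≤ P := Real.sqrt_nonneg _
        have hP2 : P ^ 2 = psq D k.1 := Real.sq_sqrt (psq_nonneg D k.1)
        have hm : (1 : ℝ) ≤ |(k.2 : ℝ)| := by
          have : 1 ≤ |k.2| := Int.one_le_abs hk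
          exact_mod_cast this
        have he : |mE D k| = |(k.2 : ℝ)| * (1 + D.ω * P ^ 2) := by
          rw [mE, abs_mul, hP2, abs_of_nonneg (a := 1 + D.ω * psq D k.1)]
          have := psq_nonneg D k.1
          positivity
        rw [he] at hl
        have hPw : D.ω * P < 2 * β := by
          by_contra hcon
          push Not at hcon
          nlinarith [mul_nonneg hω.le (sq_nonneg P)]
        have hPw' : P ≤ 2 * β / D.ω := by rw [le_div_iff₀ hω]; linarith
        have hsum : 0 ≤ 2 * β * (1 + 1 / D.ω) := by positivity
        constructor
        · rw [← hP2]
          have := pow_le_pow_left₀ hP0 hPw' 2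
          linarith
        · have h1 : P ≤ (1 + 1 / D.ω) * (1 + D.ω * P ^ 2) := by
            have e1 : (1 + 1 / D.ω) * (1 + D.ω * P ^ 2) =
              1 + D.ω * P ^ 2 + 1 / D.ω + P ^ 2 := by field_simp; ring
            rw [e1]
            have : 0 ≤ 1 / D.ω := by positivity
            nlinarith [sq_nonneg (P - 1), mul_nonneg hω.le (sq_nonneg P)]
          have h2 : 0 < 1 + D.ω * P ^ 2 := by positivity
          have h3 : |(k.2 : ℝ)| ≤ 2 * β * (1 + 1 / D.ω) := by
            by_contra hcon
            push Not at hcon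
            have := mul_lt_mul_of_pos_right hcon h2
            nlinarith
          have := sq_nonneg (2 * β / D.ω)
          linarith
      have h1 := (hKf k).2 F
      have h2 : Kf k ≤ S := Finset.single_le_sum (f := Kf) (fun k _ => (hKf k).1.le) hmem
      have h3 : ‖tk D β k F‖ ≤ Kf k * ‖F‖ := h1
      nlinarith

/-! ### The system and the fixed point problem on coefficients -/

/-- The Boussinesq system for Fourier coefficients. -/
def SeqSol (D : Params) (β : ℝ) (u : Freq → Coef) : Prop :=
  ∀ k, (mE D k * (u k).1 + β * (pdot D k (u k) + pdot D k (cconv u u k)) = 0) ∧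
    (mE D k * (u k).2.1 + β * p₁ D k.1 * ((u k).1 + (cconv u u k).1) = 0) ∧
    (mE D k * (u k).2.2 + β * p₂ D k.1 * ((u k).1 + (cconv u u k).1) = 0)

/-- Each tested equation is I times the corresponding real-coefficient equation, and the quadratic
terms have the convolution as their coefficients. -/
lemma isSolution_iff {D : Params} (hD : D.IsPos) {U : Field} {u : Freq → Coef}
    (hU : HasSeries D U u) (β : ℝ) : IsSolution D β U ↔ SeqSol D β u := by
  have hq := hU.quad
  unfold IsSolution SeqSol
  simp only [hU.eta.fourier_eq hD, hU.vel₁.fourier_eq hD, hU.vel₂.fourier_eq hD,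
    hq.eta.fourier_eq hD, hq.vel₁.fourier_eq hD, hq.vel₂.fourier_eq hD]
  have aux : ∀ {a b : ℂ}, a = I * b → (a = 0 ↔ b = 0) := fun {a b} h => by simp [h]
  conv_rhs => rw [Prod.forall]
  refine forall_congr' fun n => forall_congr' fun m => ?_
  refine and_congr (aux ?_) (and_congr (aux ?_) (aux ?_)) <;>
  · simp only [mE, pdot]
    push_cast
    ring

/-- `μ u + (β + μ) B(u, u)`. -/
def rhs (β μ : ℝ) (u : Freq → Coef) (k : Freq) : Coef := μ • u k + (β + μ) • cconv u u k

/-- `u = X - 𝒯 (μ u + (β + μ) B(u, u))`. -/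
def Fixed (D : Params) (β μ : ℝ) (X u : Freq → Coef) : Prop :=
  ∀ k, u k = X k - tk D β k (rhs β μ u k)

/-- `X` is in the kernel of the linearized operator. -/
def InKer (D : Params) (β : ℝ) (X : Freq → Coef) : Prop :=
  ∀ k, mE D k * (X k).1 + β * pdot D k (X k) = 0 ∧
    mE D k * (X k).2.1 + β * p₁ D k.1 * (X k).1 = 0 ∧
    mE D k * (X k).2.2 + β * p₂ D k.1 * (X k).1 = 0

lemma TimeSym.vel_zero {c : Freq → Coef} (hc : TimeSym c) (n : ℤ × ℤ) :
    (c (n, 0)).2.1 = 0 ∧ (c (n, 0)).2.2 = 0 := by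
  have := hc n 0
  rw [neg_zero] at this
  have h1 := congrArg (fun z => z.2.1) this
  have h2 := congrArg (fun z => z.2.2) this
  simp only [refl, self_eq_neg] at h1 h2
  exact ⟨h1, h2⟩

lemma pdot_p (D : Params) (k : Freq) (a b : ℂ) :
    pdot D k (a, p₁ D k.1 * b, p₂ D k.1 * b) = psq D k.1 * b := by
  simp only [pdot, psq]
  push_cast
  ring

/-- The linearized operator inverts `𝒯`, up to the solvability condition. -/
lemma lin_tk {D : Params} {β : ℝ} (hβ : β ≠ 0) {k : Freq} {F : Coef}
    (h0 : k.2 = 0 → F.2.1 = 0 ∧ F.2.2 = 0)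
    (hs : k.2 ≠ 0 → fdisc D β k = 0 → mE D k * F.1 = β * pdot D k F) :
    mE D k * (tk D β k F).1 + β * pdot D k (tk D β k F) = pdot D k F ∧
    mE D k * (tk D β k F).2.1 + β * p₁ D k.1 * (tk D β k F).1 = p₁ D k.1 * F.1 ∧
    mE D k * (tk D β k F).2.2 + β * p₂ D k.1 * (tk D β k F).1 = p₂ D k.1 * F.1 := by
  have hβ' : (β : ℂ) ≠ 0 := by exact_mod_cast hβ
  by_cases hk : k.2 = 0
  · obtain ⟨h1, h2⟩ := h0 hk
    have e : mE D k = 0 := by simp [mE, hk]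
    by_cases hk0 : k = 0
    · subst hk0
      simp [tk_zero, pdot, e, p₁, p₂]
    · rw [tk_of_eq (Or.inl hk) hk0]
      simp only [pdot, e, h1, h2]
      push_cast
      refine ⟨by ring, by field_simp; ring, by field_simp; ring⟩
  · have hk0 : k ≠ 0 := fun h => hk (by rw [h]; rfl)
    by_cases hd : fdisc D β k = 0
    · rw [tk_of_eq (Or.inr hd) hk0]
      have := hs hk hd
      simp only [pdot] at this ⊢
      refine ⟨?_, by field_simp; ring, by field_simp; ring⟩
      field_simp
      linear_combination this
    · rw [tk_of_ne hk hd]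
      have hd' : (fdisc D β k : ℂ) ≠ 0 := by exact_mod_cast hd
      rw [pdot_p]
      have e : (fdisc D β k : ℂ) = (mE D k : ℂ) ^ 2 - (β : ℂ) ^ 2 * psq D k.1 := by
        simp only [fdisc]
        push_cast
        ring
      refine ⟨?_, ?_, ?_⟩ <;>
      · field_simp
        rw [e]
        ring

lemma pdot_smul (D : Params) (k : Freq) (r : ℝ) (x : Coef) :
    pdot D k (r • x) = r * pdot D k x := by
  simp only [pdot, Prod.smul_fst, Prod.smul_snd, Complex.real_smul]
  ring

lemma pdot_add (D : Params) (k : Freq) (x y : Coef) :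
    pdot D k (x + y) = pdot D k x + pdot D k y := by
  simp only [pdot, Prod.fst_add, Prod.snd_add]
  ring

lemma pdot_sub (D : Params) (k : Freq) (x y : Coef) :
    pdot D k (x - y) = pdot D k x - pdot D k y := by
  simp only [pdot, Prod.fst_sub, Prod.snd_sub]
  ring

lemma rhs_fst (β μ : ℝ) (u : Freq → Coef) (k : Freq) :
    (rhs β μ u k).1 = μ * (u k).1 + (β + μ) * (cconv u u k).1 := by
  simp only [rhs, Prod.fst_add, Prod.smul_fst, Complex.real_smul]
  push_cast
  ring

lemma pdot_rhs (D : Params) (β μ : ℝ) (u : Freq → Coef) (k : Freq) :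
    pdot D k (rhs β μ u k) = μ * pdot D k (u k) + (β + μ) * pdot D k (cconv u u k) := by
  rw [rhs, pdot_add, pdot_smul, pdot_smul]
  push_cast
  ring

/-- Apply the linearized operator to the fixed point equation: it annihilates X, and by `lin_tk` it
turns the 𝒯 term into the nonlinear one. The term μu then combines with the linear part and changes
β into β + μ. -/
lemma seqSol_of_fixed {D : Params} {β μ : ℝ} (hβ : β ≠ 0) {X u : Freq → Coef}
    (hX : InKer D β X) (hu : Fixed D β μ X u)
    (h0 : ∀ k : Freq, k.2 = 0 → (rhs β μ u k).2.1 = 0 ∧ (rhs β μ u k).2.2 = 0)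
    (hs : ∀ k : Freq, k.2 ≠ 0 → fdisc D β k = 0 →
      mE D k * (rhs β μ u k).1 = β * pdot D k (rhs β μ u k)) :
    SeqSol D (β + μ) u := by
  intro k
  obtain ⟨h1, h2, h3⟩ := lin_tk hβ (h0 k) (hs k)
  obtain ⟨x1, x2, x3⟩ := hX k
  have e := hu k
  have e1 : (u k).1 = (X k).1 - (tk D β k (rhs β μ u k)).1 := congrArg Prod.fst e
  have e2 : (u k).2.1 = (X k).2.1 - (tk D β k (rhs β μ u k)).2.1 := congrArg (fun z => z.2.1) e
  have e3 : (u k).2.2 = (X k).2.2 - (tk D β k (rhs β μ u k)).2.2 := congrArg (fun z => z.2.2) e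
  have e4 : pdot D k (u k) = pdot D k (X k) - pdot D k (tk D β k (rhs β μ u k)) := by
    rw [← pdot_sub, ← e]
  rw [pdot_rhs] at h1
  rw [rhs_fst] at h2 h3
  push_cast
  refine ⟨?_, ?_, ?_⟩
  · linear_combination x1 - h1 + (mE D k : ℂ) * e1 + (β : ℂ) * e4
  · linear_combination x2 - h2 + (mE D k : ℂ) * e2 + (β : ℂ) * p₁ D k.1 * e1
  · linear_combination x3 - h3 + (mE D k : ℂ) * e3 + (β : ℂ) * p₂ D k.1 * e1

/-- The linearized operator, away from resonances, is inverted by `𝒯`. -/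
lemma eq_neg_tk {D : Params} (hD : D.IsPos) {β : ℝ} (hβ : β ≠ 0) {k : Freq} (hk0 : k ≠ 0)
    (hk : k.2 = 0 ∨ fdisc D β k ≠ 0) {x F : Coef}
    (h0 : k.2 = 0 → x.2.1 = 0 ∧ x.2.2 = 0)
    (h1 : mE D k * x.1 + β * pdot D k x + pdot D k F = 0)
    (h2 : mE D k * x.2.1 + β * p₁ D k.1 * x.1 + p₁ D k.1 * F.1 = 0)
    (h3 : mE D k * x.2.2 + β * p₂ D k.1 * x.1 + p₂ D k.1 * F.1 = 0) :
    x = - tk D β k F := by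
  have hβ' : (β : ℂ) ≠ 0 := by exact_mod_cast hβ
  by_cases hm : k.2 = 0
  · obtain ⟨v1, v2⟩ := h0 hm
    have e : mE D k = 0 := by simp [mE, hm]
    rw [tk_of_eq (Or.inl hm) hk0]
    obtain ⟨K, hK, hn⟩ := sq_int_le hD
    have hp : psq D k.1 ≠ 0 := by
      intro hp
      obtain ⟨n1, n2⟩ := hn k.1
      rw [hp, mul_zero] at n1 n2
      apply hk0
      have a1 : (k.1.1 : ℝ) = 0 := by nlinarith
      have a2 : (k.1.2 : ℝ) = 0 := by nlinarith
      ext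
      · exact_mod_cast a1
      · exact_mod_cast a2
      · exact hm
    have hpc : ((p₁ D k.1 : ℂ) ^ 2 + (p₂ D k.1 : ℂ) ^ 2) ≠ 0 := by
      have : (psq D k.1 : ℂ) ≠ 0 := by exact_mod_cast hp
      simpa [psq] using this
    rw [e, v1] at h2
    rw [e, v2] at h3
    -- With m = 0 and no velocity, the velocity equations say p(βη + F₁) = 0, and p ≠ 0 here.
    have key : ((p₁ D k.1 : ℂ) ^ 2 + (p₂ D k.1 : ℂ) ^ 2) * (β * x.1 + F.1) = 0 := by
      push_cast at h2 h3
      linear_combination (p₁ D k.1 : ℂ) * h2 + (p₂ D k.1 : ℂ) * h3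
    have := (mul_eq_zero.1 key).resolve_left hpc
    ext
    · simp only [Prod.fst_neg]
      field_simp
      linear_combination this
    · simp [v1]
    · simp [v2]
  · have hd : fdisc D β k ≠ 0 := hk.resolve_left hm
    have hd' : (fdisc D β k : ℂ) ≠ 0 := by exact_mod_cast hd
    have e : (fdisc D β k : ℂ) = (mE D k : ℂ) ^ 2 - (β : ℂ) ^ 2 * psq D k.1 := by
      simp only [fdisc]
      push_cast
      ring
    -- Once the elevation is known, the velocities follow from their own equations on division by
    -- m(1 + ω|p|²).
    have hE : (mE D k : ℂ) ≠ 0 := by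
      have : mE D k ≠ 0 := by
        have h := psq_nonneg D k.1
        have := hD.ω
        exact mul_ne_zero (by exact_mod_cast hm) (by positivity)
      exact_mod_cast this
    have ep : (psq D k.1 : ℂ) = (p₁ D k.1 : ℂ) ^ 2 + (p₂ D k.1 : ℂ) ^ 2 := by
      simp [psq]
    have h4 : (mE D k : ℂ) * pdot D k x + β * psq D k.1 * x.1 + psq D k.1 * F.1 = 0 := by
      rw [ep]
      simp only [pdot]
      linear_combination (p₁ D k.1 : ℂ) * h2 + (p₂ D k.1 : ℂ) * h3
    have e1 : (fdisc D β k : ℂ) * x.1 =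
        -(mE D k * pdot D k F - β * psq D k.1 * F.1) := by
      rw [e]
      linear_combination (mE D k : ℂ) * h1 - β * h4
    rw [tk_of_ne hm hd]
    have r1 : x.1 = -((mE D k * pdot D k F - β * psq D k.1 * F.1) / fdisc D β k) := by
      rw [← neg_div, eq_div_iff hd', mul_comm]
      exact e1
    have r0 : (β * x.1 + F.1 : ℂ) = mE D k * ((mE D k * F.1 - β * pdot D k F) / fdisc D β k) := by
      rw [r1]
      field_simp
      rw [e]
      ring
    ext
    · exact r1
    · simp only [Prod.snd_neg, Prod.fst_neg]
      refine mul_left_cancel₀ hE ?_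
      linear_combination h2 - (p₁ D k.1 : ℂ) * r0
    · simp only [Prod.snd_neg]
      refine mul_left_cancel₀ hE ?_
      linear_combination h3 - (p₂ D k.1 : ℂ) * r0

/-! ### Uniqueness -/

lemma cconv_sub {u v : Freq → Coef} (hu : Summable fun k => ‖u k‖)
    (hv : Summable fun k => ‖v k‖) (hd : Summable fun k => ‖(u - v) k‖) (k : Freq) :
    cconv u u k - cconv v v k = cconv u (u - v) k + cconv (u - v) v k := by
  simp only [cconv]
  rw [← (summable_bil hu hu k).of_norm.tsum_sub (summable_bil hv hv k).of_norm,
    ← (summable_bil hu hd k).of_norm.tsum_add (summable_bil hd hv k).of_norm]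
  congr 1
  funext j
  simp

/-- The difference of two fixed points is 𝒯 of an expression linear in it, so its ℓ¹ norm N
satisfies N ≤ θN with θ < 1. The norms are unweighted in order that one of the fixed points may come
from an arbitrary element of Q_s. -/
lemma fixed_unique {D : Params} {β μ K : ℝ} (hK : ∀ k F, ‖tk D β k F‖ ≤ K * ‖F‖) (hK0 : 0 ≤ K)
    {X u v : Freq → Coef} (hu : Summable fun k => ‖u k‖) (hv : Summable fun k => ‖v k‖)
    (hlt : K * (|μ| + |β + μ| * (∑' k, ‖u k‖ + ∑' k, ‖v k‖)) < 1)
    (fu : Fixed D β μ X u) (fv : Fixed D β μ X v) : u = v := by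
  have hd : Summable fun k => ‖(u - v) k‖ :=
    Summable.of_nonneg_of_le (fun _ => norm_nonneg _) (fun k => norm_sub_le (u k) (v k))
      (hu.add hv)
  have s1 := summable_cconv hu hd
  have s2 := summable_cconv hd hv
  have le : ∀ k, ‖(u - v) k‖ ≤ K * (|μ| * ‖(u - v) k‖ +
      |β + μ| * (‖cconv u (u - v) k‖ + ‖cconv (u - v) v k‖)) := fun k => by
    have e : (u - v) k = - tk D β k (μ • (u - v) k +
        (β + μ) • (cconv u (u - v) k + cconv (u - v) v k)) := by
      rw [← cconv_sub hu hv hd, ← map_neg, Pi.sub_apply]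
      nth_rewrite 1 [fu k, fv k]
      rw [sub_sub_sub_cancel_left, ← map_sub]
      congr 1
      simp only [rhs, smul_sub]
      abel
    calc ‖(u - v) k‖ = ‖tk D β k (μ • (u - v) k +
        (β + μ) • (cconv u (u - v) k + cconv (u - v) v k))‖ := by
          rw [← norm_neg (tk D β k _), ← e]
      _ ≤ _ := (hK k _).trans ?_
    refine mul_le_mul_of_nonneg_left ((norm_add_le _ _).trans ?_) hK0
    rw [norm_smul, norm_smul, Real.norm_eq_abs, Real.norm_eq_abs]
    gcongr
    exact norm_add_le _ _
  have hS := ((hd.mul_left |μ|).add ((s1.add s2).mul_left |β + μ|)).mul_left K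
  have h1 := hd.tsum_le_tsum le hS
  rw [tsum_mul_left, (hd.mul_left _).tsum_add ((s1.add s2).mul_left _), tsum_mul_left,
    tsum_mul_left, s1.tsum_add s2] at h1
  have h2 := tsum_cconv_le hu hd
  have h3 := tsum_cconv_le hd hv
  set N := ∑' k, ‖(u - v) k‖
  have hN : 0 ≤ N := tsum_nonneg fun _ => norm_nonneg _
  have h4 : N ≤ K * (|μ| + |β + μ| * (∑' k, ‖u k‖ + ∑' k, ‖v k‖)) * N := by
    refine h1.trans ?_
    calc _ ≤ K * (|μ| * N + |β + μ| * ((∑' k, ‖u k‖) * N + N * ∑' k, ‖v k‖)) := by gcongr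
      _ = _ := by ring
  have hN0 : N = 0 := by nlinarith
  have h0 := hd.hasSum
  rw [show ∑' k, ‖(u - v) k‖ = 0 from hN0] at h0
  have := (hasSum_zero_iff_of_nonneg (fun k => norm_nonneg ((u - v) k))).1 h0
  funext k
  have := congrFun this k
  simpa [sub_eq_zero] using this

/-! ### Symmetries -/

/-- A symmetry of the system, acting on coefficients by `u ↦ (k ↦ S k (u (ρ k)))`. -/
structure CoefSym (D : Params) (β : ℝ) where
  S : Freq → Coef →L[ℝ] Coef
  ρ : Freq ≃+ Freq
  norm_S : ∀ k x, ‖S k x‖ = ‖x‖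
  bil_S : ∀ j k x y, bil (S j x) (S k y) = S (j + k) (bil x y)
  tk_S : ∀ k x, tk D β k (S k x) = S k (tk D β (ρ k) x)

namespace CoefSym

variable {D : Params} {β : ℝ} (g : CoefSym D β) {u v X : Freq → Coef} {μ : ℝ}

/-- The action of a symmetry. -/
def act (u : Freq → Coef) (k : Freq) : Coef := g.S k (u (g.ρ k))

lemma summable_act (hu : Summable fun k => ‖u k‖) : Summable fun k => ‖g.act u k‖ := by
  simp only [act, g.norm_S]
  exact (g.ρ.toEquiv.summable_iff (f := fun k => ‖u k‖)).2 hu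

lemma tsum_act : ∑' k, ‖g.act u k‖ = ∑' k, ‖u k‖ := by
  simp only [act, g.norm_S]
  exact g.ρ.toEquiv.tsum_eq (fun k => ‖u k‖)

/-- The field `bil_S` takes the symmetry out of each product, and additivity of ρ allows the sum to
be reindexed. -/
lemma cconv_act (hu : Summable fun k => ‖u k‖) (hv : Summable fun k => ‖v k‖) :
    cconv (g.act u) (g.act v) = g.act (cconv u v) := by
  funext k
  simp only [cconv, act]
  have hs : Summable fun j => bil (u j) (v (g.ρ k - j)) := (summable_bil hu hv _).of_norm
  rw [(g.S k).map_tsum hs,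
    ← g.ρ.toEquiv.tsum_eq (fun j => g.S k (bil (u j) (v (g.ρ k - j))))]
  congr 1
  funext j
  rw [g.bil_S]
  simp

lemma rhs_act (hu : Summable fun k => ‖u k‖) : rhs β μ (g.act u) = g.act (rhs β μ u) := by
  funext k
  rw [rhs, g.cconv_act hu hu]
  simp only [act, rhs, map_add, map_smul]

/-- Together with uniqueness this makes a small fixed point inherit every symmetry of its leading
part X. -/
lemma fixed_act (hu : Summable fun k => ‖u k‖) (h : Fixed D β μ X u) :
    Fixed D β μ (g.act X) (g.act u) := by
  intro k
  rw [g.rhs_act hu, act, act, act, h, map_sub, g.tk_S]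

end CoefSym

/-- Multiplication by a unitary character of `ℤ³`. -/
def phaseSym (D : Params) (β : ℝ) (χ : Freq → ℂ) (h1 : ∀ k, ‖χ k‖ = 1)
    (hχ : ∀ j k, χ (j + k) = χ j * χ k) : CoefSym D β where
  S k := (χ k • ContinuousLinearMap.id ℂ Coef).restrictScalars ℝ
  ρ := AddEquiv.refl _
  norm_S k x := by simp [norm_smul, h1]
  bil_S j k x y := by simp [hχ, smul_smul, mul_comm]
  tk_S k x := by simp

/-- Complex conjugation on `ℂ³`. -/
def conjL : Coef →L[ℝ] Coef :=
  (conjCLE : ℂ →L[ℝ] ℂ).prodMap ((conjCLE : ℂ →L[ℝ] ℂ).prodMap (conjCLE : ℂ →L[ℝ] ℂ))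

lemma conjL_apply (x : Coef) : conjL x =
    ((starRingEnd ℂ) x.1, (starRingEnd ℂ) x.2.1, (starRingEnd ℂ) x.2.2) := rfl

lemma tk_conjL (D : Params) (β : ℝ) (k : Freq) (x : Coef) :
    tk D β k (conjL x) = conjL (tk D β k x) := by
  by_cases h : k.2 ≠ 0 ∧ fdisc D β k ≠ 0
  · rw [tk_of_ne h.1 h.2, tk_of_ne h.1 h.2]
    simp [conjL_apply, pdot]
  · by_cases h0 : k = 0
    · subst h0
      simp [tk_zero]
    · have h' : k.2 = 0 ∨ fdisc D β k = 0 := by tauto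
      rw [tk_of_eq h' h0, tk_of_eq h' h0]
      simp [conjL_apply]

/-- Complex conjugation of the coefficients. -/
def conjSym (D : Params) (β : ℝ) : CoefSym D β where
  S _ := conjL
  ρ := AddEquiv.refl _
  norm_S k x := by simp [conjL_apply, Prod.norm_def]
  bil_S j k x y := by simp [conjL_apply, bil_apply, map_ofNat]
  tk_S k x := tk_conjL D β k x

/-- `refl` as a linear map. -/
def reflL : Coef →L[ℝ] Coef :=
  (ContinuousLinearMap.id ℝ ℂ).prodMap
    ((-ContinuousLinearMap.id ℝ ℂ).prodMap (-ContinuousLinearMap.id ℝ ℂ))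

lemma reflL_apply (x : Coef) : reflL x = refl x := rfl

lemma norm_refl (x : Coef) : ‖refl x‖ = ‖x‖ := by simp [refl, Prod.norm_def]

lemma bil_refl (x y : Coef) : bil (refl x) (refl y) = refl (bil x y) := by
  simp [bil_apply, refl]

/-- `(n, m) ↦ (n, -m)`. -/
def timeNeg : Freq ≃+ Freq := (AddEquiv.refl (ℤ × ℤ)).prodCongr (AddEquiv.neg ℤ)

/-- `(n, m) ↦ (-n, m)`. -/
def spaceNeg : Freq ≃+ Freq := (AddEquiv.neg (ℤ × ℤ)).prodCongr (AddEquiv.refl ℤ)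

lemma timeNeg_apply (k : Freq) : timeNeg k = (k.1, -k.2) := rfl
lemma spaceNeg_apply (k : Freq) : spaceNeg k = (-k.1, k.2) := rfl

lemma p₁_neg (D : Params) (n : ℤ × ℤ) : p₁ D (-n) = -p₁ D n := by
  simp only [p₁, Prod.fst_neg, Prod.snd_neg]; push_cast; ring
lemma p₂_neg (D : Params) (n : ℤ × ℤ) : p₂ D (-n) = -p₂ D n := by
  simp only [p₂, Prod.fst_neg, Prod.snd_neg]; push_cast; ring
lemma psq_neg (D : Params) (n : ℤ × ℤ) : psq D (-n) = psq D n := by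
  simp only [psq, p₁_neg, p₂_neg, neg_sq]

lemma tk_reflTime (D : Params) (β : ℝ) (k : Freq) (x : Coef) :
    tk D β k (refl x) = refl (tk D β (timeNeg k) x) := by
  have hE : mE D (timeNeg k) = -mE D k := by simp [mE, timeNeg_apply]
  have hd : fdisc D β (timeNeg k) = fdisc D β k := by
    rw [fdisc, hE, timeNeg_apply, neg_sq, fdisc]
  by_cases h : k.2 ≠ 0 ∧ fdisc D β k ≠ 0
  · rw [tk_of_ne h.1 h.2, tk_of_ne (by simpa [timeNeg_apply] using h.1) (by rw [hd]; exact h.2),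
      hd, hE]
    simp only [refl, pdot, timeNeg_apply, Prod.mk.injEq]
    push_cast
    refine ⟨by ring, by ring, by ring⟩
  · by_cases h0 : k = 0
    · subst h0
      simp [tk_zero, refl]
      rfl
    · have h' : k.2 = 0 ∨ fdisc D β k = 0 := by tauto
      rw [tk_of_eq h' h0, tk_of_eq (by rw [hd]; simpa [timeNeg_apply] using h')
        (by simpa using h0)]
      simp [refl]

lemma tk_reflSpace (D : Params) (β : ℝ) (k : Freq) (x : Coef) :
    tk D β k (refl x) = refl (tk D β (spaceNeg k) x) := by
  have hE : mE D (spaceNeg k) = mE D k := by simp [mE, spaceNeg_apply, psq_neg]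
  have hd : fdisc D β (spaceNeg k) = fdisc D β k := by
    rw [fdisc, hE, spaceNeg_apply, psq_neg, fdisc]
  by_cases h : k.2 ≠ 0 ∧ fdisc D β k ≠ 0
  · rw [tk_of_ne h.1 h.2, tk_of_ne (by simpa [spaceNeg_apply] using h.1) (by rw [hd]; exact h.2),
      hd, hE]
    simp only [refl, pdot, spaceNeg_apply, psq_neg, p₁_neg, p₂_neg, Prod.mk.injEq]
    push_cast
    refine ⟨by ring, by ring, by ring⟩
  · by_cases h0 : k = 0
    · subst h0
      simp [tk_zero, refl]
      rfl
    · have h' : k.2 = 0 ∨ fdisc D β k = 0 := by tauto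
      rw [tk_of_eq h' h0, tk_of_eq (by rw [hd]; simpa [spaceNeg_apply] using h')
        (by simpa using h0)]
      simp [refl]

/-- Reversal of time. -/
def timeSym (D : Params) (β : ℝ) : CoefSym D β where
  S _ := reflL
  ρ := timeNeg
  norm_S _ x := norm_refl x
  bil_S _ _ x y := bil_refl x y
  tk_S k x := tk_reflTime D β k x

/-- Point reflection in space. -/
def spaceSym (D : Params) (β : ℝ) : CoefSym D β where
  S _ := reflL
  ρ := spaceNeg
  norm_S _ x := norm_refl x
  bil_S _ _ x y := bil_refl x y
  tk_S k x := tk_reflSpace D β k x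

lemma refl_refl (x : Coef) : refl (refl x) = x := by simp [refl]

lemma timeSym_act_iff {D : Params} {β : ℝ} {u : Freq → Coef} :
    (timeSym D β).act u = u ↔ TimeSym u := by
  constructor
  · intro h n m
    have h1 : refl (u (n, - -m)) = u (n, -m) := congrFun h (n, -m)
    rw [neg_neg] at h1
    exact h1.symm
  · intro h
    funext ⟨n, m⟩
    change refl (u (n, -m)) = u (n, m)
    rw [h, refl_refl]

lemma TimeSym.cconv {u v : Freq → Coef} (hu : TimeSym u) (hv : TimeSym v)
    (su : Summable fun k => ‖u k‖) (sv : Summable fun k => ‖v k‖) : TimeSym (cconv u v) := by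
  -- The convolution involves neither the lattice nor β, so dummy parameters serve.
  rw [← timeSym_act_iff (D := ⟨0, 0, 0, 0, 0⟩) (β := 0)] at *
  rw [← CoefSym.cconv_act _ su sv, hu, hv]

lemma TimeSym.tk {D : Params} {β : ℝ} {F : Freq → Coef} (hF : TimeSym F) :
    TimeSym (fun k => tk D β k (F k)) := by
  intro n m
  dsimp only
  rw [hF, tk_reflTime]
  simp [timeNeg_apply]

lemma TimeSym.add {u v : Freq → Coef} (hu : TimeSym u) (hv : TimeSym v) : TimeSym (u + v) := by
  intro n m
  simp only [Pi.add_apply, hu n m, hv n m, refl, Prod.fst_add, Prod.snd_add, Prod.mk_add_mk]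
  ext <;> simp <;> ring

lemma TimeSym.smul {u : Freq → Coef} (a : ℂ) (hu : TimeSym u) : TimeSym (a • u) := by
  intro n m
  simp [hu n m, refl]

/-! ### The bifurcating branch, in a Banach space -/

section Branch

open Filter Topology

variable {𝓔 : Type*} [NormedAddCommGroup 𝓔] [NormedSpace ℝ 𝓔]

/-- Parameters `((μ, C), (a₁, a₂))`. -/
abbrev Par := (ℝ × ℝ) × (ℝ × ℝ)

/-- Nonlinear terms in the components of `E + A₁ O₁ + A₂ O₂ + A₁ A₂ D`, where `a_j = A_j²`. -/
def nonlin (B : 𝓔 →L[ℝ] 𝓔 →L[ℝ] 𝓔) (β : ℝ) (y : Par) (z : 𝓔 × 𝓔 × 𝓔 × 𝓔) : 𝓔 × 𝓔 × 𝓔 × 𝓔 :=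
  (y.1.1 • z.1 + (β + y.1.1) • (B z.1 z.1 + y.2.1 • B z.2.1 z.2.1 + y.2.2 • B z.2.2.1 z.2.2.1
      + (y.2.1 * y.2.2) • B z.2.2.2 z.2.2.2),
    y.1.1 • z.2.1 + (β + y.1.1) • (B z.1 z.2.1 + B z.2.1 z.1
      + y.2.2 • (B z.2.2.1 z.2.2.2 + B z.2.2.2 z.2.2.1)),
    y.1.1 • z.2.2.1 + (β + y.1.1) • (B z.1 z.2.2.1 + B z.2.2.1 z.1
      + y.2.1 • (B z.2.1 z.2.2.2 + B z.2.2.2 z.2.1)),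
    y.1.1 • z.2.2.2 + (β + y.1.1) • (B z.1 z.2.2.2 + B z.2.2.2 z.1
      + (B z.2.1 z.2.2.1 + B z.2.2.1 z.2.1)))

/-- The leading terms of the components. -/
def lead (e₀ ξ₁ ξ₂ : 𝓔) (y : Par) : 𝓔 × 𝓔 × 𝓔 × 𝓔 := (y.1.2 • e₀, ξ₁, ξ₂, 0)

/-- The residual of the system for the components. -/
def residual (T : 𝓔 →L[ℝ] 𝓔) (B : 𝓔 →L[ℝ] 𝓔 →L[ℝ] 𝓔) (β : ℝ) (e₀ ξ₁ ξ₂ : 𝓔)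
    (w : Par × (𝓔 × 𝓔 × 𝓔 × 𝓔)) : 𝓔 × 𝓔 × 𝓔 × 𝓔 :=
  w.2 - lead e₀ ξ₁ ξ₂ w.1 +
    (T.prodMap (T.prodMap (T.prodMap T))) (nonlin B β w.1 w.2)

/-- The sum `E + A₁ O₁ + A₂ O₂ + A₁ A₂ D`. -/
def assemble (A₁ A₂ : ℝ) (z : 𝓔 × 𝓔 × 𝓔 × 𝓔) : 𝓔 :=
  z.1 + A₁ • z.2.1 + A₂ • z.2.2.1 + (A₁ * A₂) • z.2.2.2

lemma contDiff_nonlin (B : 𝓔 →L[ℝ] 𝓔 →L[ℝ] 𝓔) (β : ℝ) {n : WithTop ℕ∞} :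
    ContDiff ℝ n (fun w : Par × (𝓔 × 𝓔 × 𝓔 × 𝓔) => nonlin B β w.1 w.2) := by
  unfold nonlin
  fun_prop

lemma contDiff_residual (T : 𝓔 →L[ℝ] 𝓔) (B : 𝓔 →L[ℝ] 𝓔 →L[ℝ] 𝓔) (β : ℝ) (e₀ ξ₁ ξ₂ : 𝓔)
    {n : WithTop ℕ∞} : ContDiff ℝ n (residual T B β e₀ ξ₁ ξ₂) := by
  have := contDiff_nonlin B β (n := n)
  unfold residual lead
  fun_prop

variable (T : 𝓔 →L[ℝ] 𝓔) (B : 𝓔 →L[ℝ] 𝓔 →L[ℝ] 𝓔) (β : ℝ) (e₀ ξ₁ ξ₂ : 𝓔)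

/-- The solution of the system for the components at the parameter `0`. -/
def base : 𝓔 × 𝓔 × 𝓔 × 𝓔 := (0, ξ₁, ξ₂, -(β • T (B ξ₁ ξ₂ + B ξ₂ ξ₁)))

lemma residual_base : residual T B β e₀ ξ₁ ξ₂ (0, base T B β ξ₁ ξ₂) = 0 := by
  simp only [residual, base, lead, nonlin, ContinuousLinearMap.coe_prodMap', Prod.map_apply']
  ext <;> simp

lemma residual_zero (z : 𝓔 × 𝓔 × 𝓔 × 𝓔) : residual T B β e₀ ξ₁ ξ₂ (0, z) =
    (z.1 + β • T (B z.1 z.1), z.2.1 - ξ₁ + β • T (B z.1 z.2.1 + B z.2.1 z.1),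
      z.2.2.1 - ξ₂ + β • T (B z.1 z.2.2.1 + B z.2.2.1 z.1),
      z.2.2.2 + β • T (B z.1 z.2.2.2 + B z.2.2.2 z.1 + (B z.2.1 z.2.2.1 + B z.2.2.1 z.2.1))) := by
  simp only [residual, lead, nonlin, ContinuousLinearMap.coe_prodMap', Prod.map_apply']
  ext <;> simp

/-- The linearization at `base`. -/
def linBase (δ : 𝓔 × 𝓔 × 𝓔 × 𝓔) : 𝓔 × 𝓔 × 𝓔 × 𝓔 :=
  (δ.1, δ.2.1 + β • T (B δ.1 ξ₁ + B ξ₁ δ.1), δ.2.2.1 + β • T (B δ.1 ξ₂ + B ξ₂ δ.1),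
    δ.2.2.2 + β • T (B δ.1 (base T B β ξ₁ ξ₂).2.2.2 + B (base T B β ξ₁ ξ₂).2.2.2 δ.1 +
      (B δ.2.1 ξ₂ + B ξ₁ δ.2.2.1 + (B δ.2.2.1 ξ₁ + B ξ₂ δ.2.1))))

/-- At parameter zero the residual is a quadratic polynomial along any line through `base`, where it
vanishes; the derivative is the coefficient of t. -/
lemma fderiv_residual_base (δ : 𝓔 × 𝓔 × 𝓔 × 𝓔) :
    fderiv ℝ (residual T B β e₀ ξ₁ ξ₂) (0, base T B β ξ₁ ξ₂) (0, δ) =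
      linBase T B β ξ₁ ξ₂ δ := by
  have hd : HasFDerivAt (residual T B β e₀ ξ₁ ξ₂) _ (0, base T B β ξ₁ ξ₂) :=
    ((contDiff_residual T B β e₀ ξ₁ ξ₂ (n := 1)).differentiable (by simp) _).hasFDerivAt
  have hl : HasDerivAt (fun t : ℝ => (((0 : Par), base T B β ξ₁ ξ₂ + t • δ) :
      Par × (𝓔 × 𝓔 × 𝓔 × 𝓔))) (0, δ) 0 := by
    have : HasDerivAt (fun t : ℝ => base T B β ξ₁ ξ₂ + t • δ) δ 0 := by
      simpa using ((hasDerivAt_id (0 : ℝ)).smul_const δ).const_add (base T B β ξ₁ ξ₂)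
    exact (hasDerivAt_const (0 : ℝ) (0 : Par)).prodMk this
  have hc := HasFDerivAt.comp_hasDerivAt_of_eq (0 : ℝ) hd hl (by simp)
  refine hc.unique ?_
  have e : residual T B β e₀ ξ₁ ξ₂ ∘ (fun t : ℝ => (((0 : Par), base T B β ξ₁ ξ₂ + t • δ) :
      Par × (𝓔 × 𝓔 × 𝓔 × 𝓔))) = fun t : ℝ => t • linBase T B β ξ₁ ξ₂ δ + t ^ 2 • (β • T (B δ.1 δ.1),
        β • T (B δ.1 δ.2.1 + B δ.2.1 δ.1), β • T (B δ.1 δ.2.2.1 + B δ.2.2.1 δ.1),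
        β • T (B δ.1 δ.2.2.2 + B δ.2.2.2 δ.1 + (B δ.2.1 δ.2.2.1 + B δ.2.2.1 δ.2.1))) := by
    funext t
    rw [Function.comp_apply, residual_zero]
    simp only [linBase, base, Prod.fst_add, Prod.snd_add, Prod.smul_fst, Prod.smul_snd, map_add, map_smul,
      add_apply, smul_apply, zero_add]
    refine Prod.ext ?_ (Prod.ext ?_ (Prod.ext ?_ ?_)) <;>
    simp only [Prod.fst_add, Prod.snd_add, Prod.smul_fst, Prod.smul_snd, map_neg,
      neg_apply, map_smul, smul_apply, add_apply, map_add] <;> module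
  rw [e]
  have h1 : HasDerivAt (fun t : ℝ => t ^ 2) 0 0 := by simpa using hasDerivAt_pow 2 (0 : ℝ)
  have h2 := ((hasDerivAt_id (0 : ℝ)).smul_const (linBase T B β ξ₁ ξ₂ δ)).add
    (h1.smul_const (β • T (B δ.1 δ.1), β • T (B δ.1 δ.2.1 + B δ.2.1 δ.1),
      β • T (B δ.1 δ.2.2.1 + B δ.2.2.1 δ.1),
      β • T (B δ.1 δ.2.2.2 + B δ.2.2.2 δ.1 + (B δ.2.1 δ.2.2.1 + B δ.2.2.1 δ.2.1))))
  convert! h2 using 1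
  simp

-- E vanishes at the origin, so μE and B(E,E) have no first derivative there, nor has the term with
-- a₁a₂. What remains comes from Ce₀ and from a_j B(O_j, O_j) evaluated at O_j = ξ_j.
variable {T B β e₀ ξ₁ ξ₂} in
lemma hasDerivAt_components_fst {z : Par → 𝓔 × 𝓔 × 𝓔 × 𝓔} (hz : DifferentiableAt ℝ z 0)
    (hz0 : z 0 = base T B β ξ₁ ξ₂)
    (hr : ∀ᶠ y in 𝓝 0, residual T B β e₀ ξ₁ ξ₂ (y, z y) = 0) (y : Par) :
    HasDerivAt (fun t : ℝ => (z (t • y)).1)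
      (y.1.2 • e₀ - β • T (y.2.1 • B ξ₁ ξ₁ + y.2.2 • B ξ₂ ξ₂)) 0 := by
  have hl : HasDerivAt (fun t : ℝ => t • y) y 0 := by
    simpa using (hasDerivAt_id (0 : ℝ)).smul_const y
  have hzl : HasDerivAt (fun t : ℝ => z (t • y)) (fderiv ℝ z 0 y) 0 :=
    HasFDerivAt.comp_hasDerivAt_of_eq (0 : ℝ) hz.hasFDerivAt hl (by simp)
  have ht : Tendsto (fun t : ℝ => t • y) (𝓝 0) (𝓝 0) := by
    have := hl.continuousAt.tendsto
    simpa using this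
  have hE := hzl.fst
  have hO₁ := hzl.snd.fst
  have hO₂ := hzl.snd.snd.fst
  have hD := hzl.snd.snd.snd
  have hid := hasDerivAt_id (0 : ℝ)
  have hB : ∀ {f g : ℝ → 𝓔} {f' g' : 𝓔}, HasDerivAt f f' 0 → HasDerivAt g g' 0 →
      HasDerivAt (fun t => B (f t) (g t)) (B f' (g 0) + B (f 0) g') 0 := fun hf hg =>
    (B.hasFDerivAt.comp_hasDerivAt 0 hf).clm_apply hg
  have key := ((hid.mul_const y.1.2).smul_const e₀).sub (T.hasFDerivAt.comp_hasDerivAt (0 : ℝ)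
    (((hid.mul_const y.1.1).smul hE).add (((hid.mul_const y.1.1).const_add β).smul
      ((((hB hE hE).add ((hid.mul_const y.2.1).smul (hB hO₁ hO₁))).add
        ((hid.mul_const y.2.2).smul (hB hO₂ hO₂))).add
        (((hid.mul_const y.2.1).mul (hid.mul_const y.2.2)).smul (hB hD hD))))))
  have key2 := key.congr_of_eventuallyEq (f₁ := fun t => (z (t • y)).1) (by
    filter_upwards [ht.eventually hr] with t h
    have h1 := congrArg Prod.fst h
    simp only [residual, lead, nonlin, Prod.fst_add, Prod.fst_sub, Prod.fst_zero,
      ContinuousLinearMap.coe_prodMap', Prod.map_apply', Prod.smul_fst, Prod.smul_snd, smul_eq_mul] at h1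
    rw [sub_add, sub_eq_zero] at h1
    exact h1)
  convert! key2 using 1
  simp [hz0, base]

variable [CompleteSpace 𝓔]

/-- The linearization is triangular: the identity in E, then O₁ and O₂ up to terms in E, then D up
to terms in the other three. Successive substitution inverts it without any smallness assumption. -/
lemma isInvertible_fderiv_residual :
    (fderiv ℝ (residual T B β e₀ ξ₁ ξ₂) (0, base T B β ξ₁ ξ₂) ∘L
      .inr ℝ Par (𝓔 × 𝓔 × 𝓔 × 𝓔)).IsInvertible := by
  set L := fderiv ℝ (residual T B β e₀ ξ₁ ξ₂) (0, base T B β ξ₁ ξ₂) ∘L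
    .inr ℝ Par (𝓔 × 𝓔 × 𝓔 × 𝓔) with hL
  have hLa := fun δ => fderiv_residual_base T B β e₀ ξ₁ ξ₂ δ
  have hLd : ∀ δ, L δ = fderiv ℝ (residual T B β e₀ ξ₁ ξ₂) (0, base T B β ξ₁ ξ₂) (0, δ) :=
    fun δ => rfl
  have hker : L.ker = ⊥ := by
    rw [LinearMap.ker_eq_bot']
    rintro ⟨E, O₁, O₂, D⟩ h
    have h' : L (E, O₁, O₂, D) = 0 := h
    rw [hLd, hLa] at h'
    simp only [linBase, Prod.mk_eq_zero] at h'
    obtain ⟨h1, h2, h3, h4⟩ := h'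
    subst h1
    simp only [map_zero, zero_apply, add_zero, smul_zero] at h2 h3
    subst h2 h3
    simp only [map_zero, zero_apply, add_zero, smul_zero] at h4
    subst h4
    rfl
  have hrange : L.range = ⊤ := by
    rw [LinearMap.range_eq_top]
    rintro ⟨r₁, r₂, r₃, r₄⟩
    let O₁ := r₂ - β • T (B r₁ ξ₁ + B ξ₁ r₁)
    let O₂ := r₃ - β • T (B r₁ ξ₂ + B ξ₂ r₁)
    refine ⟨(r₁, O₁, O₂, r₄ - β • T (B r₁ (base T B β ξ₁ ξ₂).2.2.2 +
      B (base T B β ξ₁ ξ₂).2.2.2 r₁ + (B O₁ ξ₂ + B ξ₁ O₂ + (B O₂ ξ₁ + B ξ₂ O₁)))), ?_⟩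
    change L _ = _
    rw [hLd, hLa]
    simp [linBase, O₁, O₂]
  exact ⟨ContinuousLinearEquiv.ofBijective L hker hrange,
    ContinuousLinearEquiv.coe_ofBijective L hker hrange⟩

/-- Smooth dependence of the components on the parameters. -/
lemma exists_components : ∃ z : Par → 𝓔 × 𝓔 × 𝓔 × 𝓔, ContDiffAt ℝ 2 z 0 ∧
    z 0 = base T B β ξ₁ ξ₂ ∧ ∀ᶠ y in 𝓝 0, residual T B β e₀ ξ₁ ξ₂ (y, z y) = 0 := by
  have hc : ContDiffAt ℝ 2 (residual T B β e₀ ξ₁ ξ₂) (0, base T B β ξ₁ ξ₂) :=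
    (contDiff_residual T B β e₀ ξ₁ ξ₂).contDiffAt
  have hi := isInvertible_fderiv_residual T B β e₀ ξ₁ ξ₂
  refine ⟨hc.implicitFunction (by norm_num) hi, hc.contDiffAt_implicitFunction _ hi,
    hc.implicitFunction_apply_self _ hi, ?_⟩
  filter_upwards [hc.eventually_apply_implicitFunction (by norm_num) hi] with y hy
  rw [hy, residual_base]

end Branch

/-! ### The bifurcation functions and their derivative at the origin -/

section Branch

open Filter Topology

variable {𝓔 : Type*} [NormedAddCommGroup 𝓔] [NormedSpace ℝ 𝓔]
  {T : 𝓔 →L[ℝ] 𝓔} {B : 𝓔 →L[ℝ] 𝓔 →L[ℝ] 𝓔} {β : ℝ} {e₀ ξ₁ ξ₂ : 𝓔}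

/-- Expand B and sort by parity in A₁ and A₂: every excess factor is a square, hence a power of a₁
or a₂. The equations for the components therefore involve the amplitudes only through a₁ and a₂. -/
lemma nonlin_assemble {y : Par} {A₁ A₂ : ℝ} (hy : y.2 = (A₁ ^ 2, A₂ ^ 2))
    (z : 𝓔 × 𝓔 × 𝓔 × 𝓔) :
    y.1.1 • assemble A₁ A₂ z + (β + y.1.1) • B (assemble A₁ A₂ z) (assemble A₁ A₂ z) =
      assemble A₁ A₂ (nonlin B β y z) := by
  obtain ⟨⟨μ, C⟩, a⟩ := y
  obtain ⟨E, O₁, O₂, D⟩ := z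
  dsimp only at hy
  subst hy
  simp only [assemble, nonlin, map_add, map_smul, add_apply, smul_apply]
  module

lemma assemble_eq {y : Par} {A₁ A₂ : ℝ} (hy : y.2 = (A₁ ^ 2, A₂ ^ 2))
    {z : 𝓔 × 𝓔 × 𝓔 × 𝓔} (hr : residual T B β e₀ ξ₁ ξ₂ (y, z) = 0) :
    assemble A₁ A₂ z = y.1.2 • e₀ + A₁ • ξ₁ + A₂ • ξ₂ - T (y.1.1 • assemble A₁ A₂ z +
      (β + y.1.1) • B (assemble A₁ A₂ z) (assemble A₁ A₂ z)) := by
  rw [nonlin_assemble hy]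
  have h := congrArg (assemble A₁ A₂) hr
  simp only [residual, lead, assemble, ContinuousLinearMap.coe_prodMap', Prod.map_apply',
    Prod.fst_add, Prod.snd_add, Prod.fst_sub, Prod.snd_sub, Prod.fst_zero, Prod.snd_zero] at h
  simp only [assemble, map_add, map_smul]
  rw [← sub_eq_zero, ← sub_eq_zero.2 h]
  module

/-- The bifurcation functions, one for each resonant direction. -/
def bifFun (ℓ₁ ℓ₂ : 𝓔 →L[ℝ] ℝ) (B : 𝓔 →L[ℝ] 𝓔 →L[ℝ] 𝓔) (β : ℝ) (z : Par → 𝓔 × 𝓔 × 𝓔 × 𝓔)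
    (y : Par) : ℝ × ℝ :=
  (ℓ₁ (nonlin B β y (z y)).2.1, ℓ₂ (nonlin B β y (z y)).2.2.1)

lemma contDiffAt_bif {z : Par → 𝓔 × 𝓔 × 𝓔 × 𝓔} (hz : ContDiffAt ℝ 2 z 0)
    (ℓ₁ ℓ₂ : 𝓔 →L[ℝ] ℝ) : ContDiffAt ℝ 2 (bifFun ℓ₁ ℓ₂ B β z) 0 := by
  have h : ContDiffAt ℝ 2 (fun y => nonlin B β y (z y)) 0 :=
    (contDiff_nonlin B β (n := 2)).contDiffAt.comp (0 : Par) (contDiffAt_id.prodMk hz)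
  unfold bifFun
  fun_prop

lemma bif_zero {z : Par → 𝓔 × 𝓔 × 𝓔 × 𝓔} (hz0 : z 0 = base T B β ξ₁ ξ₂)
    (ℓ₁ ℓ₂ : 𝓔 →L[ℝ] ℝ) : bifFun ℓ₁ ℓ₂ B β z 0 = 0 := by
  simp [bifFun, nonlin, hz0, base]

/-- In the first function O₁ occurs multiplied by μ or paired with E, and the pairing of O₂ with D
is multiplied by a₂. Since μ, E and a₂ vanish at the origin, only E contributes a derivative, while
O_j and D enter through their values. The second function is alike. -/
lemma fderiv_bif {z : Par → 𝓔 × 𝓔 × 𝓔 × 𝓔} (hz : ContDiffAt ℝ 2 z 0)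
    (hz0 : z 0 = base T B β ξ₁ ξ₂)
    (hr : ∀ᶠ y in 𝓝 0, residual T B β e₀ ξ₁ ξ₂ (y, z y) = 0) (ℓ₁ ℓ₂ : 𝓔 →L[ℝ] ℝ) (y : Par)
    {E' D₀ : 𝓔} (hE' : E' = y.1.2 • e₀ - β • T (y.2.1 • B ξ₁ ξ₁ + y.2.2 • B ξ₂ ξ₂))
    (hD₀ : D₀ = -(β • T (B ξ₁ ξ₂ + B ξ₂ ξ₁))) :
    fderiv ℝ (bifFun ℓ₁ ℓ₂ B β z) 0 y =
      (ℓ₁ (y.1.1 • ξ₁ + β • (B E' ξ₁ + B ξ₁ E' + y.2.2 • (B ξ₂ D₀ + B D₀ ξ₂))),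
        ℓ₂ (y.1.1 • ξ₂ + β • (B E' ξ₂ + B ξ₂ E' + y.2.1 • (B ξ₁ D₀ + B D₀ ξ₁)))) := by
  have hzd : DifferentiableAt ℝ z 0 := hz.differentiableAt (by norm_num)
  have hl : HasDerivAt (fun t : ℝ => t • y) y 0 := by
    simpa using (hasDerivAt_id (0 : ℝ)).smul_const y
  have hzl : HasDerivAt (fun t : ℝ => z (t • y)) (fderiv ℝ z 0 y) 0 :=
    HasFDerivAt.comp_hasDerivAt_of_eq (0 : ℝ) hzd.hasFDerivAt hl (by simp)
  have hE := hasDerivAt_components_fst hzd hz0 hr y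
  rw [← hE'] at hE
  have hO₁ := hzl.snd.fst
  have hO₂ := hzl.snd.snd.fst
  have hD := hzl.snd.snd.snd
  have hid := hasDerivAt_id (0 : ℝ)
  have hB : ∀ {f g : ℝ → 𝓔} {f' g' : 𝓔}, HasDerivAt f f' 0 → HasDerivAt g g' 0 →
      HasDerivAt (fun t => B (f t) (g t)) (B f' (g 0) + B (f 0) g') 0 := fun hf hg =>
    (B.hasFDerivAt.comp_hasDerivAt 0 hf).clm_apply hg
  have k₁ := ℓ₁.hasFDerivAt.comp_hasDerivAt (0 : ℝ)
    (((hid.mul_const y.1.1).smul hO₁).add (((hid.mul_const y.1.1).const_add β).smul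
      (((hB hE hO₁).add (hB hO₁ hE)).add
        ((hid.mul_const y.2.2).smul ((hB hO₂ hD).add (hB hD hO₂))))))
  have k₂ := ℓ₂.hasFDerivAt.comp_hasDerivAt (0 : ℝ)
    (((hid.mul_const y.1.1).smul hO₂).add (((hid.mul_const y.1.1).const_add β).smul
      (((hB hE hO₂).add (hB hO₂ hE)).add
        ((hid.mul_const y.2.1).smul ((hB hO₁ hD).add (hB hD hO₁))))))
  have hb : HasDerivAt (fun t : ℝ => bifFun ℓ₁ ℓ₂ B β z (t • y)) (fderiv ℝ (bifFun ℓ₁ ℓ₂ B β z) 0 y) 0 :=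
    HasFDerivAt.comp_hasDerivAt_of_eq (0 : ℝ)
      (((contDiffAt_bif hz ℓ₁ ℓ₂).differentiableAt (by norm_num)).hasFDerivAt) hl (by simp)
  refine hb.unique ?_
  convert! k₁.prodMk k₂ using 1
  have hzD : (z 0).2.2.2 = D₀ := by rw [hz0, hD₀]; rfl
  have hz1 : (z 0).1 = 0 := by rw [hz0]; rfl
  have hz2 : (z 0).2.1 = ξ₁ := by rw [hz0]; rfl
  have hz3 : (z 0).2.2.1 = ξ₂ := by rw [hz0]; rfl
  simp [hzD, hz1, hz2, hz3]

end Branch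

/-! ### Selection of the amplitudes -/

section Amplitudes

open Filter Topology Asymptotics

/-- A `C²` function is approximated to second order by its linear part. -/
lemma isBigO_sq_of_contDiffAt {E F : Type*} [NormedAddCommGroup E] [NormedSpace ℝ E]
    [NormedAddCommGroup F] [NormedSpace ℝ F] {f : E → F} (hf : ContDiffAt ℝ 2 f 0)
    (h0 : f 0 = 0) :
    ∃ K > 0, ∃ r > 0, ∀ y, ‖y‖ < r → ‖f y - fderiv ℝ f 0 y‖ ≤ K * ‖y‖ ^ 2 := by
  have h1 : ContDiffAt ℝ 1 (fderiv ℝ f) 0 := hf.fderiv_right (by norm_num)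
  obtain ⟨K, s, hs, hL⟩ := h1.exists_lipschitzOnWith
  have hd : ∀ᶠ y in 𝓝 (0 : E), DifferentiableAt ℝ f y :=
    (hf.eventually (by simp)).mono fun y hy => hy.differentiableAt (by norm_num)
  obtain ⟨r, hr, hball⟩ := Metric.eventually_nhds_iff_ball.1 (hd.and hs)
  refine ⟨K + 1, by positivity, r, hr, fun y hy => ?_⟩
  have hsub : Metric.closedBall (0 : E) ‖y‖ ⊆ Metric.ball 0 r :=
    Metric.closedBall_subset_ball hy
  have hmem0 : (0 : E) ∈ s := (hball 0 (Metric.mem_ball_self hr)).2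
  have := (convex_closedBall (0 : E) ‖y‖).norm_image_sub_le_of_norm_fderiv_le' (𝕜 := ℝ) (f := f)
    (φ := fderiv ℝ f 0) (C := K * ‖y‖) (fun x hx => (hball x (hsub hx)).1)
    (fun x hx => by
      have h := hL.dist_le_mul x (hball x (hsub hx)).2 0 hmem0
      rw [dist_eq_norm, dist_zero_right] at h
      refine h.trans (mul_le_mul_of_nonneg_left ?_ K.2)
      simpa using hx)
    (x := 0) (y := y) (by simp) (by simp)
  rw [h0, sub_zero, sub_zero] at this
  refine this.trans ?_
  have := sq_nonneg ‖y‖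
  have e : (K : ℝ) * ‖y‖ * ‖y‖ = K * ‖y‖ ^ 2 := by ring
  rw [e]
  linarith

end Amplitudes

section Amplitudes

open Filter Topology

/-- Multiplication by κ makes the slope κ² whatever the sign of κ; the endpoint values then straddle
zero and the intermediate value theorem applies. -/
lemma exists_zero_of_approx {g : ℝ → ℝ} {κ α δ : ℝ} (hδ : 0 ≤ δ)
    (hc : ContinuousOn g (Set.Icc (α - δ) (α + δ)))
    (hg : ∀ t ∈ Set.Icc (α - δ) (α + δ), |g t - κ * (t - α)| ≤ |κ| * δ) (hκ : κ ≠ 0) :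
    ∃ t ∈ Set.Icc (α - δ) (α + δ), g t = 0 := by
  have hle : α - δ ≤ α + δ := by linarith
  have h1 := hg _ (Set.left_mem_Icc.2 hle)
  have h2 := hg _ (Set.right_mem_Icc.2 hle)
  have hc' : ContinuousOn (fun t => κ * g t) (Set.Icc (α - δ) (α + δ)) := hc.const_smul κ
  have a1 : |κ * (g (α - δ) - κ * (α - δ - α))| ≤ |κ| * (|κ| * δ) := by
    rw [abs_mul]; gcongr
  have a2 : |κ * (g (α + δ) - κ * (α + δ - α))| ≤ |κ| * (|κ| * δ) := by
    rw [abs_mul]; gcongr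
  have e : |κ| * (|κ| * δ) = κ ^ 2 * δ := by rw [← mul_assoc, abs_mul_abs_self]; ring
  rw [e] at a1 a2
  have b1 := (abs_le.1 a1).2
  have b2 := (abs_le.1 a2).1
  obtain ⟨t, ht, h0⟩ := intermediate_value_Icc hle hc'
    (show (0 : ℝ) ∈ Set.Icc (κ * g (α - δ)) (κ * g (α + δ)) by constructor <;> nlinarith)
  exact ⟨t, ht, (mul_eq_zero.1 h0).resolve_left hκ⟩

lemma norm_par_le {μ C a b r s : ℝ} (h1 : |μ| + |C| ≤ r) (ha : |a| ≤ s) (hb : |b| ≤ s)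
    (hs : 0 ≤ s) : ‖(((μ, C), (a, b)) : Par)‖ ≤ r + s := by
  have := abs_nonneg μ
  have := abs_nonneg C
  refine max_le (max_le ?_ ?_) (max_le ?_ ?_) <;> simp only [Real.norm_eq_abs] <;> linarith

-- The implicit function theorem gives the only small zero (s₁, s₂) of h at (μ, C), and it lies
-- within M₀r² of (α₁, α₂), where r = |μ| + |C|. If both s_j are positive, they are the squares
-- sought. Otherwise there is no small positive zero, and some a_j is set to 0. If both α_j are at
-- most Mr², both a_j are 0. If just one is larger, the other is at most M₀r²; as the ratio of the
-- α_j does not depend on (μ, C), the small one must vanish identically. The large one is then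
-- approximated by a zero of the remaining equation on the axis.
set_option maxHeartbeats 1600000 in
theorem exists_amplitudes {h : Par → ℝ × ℝ} (hc : ContDiffAt ℝ 2 h 0) (h0 : h 0 = 0)
    {β c₁ c₂ l₁ l₂ l₃ : ℝ} (hβ : 0 < β) (hc₁ : 0 < c₁) (hc₂ : 0 < c₂)
    (hdet : l₁ * l₃ - l₂ ^ 2 ≠ 0)
    (hd : ∀ y : Par, fderiv ℝ h 0 y =
      ((c₁ * (2 * y.1.1 + y.1.2 * β) - β * (l₁ * y.2.1 + l₂ * y.2.2)) / 2,
        (c₂ * (2 * y.1.1 + y.1.2 * β) - β * (l₂ * y.2.1 + l₃ * y.2.2)) / 2)) :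
    ∃ ρ > 0, ∃ ε > 0, ∃ M > 0, ∀ μ C α₁ α₂ : ℝ, |μ| + |C| < ε →
      α₁ = (2 * μ + C * β) * (l₃ * c₁ - l₂ * c₂) / (β * (l₁ * l₃ - l₂ ^ 2)) →
      α₂ = (2 * μ + C * β) * (l₁ * c₂ - l₂ * c₁) / (β * (l₁ * l₃ - l₂ ^ 2)) →
      0 ≤ α₁ → 0 ≤ α₂ →
      ∃ a₁ a₂ : ℝ, 0 ≤ a₁ ∧ 0 ≤ a₂ ∧ |a₁ - α₁| ≤ M * (|μ| + |C|) ^ 2 ∧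
        |a₂ - α₂| ≤ M * (|μ| + |C|) ^ 2 ∧
        a₁ ≤ M * (|μ| + |C|) ∧ a₂ ≤ M * (|μ| + |C|) ∧
        (a₁ = 0 ∨ (h ((μ, C), (a₁, a₂))).1 = 0) ∧ (a₂ = 0 ∨ (h ((μ, C), (a₁, a₂))).2 = 0) ∧
        ∀ b₁ b₂ : ℝ, 0 < b₁ → b₁ < ρ → 0 < b₂ → b₂ < ρ → h ((μ, C), (b₁, b₂)) = 0 →
          b₁ = a₁ ∧ b₂ = a₂ := by
  generalize hdet'_ : l₁ * l₃ - l₂ ^ 2 = det at *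
  have hdet' := hdet'_.symm
  -- the implicit function
  have hinv : (fderiv ℝ h 0 ∘L .inr ℝ (ℝ × ℝ) (ℝ × ℝ)).IsInvertible := by
    set L := fderiv ℝ h 0 ∘L .inr ℝ (ℝ × ℝ) (ℝ × ℝ) with hL
    have hLa : ∀ a, L a = fderiv ℝ h 0 (0, a) := fun a => rfl
    have hker : L.ker = ⊥ := by
      rw [LinearMap.ker_eq_bot']
      rintro ⟨a, b⟩ hab
      have hab' : L (a, b) = 0 := hab
      rw [hLa, hd] at hab'
      simp only [Prod.fst_zero, Prod.snd_zero, mul_zero, zero_mul, add_zero, zero_sub,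
        Prod.mk_eq_zero] at hab'
      obtain ⟨e1, e2⟩ := hab'
      have f1 : l₁ * a + l₂ * b = 0 := by
        have : β * (l₁ * a + l₂ * b) = 0 := by linarith
        exact (mul_eq_zero.1 this).resolve_left hβ.ne'
      have f2 : l₂ * a + l₃ * b = 0 := by
        have : β * (l₂ * a + l₃ * b) = 0 := by linarith
        exact (mul_eq_zero.1 this).resolve_left hβ.ne'
      have g1 : det * a = 0 := by rw [hdet']; linear_combination l₃ * f1 - l₂ * f2
      have g2 : det * b = 0 := by rw [hdet']; linear_combination l₁ * f2 - l₂ * f1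
      rw [(mul_eq_zero.1 g1).resolve_left hdet, (mul_eq_zero.1 g2).resolve_left hdet]
      rfl
    have hrange : L.range = ⊤ := LinearMap.ker_eq_bot_iff_range_eq_top.1 hker
    exact ⟨ContinuousLinearEquiv.ofBijective L hker hrange,
      ContinuousLinearEquiv.coe_ofBijective L hker hrange⟩
  have hc0 : ContDiffAt ℝ 2 h ((0 : ℝ × ℝ), (0 : ℝ × ℝ)) := hc
  obtain ⟨ψ, hψ⟩ : ∃ ψ, ψ = hc0.implicitFunction (by norm_num) hinv := ⟨_, rfl⟩
  have hψ0 : ψ 0 = 0 := by rw [hψ]; exact hc0.implicitFunction_apply_self (by norm_num) hinv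
  have hψd : DifferentiableAt ℝ ψ 0 := by
    rw [hψ]
    exact (hc0.contDiffAt_implicitFunction (by norm_num) hinv).differentiableAt (by norm_num)
  have hψz : ∀ᶠ x in 𝓝 (0 : ℝ × ℝ), h (x, ψ x) = 0 := by
    have := hc0.eventually_apply_implicitFunction (by norm_num) hinv
    rw [← hψ] at this
    simpa [h0, Prod.mk_zero_zero] using this
  have hψu : ∀ᶠ v in 𝓝 (0 : Par), h v = 0 ↔ ψ v.1 = v.2 := by
    have := hc0.eventually_apply_eq_iff_implicitFunction (by norm_num) hinv
    rw [← hψ] at this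
    simpa [h0, Prod.mk_zero_zero] using this
  obtain ⟨Kψ, hKψ⟩ := hψd.hasFDerivAt.isBigO_sub.bound
  simp only [hψ0, sub_zero] at hKψ
  obtain ⟨r₁, hr₁, hb₁⟩ := Metric.eventually_nhds_iff_ball.1 (hKψ.and hψz)
  obtain ⟨r₂, hr₂, hb₂⟩ := Metric.eventually_nhds_iff_ball.1 hψu
  obtain ⟨r₃, hr₃, hb₃⟩ := Metric.eventually_nhds_iff_ball.1 (hc.eventually (by simp))
  obtain ⟨Kq, hKq, r₄, hr₄, hb₄⟩ := isBigO_sq_of_contDiffAt hc h0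
  -- constants
  obtain ⟨Kp, hKp⟩ : ∃ x, x = |Kψ| := ⟨_, rfl⟩
  have hKp0 : 0 ≤ Kp := hKp ▸ abs_nonneg _
  generalize hγ₁_ : l₃ * c₁ - l₂ * c₂ = γ₁ at *
  have hγ₁ := hγ₁_.symm
  generalize hγ₂_ : l₁ * c₂ - l₂ * c₁ = γ₂ at *
  have hγ₂ := hγ₂_.symm
  have hdp : 0 < |det| := abs_pos.2 hdet
  obtain ⟨K₂, hK₂⟩ : ∃ x, x = 2 * (|l₁| + |l₂| + |l₃|) / (β * |det|) := ⟨_, rfl⟩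
  have hK₂0 : 0 ≤ K₂ := by rw [hK₂]; positivity
  obtain ⟨M₀, hM₀⟩ : ∃ x, x = K₂ * (Kq * (1 + Kp) ^ 2) := ⟨_, rfl⟩
  have hM₀0 : 0 ≤ M₀ := by rw [hM₀]; positivity
  obtain ⟨Kα, hKα⟩ : ∃ x, x = (2 + β) * (|γ₁| + |γ₂|) / (β * |det|) := ⟨_, rfl⟩
  have hKα0 : 0 ≤ Kα := by rw [hKα]; positivity
  -- The ratios of the γ_j serve to transfer a bound between α₁ and α₂, and the two quotients are
  -- the error allowed in the intermediate value argument on each axis. A vanishing γ_j or l_j makes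
  -- its term 0 by the convention for division; each term is used only where its denominator is
  -- nonzero.
  obtain ⟨M, hM⟩ : ∃ x, x = M₀ * (1 + |γ₁ / γ₂| + |γ₂ / γ₁|) +
    2 * Kq * (2 + Kα) ^ 2 / (β * |l₁|) + 2 * Kq * (2 + Kα) ^ 2 / (β * |l₃|) + Kα + 1 := ⟨_, rfl⟩
  have hq1 : 0 ≤ 2 * Kq * (2 + Kα) ^ 2 / (β * |l₁|) := by positivity
  have hq3 : 0 ≤ 2 * Kq * (2 + Kα) ^ 2 / (β * |l₃|) := by positivity
  have hg12 : 0 ≤ M₀ * |γ₁ / γ₂| := by positivity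
  have hg21 : 0 ≤ M₀ * |γ₂ / γ₁| := by positivity
  have hMpos : 0 < M := by rw [hM]; positivity
  have hMM₀ : M₀ ≤ M := by rw [hM]; linarith
  -- The two occurrences of r₂/2 place a competing zero in the ball of uniqueness. The entry 1/(M +
  -- 1) gives Mr² ≤ r, and the last two keep all test points where h is C² and close to its linear
  -- part.
  refine ⟨min (r₂ / 2) 1, by positivity, min (min (r₁ / 2) (r₂ / 2))
    (min (1 / (M + 1)) (min (r₃ / (4 + Kα + Kp)) (r₄ / (4 + Kα + Kp)))), by positivity, M + Kα + 1,
    by positivity, ?_⟩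
  intro μ C α₁ α₂ hr hα₁ hα₂ hα₁0 hα₂0
  generalize hrdef_ : |μ| + |C| = r at *
  have hrdef := hrdef_.symm
  have hμ : |μ| ≤ r := by have := abs_nonneg C; linarith
  have hC : |C| ≤ r := by have := abs_nonneg μ; linarith
  have hr0 : 0 ≤ r := by rw [hrdef]; positivity
  simp only [lt_min_iff] at hr
  obtain ⟨⟨hrr₁, hrr₂⟩, hrM, hrr₃, hrr₄⟩ := hr
  have hMr : (M + 1) * r ≤ 1 := by
    rw [lt_div_iff₀ (by positivity)] at hrM
    linarith
  have hr1 : r ≤ 1 := by linarith [mul_nonneg hMpos.le hr0]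
  rw [lt_div_iff₀ (by positivity)] at hrr₃ hrr₄
  have hlam : ‖((μ, C) : ℝ × ℝ)‖ ≤ r := max_le hμ hC
  have bα : ∀ γ, |γ| ≤ |γ₁| + |γ₂| → |(2 * μ + C * β) * γ / (β * det)| ≤ Kα * r := by
    intro γ hγ
    rw [abs_div, abs_mul, abs_mul β, abs_of_pos hβ, hKα, div_mul_eq_mul_div]
    refine div_le_div_of_nonneg_right ?_ (by positivity)
    have : |2 * μ + C * β| ≤ (2 + β) * r := by
      refine (abs_add_le _ _).trans ?_
      rw [abs_mul, abs_mul, abs_of_pos hβ, abs_two]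
      linarith [mul_le_mul_of_nonneg_right hC hβ.le]
    calc |2 * μ + C * β| * |γ| ≤ ((2 + β) * r) * (|γ₁| + |γ₂|) := by gcongr
      _ = _ := by ring
  have bα₁ : |α₁| ≤ Kα * r := by rw [hα₁]; exact bα _ (by linarith [abs_nonneg γ₂])
  have bα₂ : |α₂| ≤ Kα * r := by rw [hα₂]; exact bα _ (by linarith [abs_nonneg γ₁])
  -- By Cramer's rule (α₁, α₂) is the exact zero of the linear part of h.
  have lin1 : c₁ * (2 * μ + C * β) = β * (l₁ * α₁ + l₂ * α₂) := by
    rw [hα₁, hα₂]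
    field_simp
    rw [hγ₁, hγ₂, hdet']
    ring
  have lin2 : c₂ * (2 * μ + C * β) = β * (l₂ * α₁ + l₃ * α₂) := by
    rw [hα₁, hα₂]
    field_simp
    rw [hγ₁, hγ₂, hdet']
    ring
  -- the zero given by the implicit function
  obtain ⟨hψb, hψh⟩ := hb₁ (μ, C) (by
    rw [mem_ball_zero_iff]
    linarith)
  obtain ⟨s₁, hs₁⟩ : ∃ s₁, s₁ = (ψ (μ, C)).1 := ⟨_, rfl⟩
  obtain ⟨s₂, hs₂⟩ : ∃ s₂, s₂ = (ψ (μ, C)).2 := ⟨_, rfl⟩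
  have hψe : ψ (μ, C) = (s₁, s₂) := by rw [hs₁, hs₂]
  rw [hψe] at hψb hψh
  have hsn : ‖((s₁, s₂) : ℝ × ℝ)‖ ≤ Kp * r := hψb.trans (by
    calc Kψ * ‖((μ, C) : ℝ × ℝ)‖ ≤ Kp * ‖((μ, C) : ℝ × ℝ)‖ :=
          mul_le_mul_of_nonneg_right (hKp ▸ le_abs_self _) (norm_nonneg _)
      _ ≤ _ := by gcongr)
  have hs₁n : |s₁| ≤ Kp * r := (le_max_left _ _).trans hsn
  have hs₂n : |s₂| ≤ Kp * r := (le_max_right _ _).trans hsn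
  have hyn := norm_par_le hrdef.symm.le hs₁n hs₂n (by positivity)
  have hy4 := hb₄ ((μ, C), (s₁, s₂)) (by linarith [mul_nonneg hr0 hKα0])
  rw [hψh, zero_sub, norm_neg, hd] at hy4
  have hsq : ‖(((μ, C), (s₁, s₂)) : Par)‖ ^ 2 ≤ (1 + Kp) ^ 2 * r ^ 2 := by
    rw [← mul_pow]
    exact pow_le_pow_left₀ (norm_nonneg _) (by linarith) 2
  have hy5 := hy4.trans (mul_le_mul_of_nonneg_left hsq hKq.le)
  have p1 := (le_max_left _ _).trans hy5
  have p2 := (le_max_right _ _).trans hy5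
  simp only [Real.norm_eq_abs] at p1 p2
  rw [lin1] at p1
  rw [lin2] at p2
  have err : |s₁ - α₁| ≤ M₀ * r ^ 2 ∧ |s₂ - α₂| ≤ M₀ * r ^ 2 := by
    -- P and Q are the linear part of h at (s₁, s₂), of quadratic size since h itself vanishes
    -- there; Cramer's rule turns them into the error of (s₁, s₂).
    obtain ⟨P, hP⟩ : ∃ x, x = (β * (l₁ * α₁ + l₂ * α₂) - β * (l₁ * s₁ + l₂ * s₂)) / 2 := ⟨_, rfl⟩
    obtain ⟨Q, hQ⟩ : ∃ x, x = (β * (l₂ * α₁ + l₃ * α₂) - β * (l₂ * s₁ + l₃ * s₂)) / 2 := ⟨_, rfl⟩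
    have e1 : s₁ - α₁ = 2 * (l₂ * Q - l₃ * P) / (β * det) := by
      rw [eq_div_iff (mul_ne_zero hβ.ne' hdet), hP, hQ, hdet']
      ring
    have e2 : s₂ - α₂ = 2 * (l₂ * P - l₁ * Q) / (β * det) := by
      rw [eq_div_iff (mul_ne_zero hβ.ne' hdet), hP, hQ, hdet']
      ring
    obtain ⟨S, hS⟩ : ∃ x, x = Kq * ((1 + Kp) ^ 2 * r ^ 2) := ⟨_, rfl⟩
    have hS0 : 0 ≤ S := by rw [hS]; positivity
    have eM : M₀ * r ^ 2 = 2 * ((|l₁| + |l₂| + |l₃|) * S) / (β * |det|) := by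
      rw [hM₀, hK₂, hS]; ring
    rw [← hP] at p1
    rw [← hQ] at p2
    rw [← hS] at p1 p2
    have t1 := abs_nonneg l₁
    have t2 := abs_nonneg l₂
    have t3 := abs_nonneg l₃
    constructor
    · rw [e1, eM, abs_div, abs_mul, abs_two, abs_mul β, abs_of_pos hβ]
      gcongr
      refine (abs_sub _ _).trans ?_
      rw [abs_mul, abs_mul]
      linarith [mul_le_mul_of_nonneg_left p2 t2, mul_le_mul_of_nonneg_left p1 t3, mul_nonneg t1 hS0]
    · rw [e2, eM, abs_div, abs_mul, abs_two, abs_mul β, abs_of_pos hβ]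
      gcongr
      refine (abs_sub _ _).trans ?_
      rw [abs_mul, abs_mul]
      linarith [mul_le_mul_of_nonneg_left p1 t2, mul_le_mul_of_nonneg_left p2 t1, mul_nonneg t3 hS0]
  obtain ⟨err₁, err₂⟩ := err
  have huniq : ∀ b₁ b₂ : ℝ, 0 < b₁ → b₁ < min (r₂ / 2) 1 → 0 < b₂ → b₂ < min (r₂ / 2) 1 →
      h ((μ, C), (b₁, b₂)) = 0 → b₁ = s₁ ∧ b₂ = s₂ := by
    intro b₁ b₂ hb1 hb1' hb2 hb2' hz
    have hn := norm_par_le (a := b₁) (b := b₂) (s := max b₁ b₂) hrdef.symm.le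
      (by rw [abs_of_pos hb1]; exact le_max_left _ _)
      (by rw [abs_of_pos hb2]; exact le_max_right _ _) (hb1.le.trans (le_max_left _ _))
    have hm : max b₁ b₂ < r₂ / 2 := max_lt (hb1'.trans_le (min_le_left _ _))
      (hb2'.trans_le (min_le_left _ _))
    have := (hb₂ ((μ, C), (b₁, b₂)) (by rw [mem_ball_zero_iff]; linarith)).1 hz
    dsimp only at this
    rw [hψe, Prod.mk.injEq] at this
    exact ⟨this.1.symm, this.2.symm⟩
  have hr2 : 0 ≤ r ^ 2 := sq_nonneg r
  have hMr2 : M₀ * r ^ 2 ≤ M * r ^ 2 := by gcongr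
  have hfin : ∀ a α : ℝ, |α| ≤ Kα * r → |a - α| ≤ M * r ^ 2 →
      |a - α| ≤ (M + Kα + 1) * r ^ 2 ∧ a ≤ (M + Kα + 1) * r := by
    intro a α h1 h2
    refine ⟨by linarith [mul_nonneg hKα0 hr2], ?_⟩
    have h3 := (le_abs_self _).trans h2
    have h4 := (le_abs_self _).trans h1
    have h5 : M * r ^ 2 ≤ M * r := by
      have : r ^ 2 ≤ r := by linarith [mul_le_mul_of_nonneg_left hr1 hr0]
      gcongr
    linarith
  have hbig : M * r ^ 2 ≤ r := by
    have : (M + 1) * r * r ≤ 1 * r := by gcongr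
    linarith
  by_cases hpos : 0 < s₁ ∧ 0 < s₂
  · obtain ⟨f1, f2⟩ := hfin s₁ α₁ bα₁ (err₁.trans hMr2)
    obtain ⟨f3, f4⟩ := hfin s₂ α₂ bα₂ (err₂.trans hMr2)
    exact ⟨s₁, s₂, hpos.1.le, hpos.2.le, f1, f3, f2, f4, Or.inr (by rw [hψh]; rfl),
      Or.inr (by rw [hψh]; rfl), huniq⟩
  -- A small positive zero would be (s₁, s₂), which is not positive; uniqueness is vacuous for any
  -- choice of the a_j.
  · have hvac : ∀ a₁ a₂ b₁ b₂ : ℝ, 0 < b₁ → b₁ < min (r₂ / 2) 1 → 0 < b₂ →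
        b₂ < min (r₂ / 2) 1 → h ((μ, C), (b₁, b₂)) = 0 → b₁ = a₁ ∧ b₂ = a₂ := by
      intro a₁ a₂ b₁ b₂ hb1 hb1' hb2 hb2' hz
      obtain ⟨rfl, rfl⟩ := huniq b₁ b₂ hb1 hb1' hb2 hb2' hz
      exact absurd ⟨hb1, hb2⟩ hpos
    have happ : ∀ a b : ℝ, |a| ≤ Kα * r + M * r ^ 2 → |b| ≤ Kα * r + M * r ^ 2 →
        ContinuousAt h ((μ, C), (a, b)) ∧
        ‖h ((μ, C), (a, b)) - fderiv ℝ h 0 ((μ, C), (a, b))‖ ≤ Kq * (2 + Kα) ^ 2 * r ^ 2 := by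
      intro a b ha hb
      have hn := norm_par_le hrdef.symm.le ha hb (by positivity)
      have hn' : ‖(((μ, C), (a, b)) : Par)‖ ≤ (2 + Kα) * r := by linarith
      refine ⟨(hb₃ _ (by rw [mem_ball_zero_iff]; linarith [mul_nonneg hr0 hKp0])).continuousAt,
        (hb₄ _ (by linarith [mul_nonneg hr0 hKp0])).trans ?_⟩
      rw [mul_assoc, ← mul_pow]
      gcongr
    have hpath1 : Continuous fun t : ℝ => (((μ, C), (t, 0)) : Par) := by fun_prop
    have hpath2 : Continuous fun t : ℝ => (((μ, C), (0, t)) : Par) := by fun_prop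
    have habs : ∀ α t : ℝ, |α| ≤ Kα * r → t ∈ Set.Icc (α - M * r ^ 2) (α + M * r ^ 2) →
        |t| ≤ Kα * r + M * r ^ 2 := by
      intro α t hα ht
      rw [abs_le] at hα ⊢
      constructor <;> linarith [ht.1, ht.2]
    have hz0 : |(0 : ℝ)| ≤ Kα * r + M * r ^ 2 := by rw [abs_zero]; positivity
    have hsub : ∀ α t : ℝ, t ∈ Set.Icc (α - M * r ^ 2) (α + M * r ^ 2) → |t - α| ≤ M * r ^ 2 :=
      fun α t ht => abs_le.2 ⟨by linarith [ht.1], by linarith [ht.2]⟩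
    by_cases hsmall : α₁ ≤ M * r ^ 2 ∧ α₂ ≤ M * r ^ 2
    · obtain ⟨f1, f2⟩ := hfin 0 α₁ bα₁ (by rw [zero_sub, abs_neg, abs_of_nonneg hα₁0]; exact hsmall.1)
      obtain ⟨f3, f4⟩ := hfin 0 α₂ bα₂ (by rw [zero_sub, abs_neg, abs_of_nonneg hα₂0]; exact hsmall.2)
      exact ⟨0, 0, le_rfl, le_rfl, f1, f3, f2, f4, Or.inl rfl, Or.inl rfl, hvac 0 0⟩
    · by_cases hcase : α₁ ≤ M * r ^ 2
      · have hα2 : M * r ^ 2 < α₂ := by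
          by_contra hcon
          exact hsmall ⟨hcase, not_lt.1 hcon⟩
        have hs2 : 0 < s₂ := by have := (abs_le.1 err₂).1; linarith
        have hs1 : s₁ ≤ 0 := by
          by_contra hcon
          exact hpos ⟨not_le.1 hcon, hs2⟩
        have hα1 : α₁ ≤ M₀ * r ^ 2 := by have := (abs_le.1 err₁).1; linarith
        -- Since α₁ : α₂ = γ₁ : γ₂, a nonzero γ₁ would pass the bound M₀r² for α₁ on to α₂,
        -- contradicting α₂ > Mr².
        have hγ : γ₁ = 0 := by
          by_contra hne
          have e : α₂ = γ₂ / γ₁ * α₁ := by rw [hα₁, hα₂]; field_simp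
          have : α₂ ≤ |γ₂ / γ₁| * (M₀ * r ^ 2) := by
            rw [e]
            exact mul_le_mul (le_abs_self _) hα1 hα₁0 (abs_nonneg _)
          have : M₀ * |γ₂ / γ₁| * r ^ 2 ≤ M * r ^ 2 := by
            refine mul_le_mul_of_nonneg_right ?_ hr2
            rw [hM]; linarith
          linarith
        have hα1z : α₁ = 0 := by rw [hα₁, hγ]; simp
        have hl : l₃ ≠ 0 := by
          intro hl
          rw [hγ₁, hl, zero_mul, zero_sub, neg_eq_zero] at hγ
          have : l₂ = 0 := (mul_eq_zero.1 hγ).resolve_right hc₂.ne'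
          exact hdet (by rw [hdet', hl, this]; ring)
        -- On the axis a₁ = 0 the second equation has linear part with slope -βl₃/2 and root α₂.
        -- Here l₃ ≠ 0, because γ₁ = 0 together with l₃ = 0 would force l₂ = 0 and a vanishing
        -- determinant.
        obtain ⟨t, ht, htz⟩ := exists_zero_of_approx (g := fun t => (h ((μ, C), (0, t))).2)
          (κ := -(β * l₃) / 2) (α := α₂) (δ := M * r ^ 2) (by positivity)
          (fun t ht => (((happ 0 t hz0 (habs _ _ bα₂ ht)).1.comp
            (f := fun t : ℝ => (((μ, C), (0, t)) : Par)) hpath2.continuousAt).snd).continuousWithinAt)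
          (fun t ht => by
            have h1 := (norm_snd_le _).trans (happ 0 t hz0 (habs _ _ bα₂ ht)).2
            rw [hd, Prod.snd_sub, Real.norm_eq_abs] at h1
            dsimp only at h1 ⊢
            rw [lin2, hα1z] at h1
            have e : (β * (l₂ * 0 + l₃ * α₂) - β * (l₂ * 0 + l₃ * t)) / 2 =
              -(β * l₃) / 2 * (t - α₂) := by ring
            rw [e] at h1
            refine h1.trans ?_
            rw [abs_div, abs_neg, abs_mul, abs_of_pos hβ, abs_two]
            have hl' : 0 < β * |l₃| := mul_pos hβ (abs_pos.2 hl)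
            have hMl : 2 * Kq * (2 + Kα) ^ 2 / (β * |l₃|) ≤ M := by
              have := mul_nonneg hM₀0 (add_nonneg (abs_nonneg (γ₁ / γ₂)) (abs_nonneg (γ₂ / γ₁)))
              rw [hM]; linarith
            rw [div_le_iff₀ hl'] at hMl
            linarith [mul_le_mul_of_nonneg_right hMl hr2]) (div_ne_zero (neg_ne_zero.2 (mul_ne_zero hβ.ne' hl)) two_ne_zero)
        obtain ⟨f1, f2⟩ := hfin 0 α₁ bα₁ (by rw [hα1z]; simp; positivity)
        obtain ⟨f3, f4⟩ := hfin t α₂ bα₂ (hsub _ _ ht)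
        exact ⟨0, t, le_rfl, by linarith [ht.1], f1, f3, f2, f4, Or.inl rfl, Or.inr htz, hvac 0 t⟩
      · have hα1 : M * r ^ 2 < α₁ := not_le.1 hcase
        have hs1 : 0 < s₁ := by have := (abs_le.1 err₁).1; linarith
        have hs2 : s₂ ≤ 0 := by
          by_contra hcon
          exact hpos ⟨hs1, not_le.1 hcon⟩
        have hα2 : α₂ ≤ M₀ * r ^ 2 := by have := (abs_le.1 err₂).1; linarith
        have hγ : γ₂ = 0 := by
          by_contra hne
          have e : α₁ = γ₁ / γ₂ * α₂ := by rw [hα₁, hα₂]; field_simp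
          have : α₁ ≤ |γ₁ / γ₂| * (M₀ * r ^ 2) := by
            rw [e]
            exact mul_le_mul (le_abs_self _) hα2 hα₂0 (abs_nonneg _)
          have : M₀ * |γ₁ / γ₂| * r ^ 2 ≤ M * r ^ 2 := by
            refine mul_le_mul_of_nonneg_right ?_ hr2
            rw [hM]; linarith
          linarith
        have hα2z : α₂ = 0 := by rw [hα₂, hγ]; simp
        have hl : l₁ ≠ 0 := by
          intro hl
          rw [hγ₂, hl, zero_mul, zero_sub, neg_eq_zero] at hγ
          have : l₂ = 0 := (mul_eq_zero.1 hγ).resolve_right hc₁.ne'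
          exact hdet (by rw [hdet', hl, this]; ring)
        obtain ⟨t, ht, htz⟩ := exists_zero_of_approx (g := fun t => (h ((μ, C), (t, 0))).1)
          (κ := -(β * l₁) / 2) (α := α₁) (δ := M * r ^ 2) (by positivity)
          (fun t ht => (((happ t 0 (habs _ _ bα₁ ht) hz0).1.comp
            (f := fun t : ℝ => (((μ, C), (t, 0)) : Par)) hpath1.continuousAt).fst).continuousWithinAt)
          (fun t ht => by
            have h1 := (norm_fst_le _).trans (happ t 0 (habs _ _ bα₁ ht) hz0).2
            rw [hd, Prod.fst_sub, Real.norm_eq_abs] at h1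
            dsimp only at h1 ⊢
            rw [lin1, hα2z] at h1
            have e : (β * (l₁ * α₁ + l₂ * 0) - β * (l₁ * t + l₂ * 0)) / 2 =
              -(β * l₁) / 2 * (t - α₁) := by ring
            rw [e] at h1
            refine h1.trans ?_
            rw [abs_div, abs_neg, abs_mul, abs_of_pos hβ, abs_two]
            have hl' : 0 < β * |l₁| := mul_pos hβ (abs_pos.2 hl)
            have hMl : 2 * Kq * (2 + Kα) ^ 2 / (β * |l₁|) ≤ M := by
              have := mul_nonneg hM₀0 (add_nonneg (abs_nonneg (γ₁ / γ₂)) (abs_nonneg (γ₂ / γ₁)))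
              rw [hM]; linarith
            rw [div_le_iff₀ hl'] at hMl
            linarith [mul_le_mul_of_nonneg_right hMl hr2]) (div_ne_zero (neg_ne_zero.2 (mul_ne_zero hβ.ne' hl)) two_ne_zero)
        obtain ⟨f1, f2⟩ := hfin t α₁ bα₁ (hsub _ _ ht)
        obtain ⟨f3, f4⟩ := hfin 0 α₂ bα₂ (by rw [hα2z]; simp; positivity)
        exact ⟨t, 0, by linarith [ht.1], le_rfl, f1, f3, f2, f4, Or.inr htz, Or.inl rfl, hvac t 0⟩

end Amplitudes

/-! ### The weighted space of coefficients -/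

/-- Absolutely summable families; the coefficients are `coef s x`, see below. -/
abbrev Wiener := lp (fun _ : Freq => Coef) 1

/-- The family of Fourier coefficients represented by `x`. -/
def coef (s : ℝ) (x : Wiener) (k : Freq) : Coef := (wt s k)⁻¹ • x k

section Wiener

variable {s : ℝ}

lemma memℓp_one_iff {f : Freq → Coef} : Memℓp f 1 ↔ Summable fun k => ‖f k‖ := by
  rw [memℓp_gen_iff (by simp)]
  simp

lemma Wiener.norm_eq (x : Wiener) : ‖x‖ = ∑' k, ‖x k‖ := by
  rw [lp.norm_eq_tsum_rpow (by simp)]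
  simp

lemma wt_mul_norm_coef (x : Wiener) (k : Freq) : wt s k * ‖coef s x k‖ = ‖x k‖ := by
  have h := wt_pos s k
  rw [coef, norm_smul, norm_inv, Real.norm_eq_abs, abs_of_pos h, mul_inv_cancel_left₀ h.ne']

lemma summable_wt_coef (s : ℝ) (x : Wiener) : Summable fun k => wt s k * ‖coef s x k‖ := by
  simp only [wt_mul_norm_coef]
  exact memℓp_one_iff.1 x.2

lemma tsum_wt_coef (s : ℝ) (x : Wiener) : ∑' k, wt s k * ‖coef s x k‖ = ‖x‖ := by
  simp only [wt_mul_norm_coef, Wiener.norm_eq]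

/-- The element with given coefficients. -/
def ofCoef (s : ℝ) (u : Freq → Coef) (hu : Summable fun k => wt s k * ‖u k‖) : Wiener :=
  ⟨fun k => wt s k • u k, memℓp_one_iff.2 (hu.congr fun k => by
    rw [norm_smul, Real.norm_eq_abs, abs_of_pos (wt_pos s k)])⟩

lemma coef_ofCoef {u : Freq → Coef} (hu : Summable fun k => wt s k * ‖u k‖) :
    coef s (ofCoef s u hu) = u := by
  funext k
  change (wt s k)⁻¹ • (wt s k • u k) = u k
  rw [inv_smul_smul₀ (wt_pos s k).ne']

lemma coef_injective {x y : Wiener} (h : coef s x = coef s y) : x = y := by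
  refine lp.ext (funext fun k => ?_)
  have := congrFun h k
  exact smul_right_injective _ (inv_ne_zero (wt_pos s k).ne') this

lemma norm_ofCoef {u : Freq → Coef} (hu : Summable fun k => wt s k * ‖u k‖) :
    ‖ofCoef s u hu‖ = ∑' k, wt s k * ‖u k‖ := by
  rw [← tsum_wt_coef s, coef_ofCoef]

lemma coef_add (x y : Wiener) : coef s (x + y) = coef s x + coef s y := by
  funext k
  simp [coef]

lemma coef_smul (r : ℝ) (x : Wiener) : coef s (r • x) = r • coef s x := by
  funext k
  change (wt s k)⁻¹ • (r • x k) = r • ((wt s k)⁻¹ • x k)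
  rw [smul_comm]

lemma coef_sub (x y : Wiener) : coef s (x - y) = coef s x - coef s y := by
  funext k
  simp [coef, smul_sub]

lemma summable_coef (hs : 0 ≤ s) (x : Wiener) : Summable fun k => ‖coef s x k‖ :=
  Summable.of_nonneg_of_le (fun _ => norm_nonneg _)
    (fun k => le_mul_of_one_le_left (norm_nonneg _) (one_le_wt hs k)) (summable_wt_coef s x)

lemma tsum_coef_le (hs : 0 ≤ s) (x : Wiener) : ∑' k, ‖coef s x k‖ ≤ ‖x‖ := by
  rw [← tsum_wt_coef s]
  exact (summable_coef hs x).tsum_le_tsum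
    (fun k => le_mul_of_one_le_left (norm_nonneg _) (one_le_wt hs k)) (summable_wt_coef s x)

lemma norm_coef_le (hs : 0 ≤ s) (x : Wiener) (k : Freq) : ‖coef s x k‖ ≤ ‖x‖ :=
  ((summable_coef hs x).le_tsum k fun _ _ => norm_nonneg _).trans (tsum_coef_le hs x)

/-- Evaluation of one coefficient. -/
def evalCoef (hs : 0 ≤ s) (k : Freq) : Wiener →L[ℝ] Coef :=
  LinearMap.mkContinuous
    { toFun := fun x => coef s x k
      map_add' := fun x y => by rw [coef_add]; rfl
      map_smul' := fun r x => by rw [coef_smul]; rfl } 1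
    (fun x => by rw [one_mul]; exact norm_coef_le hs x k)

variable {D : Params} {β K : ℝ}

lemma weighted_tk (hK : ∀ k F, ‖tk D β k F‖ ≤ K * ‖F‖) (x : Wiener) :
    Summable (fun k => wt s k * ‖tk D β k (coef s x k)‖) ∧
      ∑' k, wt s k * ‖tk D β k (coef s x k)‖ ≤ K * ‖x‖ := by
  have hle : ∀ k, wt s k * ‖tk D β k (coef s x k)‖ ≤ K * (wt s k * ‖coef s x k‖) := fun k =>
    (mul_le_mul_of_nonneg_left (hK k _) (wt_pos s k).le).trans_eq (mul_left_comm _ _ _)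
  have hr := (summable_wt_coef s x).mul_left K
  have h := Summable.of_nonneg_of_le (fun k => mul_nonneg (wt_pos s k).le (norm_nonneg _)) hle hr
  refine ⟨h, (h.tsum_le_tsum hle hr).trans_eq ?_⟩
  rw [tsum_mul_left, tsum_wt_coef]

/-- The operator `𝒯` on `Wiener`. -/
def opT (s : ℝ) (hK : ∀ k F, ‖tk D β k F‖ ≤ K * ‖F‖) : Wiener →L[ℝ] Wiener :=
  LinearMap.mkContinuous
    { toFun := fun x => ofCoef s (fun k => tk D β k (coef s x k)) (weighted_tk hK x).1
      map_add' := fun x y => coef_injective (s := s) (by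
        funext k
        simp [coef_add, coef_ofCoef])
      map_smul' := fun r x => coef_injective (s := s) (by
        funext k
        simp only [coef_smul, coef_ofCoef, Pi.smul_apply, RingHom.id_apply]
        exact ((tk D β k).restrictScalars ℝ).map_smul r _) } K
    (fun x => (norm_ofCoef (weighted_tk hK x).1).trans_le (weighted_tk hK x).2)

lemma coef_opT (hK : ∀ k F, ‖tk D β k F‖ ≤ K * ‖F‖) (x : Wiener) :
    coef s (opT s hK x) = fun k => tk D β k (coef s x k) :=
  coef_ofCoef (weighted_tk hK x).1

lemma weighted_cconv (hs : 0 ≤ s) (x y : Wiener) :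
    Summable (fun k => wt s k * ‖cconv (coef s x) (coef s y) k‖) ∧
      ∑' k, wt s k * ‖cconv (coef s x) (coef s y) k‖ ≤ ‖x‖ * ‖y‖ := by
  have := cconv_weighted (fun k => (wt_pos s k).le) (wt_add_le hs) (summable_wt_coef s x)
    (summable_wt_coef s y) (summable_bil (summable_coef hs x) (summable_coef hs y))
  rwa [tsum_wt_coef, tsum_wt_coef] at this

lemma cconv_add_left {u u' v : Freq → Coef} (hu : Summable fun k => ‖u k‖)
    (hu' : Summable fun k => ‖u' k‖) (hv : Summable fun k => ‖v k‖) :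
    cconv (u + u') v = cconv u v + cconv u' v := by
  funext k
  simp only [cconv, Pi.add_apply, map_add, add_apply]
  exact (summable_bil hu hv k).of_norm.tsum_add (summable_bil hu' hv k).of_norm

lemma cconv_add_right {u v v' : Freq → Coef} (hu : Summable fun k => ‖u k‖)
    (hv : Summable fun k => ‖v k‖) (hv' : Summable fun k => ‖v' k‖) :
    cconv u (v + v') = cconv u v + cconv u v' := by
  funext k
  simp only [cconv, Pi.add_apply, map_add]
  exact (summable_bil hu hv k).of_norm.tsum_add (summable_bil hu hv' k).of_norm

lemma cconv_smul_left (r : ℝ) (u v : Freq → Coef) : cconv (r • u) v = r • cconv u v := by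
  funext k
  simp only [cconv, Pi.smul_apply]
  rw [← tsum_const_smul'']
  congr 1
  funext j
  rw [ContinuousLinearMap.map_smul_of_tower, smul_apply]

lemma cconv_smul_right (r : ℝ) (u v : Freq → Coef) : cconv u (r • v) = r • cconv u v := by
  funext k
  simp only [cconv, Pi.smul_apply]
  rw [← tsum_const_smul'']
  congr 1
  funext j
  rw [ContinuousLinearMap.map_smul_of_tower]

/-- The bilinear map `B` on `Wiener`. -/
def opB (hs : 0 ≤ s) : Wiener →L[ℝ] Wiener →L[ℝ] Wiener :=
  LinearMap.mkContinuous₂ (LinearMap.mk₂ ℝ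
    (fun x y => ofCoef s (cconv (coef s x) (coef s y)) (weighted_cconv hs x y).1)
    (fun x x' y => coef_injective (s := s) ((coef_ofCoef _).trans (by
      simp only [coef_add, coef_ofCoef]
      exact cconv_add_left (summable_coef hs x) (summable_coef hs x') (summable_coef hs y))))
    (fun r x y => coef_injective (s := s) ((coef_ofCoef _).trans (by
      simp only [coef_smul, coef_ofCoef, cconv_smul_left])))
    (fun x y y' => coef_injective (s := s) ((coef_ofCoef _).trans (by
      simp only [coef_add, coef_ofCoef]
      exact cconv_add_right (summable_coef hs x) (summable_coef hs y) (summable_coef hs y'))))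
    (fun r x y => coef_injective (s := s) ((coef_ofCoef _).trans (by
      simp only [coef_smul, coef_ofCoef, cconv_smul_right])))) 1
    (fun x y => by
      rw [one_mul]
      exact (norm_ofCoef (weighted_cconv hs x y).1).trans_le (weighted_cconv hs x y).2)

lemma coef_opB (hs : 0 ≤ s) (x y : Wiener) :
    coef s (opB hs x y) = cconv (coef s x) (coef s y) :=
  coef_ofCoef (weighted_cconv hs x y).1

lemma norm_opB_le (hs : 0 ≤ s) (x y : Wiener) : ‖opB hs x y‖ ≤ ‖x‖ * ‖y‖ :=
  (norm_ofCoef (weighted_cconv hs x y).1).trans_le (weighted_cconv hs x y).2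

lemma norm_opT_le (hK : ∀ k F, ‖tk D β k F‖ ≤ K * ‖F‖) (x : Wiener) : ‖opT s hK x‖ ≤ K * ‖x‖ :=
  (norm_ofCoef (weighted_tk hK x).1).trans_le (weighted_tk hK x).2

end Wiener

/-! ### Interaction of the resonant waves -/

/-- Real coefficients. -/
def rv (a b c : ℝ) : Coef := ((a : ℂ), (b : ℂ), (c : ℂ))

lemma rv_add (a b c a' b' c' : ℝ) : rv a b c + rv a' b' c' = rv (a + a') (b + b') (c + c') := by
  simp [rv]

lemma rv_smul (r a b c : ℝ) : r • rv a b c = rv (r * a) (r * b) (r * c) := by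
  simp [rv]

/-- Twice the symmetrization of `bil`. -/
def bilSymm (x y : Coef) : Coef := bil x y + bil y x

lemma bilSymm_rv (a b c a' b' c' : ℝ) :
    bilSymm (rv a b c) (rv a' b' c') = rv (b * b' + c * c') (a * b' + a' * b) (a * c' + a' * c) := by
  simp only [bilSymm, bil_apply, rv, Prod.mk_add_mk, Prod.mk.injEq]
  push_cast
  refine ⟨by ring, rfl, rfl⟩

lemma bilSymm_zero (x : Coef) : bilSymm x 0 = 0 := by
  simp [bilSymm]

/-- Twice the symmetrization of `cconv`. -/
def convSymm (u v : Freq → Coef) (k : Freq) : Coef := cconv u v k + cconv v u k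

lemma convSymm_self (u : Freq → Coef) (k : Freq) : cconv u u k = (2⁻¹ : ℝ) • convSymm u u k := by
  rw [convSymm, ← two_smul ℝ, smul_smul]
  norm_num

/-- The coefficient at the spatial index `n` of the resonant wave; `σ` is the sign of the time
frequency. -/
def waveCoef (D : Params) (n : ℤ × ℤ) (σ : ℤ) : Coef :=
  rv (√(psq D n) / 2) (-(σ * p₁ D n) / 2) (-(σ * p₂ D n) / 2)

/-- The resonant standing wave with spatial indices `±n` and time frequencies `±q`. -/
def wave (D : Params) (q : ℕ) (n : ℤ × ℤ) (k : Freq) : Coef :=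
  if (k.1 = n ∨ k.1 = -n) ∧ (k.2 = q ∨ k.2 = -q) then waveCoef D k.1 k.2.sign else 0

/-- The constant `(1, 0, 0)`. -/
def unitElev (k : Freq) : Coef := if k = 0 then (1, 0, 0) else 0

/-- The frequencies in the support of a wave. -/
def waveSupp (q : ℕ) (n : ℤ × ℤ) : Finset Freq :=
  {(n, (q : ℤ)), (-n, (q : ℤ)), (n, -(q : ℤ)), (-n, -(q : ℤ))}

lemma wave_eq_zero {D : Params} {q : ℕ} {n : ℤ × ℤ} {k : Freq} (hk : k ∉ waveSupp q n) :
    wave D q n k = 0 := by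
  rw [wave, if_neg]
  contrapose hk
  obtain ⟨a, b⟩ := k
  simp only [waveSupp, Finset.mem_insert, Finset.mem_singleton, Prod.mk.injEq]
  tauto

lemma unitElev_eq_zero {k : Freq} (hk : k ∉ ({0} : Finset Freq)) : unitElev k = 0 := by
  rw [unitElev, if_neg (by simpa using hk)]

lemma wave_mul {D : Params} {q : ℕ} (hq : 0 < q) (n x : ℤ × ℤ) (t : ℤ) :
    wave D q n (x, t * q) =
      if (x = n ∨ x = -n) ∧ (t = 1 ∨ t = -1) then waveCoef D x t else 0 := by
  have hq' : (q : ℤ) ≠ 0 := by omega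
  have e1 : t * (q : ℤ) = q ↔ t = 1 := by
    constructor
    · intro h; exact mul_right_cancel₀ hq' (by rw [h, one_mul])
    · rintro rfl; ring
  have e2 : t * (q : ℤ) = -q ↔ t = -1 := by
    constructor
    · intro h; exact mul_right_cancel₀ hq' (by rw [h]; ring)
    · rintro rfl; ring
  have hs : (q : ℤ).sign = 1 := Int.sign_eq_one_of_pos (by omega)
  simp only [wave, e1, e2]
  split_ifs with h
  · congr 1
    rcases h.2 with rfl | rfl <;> simp [hs, Int.sign_neg]
  · rfl

lemma cconv_eq_sum_left {u : Freq → Coef} {S : Finset Freq} (hu : ∀ k ∉ S, u k = 0)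
    (v : Freq → Coef) (k : Freq) : cconv u v k = ∑ j ∈ S, bil (u j) (v (k - j)) :=
  tsum_eq_sum fun j hj => by rw [hu j hj]; simp

lemma cconv_eq_sum_right {v : Freq → Coef} {S : Finset Freq} (hv : ∀ k ∉ S, v k = 0)
    (u : Freq → Coef) (k : Freq) : cconv u v k = ∑ j ∈ S, bil (u (k - j)) (v j) := by
  rw [cconv, ← (Equiv.subLeft k).tsum_eq]
  simp only [Equiv.subLeft_apply, sub_sub_cancel]
  exact tsum_eq_sum fun j hj => by rw [hv j hj]; simp

lemma convSymm_eq_sum {u : Freq → Coef} {S : Finset Freq} (hu : ∀ k ∉ S, u k = 0)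
    (v : Freq → Coef) (k : Freq) : convSymm u v k = ∑ j ∈ S, bilSymm (u j) (v (k - j)) := by
  rw [convSymm, cconv_eq_sum_left hu, cconv_eq_sum_right hu, ← Finset.sum_add_distrib]
  rfl

/-- A wave is supported at four frequencies, kept distinct by n ≠ -n and q > 0, so convolution with
it has four terms. -/
lemma convSymm_wave {D : Params} {q : ℕ} (hq : 0 < q) {n : ℤ × ℤ} (hn : n ≠ -n)
    (v : Freq → Coef) (x : ℤ × ℤ) (t : ℤ) :
    convSymm (wave D q n) v (x, t * q) =
      bilSymm (waveCoef D n 1) (v (x - n, (t - 1) * q)) +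
      (bilSymm (waveCoef D (-n) 1) (v (x + n, (t - 1) * q)) +
      (bilSymm (waveCoef D n (-1)) (v (x - n, (t + 1) * q)) +
      bilSymm (waveCoef D (-n) (-1)) (v (x + n, (t + 1) * q)))) := by
  have h1 := wave_mul (D := D) hq n n 1
  have h2 := wave_mul (D := D) hq n (-n) 1
  have h3 := wave_mul (D := D) hq n n (-1)
  have h4 := wave_mul (D := D) hq n (-n) (-1)
  simp only [true_or, or_true, and_self, if_true, one_mul, neg_mul] at h1 h2 h3 h4
  have hq' : (q : ℤ) ≠ -q := by omega
  rw [convSymm_eq_sum (fun k => wave_eq_zero), waveSupp, Finset.sum_insert, Finset.sum_insert,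
    Finset.sum_insert, Finset.sum_singleton, h1, h2, h3, h4]
  · simp only [Prod.mk_sub_mk, sub_neg_eq_add, sub_mul, add_mul, one_mul]
  · simp [hn]
  · simp [hq']
  · simp [hn, hq']

lemma convSymm_unitElev (v : Freq → Coef) (k : Freq) :
    convSymm unitElev v k = (0, (v k).2.1, (v k).2.2) := by
  rw [convSymm_eq_sum (fun k => unitElev_eq_zero)]
  simp [unitElev, bilSymm, bil_apply]

/-- The functional whose vanishing is the solvability condition at `(n, q)`. -/
def solv (D : Params) (n : ℤ × ℤ) : Coef →L[ℝ] ℝ :=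
  Complex.reCLM.comp ((√(psq D n) • ContinuousLinearMap.fst ℝ ℂ (ℂ × ℂ)) -
    (p₁ D n • (ContinuousLinearMap.fst ℝ ℂ ℂ).comp (ContinuousLinearMap.snd ℝ ℂ (ℂ × ℂ)) +
      p₂ D n • (ContinuousLinearMap.snd ℝ ℂ ℂ).comp (ContinuousLinearMap.snd ℝ ℂ (ℂ × ℂ))))

lemma solv_apply (D : Params) (n : ℤ × ℤ) (x : Coef) :
    solv D n x = √(psq D n) * x.1.re - (p₁ D n * x.2.1.re + p₂ D n * x.2.2.re) := by
  simp [solv]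

lemma solv_rv (D : Params) (n : ℤ × ℤ) (a b c : ℝ) :
    solv D n (rv a b c) = √(psq D n) * a - (p₁ D n * b + p₂ D n * c) := by
  rw [solv_apply]
  rfl

lemma tk_rv_time_zero {D : Params} {β : ℝ} {n : ℤ × ℤ} (hn : n ≠ 0) (a b c : ℝ) :
    tk D β (n, 0) (rv a b c) = rv (a / β) 0 0 := by
  rw [tk_of_eq (Or.inl rfl) (by simpa [Prod.ext_iff] using hn)]
  simp [rv]

lemma tk_rv {D : Params} {β : ℝ} {k : Freq} (hk : k.2 ≠ 0) (hd : fdisc D β k ≠ 0) (a b c : ℝ) :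
    tk D β k (rv a b c) =
      rv ((mE D k * (p₁ D k.1 * b + p₂ D k.1 * c) - β * psq D k.1 * a) / fdisc D β k)
        (p₁ D k.1 * ((mE D k * a - β * (p₁ D k.1 * b + p₂ D k.1 * c)) / fdisc D β k))
        (p₂ D k.1 * ((mE D k * a - β * (p₁ D k.1 * b + p₂ D k.1 * c)) / fdisc D β k)) := by
  rw [tk_of_ne hk hd]
  simp only [rv, pdot]
  push_cast
  rfl

/-- For p = 0 every entry of 𝒯 carries a factor p, and at the origin 𝒯 is zero by convention. Hence
the spatial mean produced by the product of two waves does not act back on them. -/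
lemma tk_space_zero {D : Params} {β : ℝ} (m : ℤ) (F : Coef) : tk D β (0, m) F = 0 := by
  have e1 : p₁ D 0 = 0 := by simp [p₁]
  have e2 : p₂ D 0 = 0 := by simp [p₂]
  have e3 : psq D 0 = 0 := by simp [psq, e1, e2]
  by_cases hm : m = 0
  · subst hm
    exact tk_zero _
  · rw [tk_of_ne (by simpa using hm) (by simpa [fdisc, mE, e3] using hm)]
    simp [pdot, e1, e2, e3]

lemma p₁_add (D : Params) (n n' : ℤ × ℤ) : p₁ D (n + n') = p₁ D n + p₁ D n' := by
  simp only [p₁, Prod.fst_add, Prod.snd_add]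
  push_cast
  ring

lemma p₂_add (D : Params) (n n' : ℤ × ℤ) : p₂ D (n + n') = p₂ D n + p₂ D n' := by
  simp only [p₂, Prod.fst_add, Prod.snd_add]
  push_cast
  ring

lemma p₁_one_zero (D : Params) : p₁ D (1, 0) = D.k₁ := by simp [p₁]
lemma p₂_one_zero (D : Params) : p₂ D (1, 0) = D.k₁ * D.τ₁ := by simp [p₂, mul_comm]
lemma p₁_zero_one (D : Params) : p₁ D (0, 1) = D.k₂ := by simp [p₁]
lemma p₂_zero_one (D : Params) : p₂ D (0, 1) = -(D.k₂ * D.τ₂) := by simp [p₂, mul_comm]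

lemma psq_one_zero (D : Params) : psq D (1, 0) = D.k₁ ^ 2 * (1 + D.τ₁ ^ 2) := by
  rw [psq, p₁_one_zero, p₂_one_zero]
  ring

lemma psq_zero_one (D : Params) : psq D (0, 1) = D.k₂ ^ 2 * (1 + D.τ₂ ^ 2) := by
  rw [psq, p₁_zero_one, p₂_zero_one]
  ring

lemma sqrt_psq_one_zero {D : Params} (hD : D.IsPos) :
    √(psq D (1, 0)) = D.k₁ * √(1 + D.τ₁ ^ 2) := by
  rw [psq_one_zero, Real.sqrt_mul (sq_nonneg _), Real.sqrt_sq hD.k₁.le]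

lemma sqrt_psq_zero_one {D : Params} (hD : D.IsPos) :
    √(psq D (0, 1)) = D.k₂ * √(1 + D.τ₂ ^ 2) := by
  rw [psq_zero_one, Real.sqrt_mul (sq_nonneg _), Real.sqrt_sq hD.k₂.le]

lemma solv_wave (D : Params) (n : ℤ × ℤ) : solv D n (waveCoef D n 1) = psq D n := by
  have h := Real.mul_self_sqrt (psq_nonneg D n)
  rw [waveCoef, solv_rv]
  simp only [psq] at h ⊢
  push_cast
  linear_combination h / 2

lemma solv_unitElev {D : Params} {q : ℕ} (hq : 0 < q) (n : ℤ × ℤ) :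
    solv D n (convSymm unitElev (wave D q n) (n, q)) = psq D n / 2 := by
  have h1 := wave_mul (D := D) hq n n 1
  simp only [true_or, and_self, if_true, one_mul] at h1
  rw [convSymm_unitElev, h1, solv_apply]
  simp only [waveCoef, rv, Complex.ofReal_re, Complex.zero_re, psq]
  push_cast
  ring

/-- Multiplying the second-order response by the wave again returns to index n from 0 or from 2n,
and index 0 is annihilated by 𝒯. The frequency (2n, 0) yields the term k⁴(1 + τ²)²/4 of l, and (2n,
2q) the terms with `aEta` and `aVel`. -/
lemma self_interaction {D : Params} {β : ℝ} (hβ : β ≠ 0) {q : ℕ} (hq : 0 < q)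
    (hd : ∀ x : ℤ × ℤ, fdisc D β (x, 2 * q) ≠ 0) {n : ℤ × ℤ} {k τ : ℝ} (hk : 0 < k)
    (hn : n = (1, 0) ∨ n = (0, 1)) (h₁ : p₁ D n = k) (h₂ : p₂ D n ^ 2 = (k * τ) ^ 2) :
    solv D n (convSymm (wave D q n) (fun k => tk D β k (cconv (wave D q n) (wave D q n) k)) (n, q)) =
      lSelf D.ω β q k τ / (2 * β) := by
  have hnn : n ≠ -n := by rcases hn with rfl | rfl <;> decide
  have hn2 : n + n ≠ 0 := by rcases hn with rfl | rfl <;> decide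
  obtain ⟨a, ha⟩ : ∃ a, a = √(psq D n) := ⟨_, rfl⟩
  have hac : a ^ 2 = psq D n := by rw [ha, Real.sq_sqrt (psq_nonneg D n)]
  have hpc : p₁ D n ^ 2 + p₂ D n ^ 2 = psq D n := rfl
  have h20 : cconv (wave D q n) (wave D q n) (n + n, 0) = rv (-(psq D n) / 4) 0 0 := by
    have := convSymm_wave (D := D) hq hnn (wave D q n) (n + n) 0
    rw [zero_mul] at this
    rw [convSymm_self, this]
    simp only [wave_mul hq]
    -- With concrete indices it is decidable which of the four terms meet the support of the other
    -- factor.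
    rcases hn with rfl | rfl <;>
    · simp (decide := true) only [bilSymm_zero, if_true, if_false, zero_add, add_zero]
      simp only [waveCoef, bilSymm_rv, rv_add, rv_smul, psq]
      push_cast
      congr 1 <;> ring_nf
  have h22 : cconv (wave D q n) (wave D q n) (n + n, 2 * q) =
      rv (psq D n / 8) (-a * p₁ D n / 4) (-a * p₂ D n / 4) := by
    have := convSymm_wave (D := D) hq hnn (wave D q n) (n + n) 2
    rw [convSymm_self, this, ha]
    simp only [wave_mul hq]
    rcases hn with rfl | rfl <;>
    · simp (decide := true) only [bilSymm_zero, if_true, if_false, add_zero]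
      simp only [waveCoef, bilSymm_rv, rv_smul, psq]
      push_cast
      congr 1 <;> ring_nf
  have := convSymm_wave (D := D) hq hnn
    (fun k => tk D β k (cconv (wave D q n) (wave D q n) k)) n 1
  rw [one_mul] at this
  rw [this]
  have hΔ := hd (n + n)
  have hr := Real.sq_sqrt (show 0 ≤ 1 + τ ^ 2 by positivity)
  have hc : psq D n = k ^ 2 * (1 + τ ^ 2) := by rw [psq, h₁, h₂]; ring
  have har : a = k * √(1 + τ ^ 2) := by
    rw [ha, hc, Real.sqrt_mul (sq_nonneg k), Real.sqrt_sq hk.le]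
  have hE : mE D (n + n, 2 * (q : ℤ)) = 2 * q * (1 + 4 * D.ω * psq D n) := by
    simp only [mE, psq, p₁_add, p₂_add]
    push_cast
    ring
  have hΔe : fdisc D β (n + n, 2 * (q : ℤ)) = 4 * q ^ 2 * (1 + 4 * D.ω * k ^ 2 * (1 + τ ^ 2)) ^ 2 -
      4 * β ^ 2 * k ^ 2 * (1 + τ ^ 2) := by
    rw [fdisc, hE, mul_assoc _ (k ^ 2), ← hc, mul_assoc _ (k ^ 2), ← hc]
    simp only [psq, p₁_add, p₂_add]
    ring
  have hv : tk D β (n + n, 2 * (q : ℤ)) (rv (psq D n / 8) (-a * p₁ D n / 4) (-a * p₂ D n / 4)) =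
      rv (aEta D.ω β q k τ / 2) (p₁ D n * (aVel D.ω β q k τ / (2 * k)))
        (p₂ D n * (aVel D.ω β q k τ / (2 * k))) := by
    have hq' : (2 * (q : ℤ)) ≠ 0 := by omega
    rw [tk_rv hq' hΔ, hE]
    have hN : psq D (n + n) = 4 * psq D n := by
      simp only [psq, p₁_add, p₂_add]
      ring
    rw [hN, p₁_add, p₂_add]
    have e : (p₁ D n + p₁ D n) * (-a * p₁ D n / 4) + (p₂ D n + p₂ D n) * (-a * p₂ D n / 4) =
        -(a * psq D n) / 2 := by rw [← hpc]; ring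
    rw [e]
    have r3 : √(1 + τ ^ 2) ^ 3 = √(1 + τ ^ 2) * (1 + τ ^ 2) := by
      rw [pow_succ, hr, mul_comm]
    have e1 : (2 * q * (1 + 4 * D.ω * psq D n) * (-(a * psq D n) / 2) -
        β * (4 * psq D n) * (psq D n / 8)) / fdisc D β (n + n, 2 * (q : ℤ)) =
        aEta D.ω β q k τ / 2 := by
      rw [aEta, ← hΔe, har, hc, r3]
      field_simp
      ring
    have e2 : (2 * q * (1 + 4 * D.ω * psq D n) * (psq D n / 8) - β * (-(a * psq D n) / 2)) /
        fdisc D β (n + n, 2 * (q : ℤ)) = aVel D.ω β q k τ / (2 * k) / 2 := by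
      rw [aVel, ← hΔe, har, hc, r3]
      field_simp
      ring
    rw [e1, e2]
    congr 1 <;> ring
  simp only [sub_self, zero_mul, tk_space_zero, bilSymm_zero, zero_add, one_add_one_eq_two, h20, h22,
    hv, tk_rv_time_zero hn2]
  simp only [waveCoef, psq_neg, p₁_neg, p₂_neg, bilSymm_rv, rv_add, solv_rv, ← ha]
  push_cast
  rw [lSelf]
  have r3 : √(1 + τ ^ 2) ^ 3 = √(1 + τ ^ 2) * (1 + τ ^ 2) := by
    rw [pow_succ, hr, mul_comm]
  have r4 : k ^ 4 * (1 + τ ^ 2) ^ 2 = psq D n ^ 2 := by rw [hc]; ring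
  have r5 : β * aVel D.ω β q k τ * k ^ 2 * √(1 + τ ^ 2) ^ 3 =
      β * aVel D.ω β q k τ * a * psq D n / k := by
    rw [r3, har, hc]; field_simp
  have r6 : β * aEta D.ω β q k τ * k ^ 2 * (1 + τ ^ 2) = β * aEta D.ω β q k τ * psq D n := by
    rw [hc]; ring
  rw [r4, r5, r6, ← hpc]
  field_simp
  ring


/-- A product with wave n reaches index n only from 0 or 2n. The square of wave n' has no part at
2n, and 𝒯 removes index 0. -/
lemma square_interaction {D : Params} {β : ℝ} {q : ℕ} (hq : 0 < q) {n n' : ℤ × ℤ}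
    (hn : n = (1, 0) ∧ n' = (0, 1) ∨ n = (0, 1) ∧ n' = (1, 0)) :
    convSymm (wave D q n) (fun k => tk D β k (cconv (wave D q n') (wave D q n') k)) (n, q) = 0 := by
  have hnn : n ≠ -n := by rcases hn with ⟨rfl, rfl⟩ | ⟨rfl, rfl⟩ <;> decide
  have hnn' : n' ≠ -n' := by rcases hn with ⟨rfl, rfl⟩ | ⟨rfl, rfl⟩ <;> decide
  have h2 : ∀ t : ℤ, cconv (wave D q n') (wave D q n') (n + n, t * q) = 0 := by
    intro t
    rw [convSymm_self, convSymm_wave (D := D) hq hnn' (wave D q n') (n + n) t]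
    simp only [wave_mul hq]
    rcases hn with ⟨rfl, rfl⟩ | ⟨rfl, rfl⟩ <;>
    · simp (decide := true) only [bilSymm_zero, if_false, add_zero, false_and, smul_zero]
  have := convSymm_wave (D := D) hq hnn
    (fun k => tk D β k (cconv (wave D q n') (wave D q n') k)) n 1
  rw [one_mul] at this
  rw [this]
  simp only [sub_self, tk_space_zero, h2, bilSymm_zero, map_zero, add_zero]

/-- Returning to n with a factor of wave n' starts from n + n' or n - n'. The time frequency 0
yields the term g²/(2β), and 2q yields the terms in (η, w) and (η', w'). -/
lemma mixed_interaction {D : Params} {β : ℝ} (hβ : β ≠ 0) {q : ℕ} (hq : 0 < q)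
    (hd : ∀ x : ℤ × ℤ, fdisc D β (x, 2 * q) ≠ 0) {n n' : ℤ × ℤ}
    (hn : n = (1, 0) ∧ n' = (0, 1) ∨ n = (0, 1) ∧ n' = (1, 0))
    {a b g N M e f η w η' w' : ℝ} (ha : a = √(psq D n)) (hb : b = √(psq D n'))
    (hg : g = p₁ D n * p₁ D n' + p₂ D n * p₂ D n')
    (hN : N = psq D (n + n')) (hM : M = psq D (n - n'))
    (he : e = p₁ D (n + n') * (a * p₁ D n' + b * p₁ D n) + p₂ D (n + n') * (a * p₂ D n' + b * p₂ D n))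
    (hf : f = p₁ D (n - n') * (a * p₁ D n' - b * p₁ D n) + p₂ D (n - n') * (a * p₂ D n' - b * p₂ D n))
    (hη : η = (-(2 * q * (1 + D.ω * N) * e) - β * g * N) / (4 * fdisc D β (n + n', 2 * q)))
    (hw : w = (2 * q * g * (1 + D.ω * N) + β * e) / (4 * fdisc D β (n + n', 2 * q)))
    (hη' : η' = (2 * q * (1 + D.ω * M) * f + β * g * M) / (4 * fdisc D β (n - n', 2 * q)))
    (hw' : w' = (-(2 * q * g * (1 + D.ω * M)) - β * f) / (4 * fdisc D β (n - n', 2 * q))) :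
    solv D n (convSymm (wave D q n')
        (fun k => tk D β k (convSymm (wave D q n) (wave D q n') k)) (n, q)) =
      g ^ 2 / (2 * β) + (g * (η - η') - w * e + w' * f) / 2 := by
  have hnn : n ≠ -n := by rcases hn with ⟨rfl, rfl⟩ | ⟨rfl, rfl⟩ <;> decide
  have hnn' : n' ≠ -n' := by rcases hn with ⟨rfl, rfl⟩ | ⟨rfl, rfl⟩ <;> decide
  have hs : n + n' ≠ 0 := by rcases hn with ⟨rfl, rfl⟩ | ⟨rfl, rfl⟩ <;> decide
  have hs' : n - n' ≠ 0 := by rcases hn with ⟨rfl, rfl⟩ | ⟨rfl, rfl⟩ <;> decide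
  have hp0 : convSymm (wave D q n) (wave D q n') (n + n', 0) = rv (-g / 2) 0 0 := by
    have := convSymm_wave (D := D) hq hnn (wave D q n') (n + n') 0
    rw [zero_mul] at this
    rw [this, hg]
    simp only [wave_mul hq]
    rcases hn with ⟨rfl, rfl⟩ | ⟨rfl, rfl⟩ <;>
    · simp (decide := true) only [bilSymm_zero, if_true, if_false, zero_add, add_zero]
      simp only [waveCoef, bilSymm_rv, rv_add]
      push_cast
      congr 1 <;> ring_nf
  have hm0 : convSymm (wave D q n) (wave D q n') (n - n', 0) = rv (g / 2) 0 0 := by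
    have := convSymm_wave (D := D) hq hnn (wave D q n') (n - n') 0
    rw [zero_mul] at this
    rw [this, hg]
    simp only [wave_mul hq]
    rcases hn with ⟨rfl, rfl⟩ | ⟨rfl, rfl⟩ <;>
    · simp (decide := true) only [bilSymm_zero, if_true, if_false, zero_add, add_zero]
      simp only [waveCoef, bilSymm_rv, rv_add, p₁, p₂, psq]
      simp
      congr 1 <;> ring_nf
  have hp2 : convSymm (wave D q n) (wave D q n') (n + n', 2 * q) =
      rv (g / 4) (-(a * p₁ D n' + b * p₁ D n) / 4) (-(a * p₂ D n' + b * p₂ D n) / 4) := by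
    have := convSymm_wave (D := D) hq hnn (wave D q n') (n + n') 2
    rw [this, hg, ha, hb]
    simp only [wave_mul hq]
    rcases hn with ⟨rfl, rfl⟩ | ⟨rfl, rfl⟩ <;>
    · simp (decide := true) only [bilSymm_zero, if_true, if_false, add_zero]
      simp only [waveCoef, bilSymm_rv, p₁, p₂, psq]
      simp
      congr 1 <;> ring_nf
  have hm2 : convSymm (wave D q n) (wave D q n') (n - n', 2 * q) =
      rv (-g / 4) ((a * p₁ D n' - b * p₁ D n) / 4) ((a * p₂ D n' - b * p₂ D n) / 4) := by
    have := convSymm_wave (D := D) hq hnn (wave D q n') (n - n') 2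
    rw [this, hg, ha, hb]
    simp only [wave_mul hq]
    rcases hn with ⟨rfl, rfl⟩ | ⟨rfl, rfl⟩ <;>
    · simp (decide := true) only [bilSymm_zero, if_true, if_false, add_zero]
      simp only [waveCoef, bilSymm_rv, p₁, p₂, psq]
      simp
      congr 1 <;> ring_nf
  have hq' : (2 * (q : ℤ)) ≠ 0 := by omega
  have tp : tk D β (n + n', 2 * (q : ℤ)) (convSymm (wave D q n) (wave D q n') (n + n', 2 * q)) =
      rv η (p₁ D (n + n') * w) (p₂ D (n + n') * w) := by
    have hΔ := hd (n + n')
    have e1 : p₁ D (n + n') * (-(a * p₁ D n' + b * p₁ D n) / 4) +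
        p₂ D (n + n') * (-(a * p₂ D n' + b * p₂ D n) / 4) = -e / 4 := by rw [he]; ring
    rw [hp2, tk_rv hq' hΔ]
    dsimp only
    rw [e1, ← hN, hη, hw, mE]
    dsimp only
    rw [← hN]
    push_cast
    congr 1 <;> field_simp <;> ring
  have tm : tk D β (n - n', 2 * (q : ℤ)) (convSymm (wave D q n) (wave D q n') (n - n', 2 * q)) =
      rv η' (p₁ D (n - n') * w') (p₂ D (n - n') * w') := by
    have hΔ := hd (n - n')
    have e1 : p₁ D (n - n') * ((a * p₁ D n' - b * p₁ D n) / 4) +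
        p₂ D (n - n') * ((a * p₂ D n' - b * p₂ D n) / 4) = f / 4 := by rw [hf]; ring
    rw [hm2, tk_rv hq' hΔ]
    dsimp only
    rw [e1, ← hM, hη', hw', mE]
    dsimp only
    rw [← hM]
    push_cast
    congr 1 <;> field_simp <;> ring
  have := convSymm_wave (D := D) hq hnn'
    (fun k => tk D β k (convSymm (wave D q n) (wave D q n') k)) n 1
  rw [one_mul] at this
  rw [this]
  simp only [sub_self, zero_mul, one_add_one_eq_two, tp, tm]
  simp only [hp0, hm0, tk_rv_time_zero hs, tk_rv_time_zero hs']
  simp only [waveCoef, psq_neg, p₁_neg, p₂_neg, bilSymm_rv, rv_add, solv_rv, ← ha, ← hb]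
  push_cast
  rw [hg, he, hf]
  field_simp
  ring

/-- The quantities g, e, f do not change when the waves are exchanged; in f both n - n' and the
vector paired with it change sign. This is why the same l₂ occurs in both amplitude equations. -/
lemma mixed_interaction_eq {D : Params} (hD : D.IsPos) {β : ℝ} (hβ : β ≠ 0) {q : ℕ} (hq : 0 < q)
    (hd : ∀ x : ℤ × ℤ, fdisc D β (x, 2 * q) ≠ 0) {n n' : ℤ × ℤ}
    (hn : n = (1, 0) ∧ n' = (0, 1) ∨ n = (0, 1) ∧ n' = (1, 0)) :
    solv D n (convSymm (wave D q n')
        (fun k => tk D β k (convSymm (wave D q n) (wave D q n') k)) (n, q)) =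
      l₂ D β q / (2 * β) := by
  have hd₁ : ∀ x, fdisc D β (x, 2 * (q : ℤ)) =
      4 * q ^ 2 * (1 + D.ω * psq D x) ^ 2 - β ^ 2 * psq D x := fun x => by
    simp only [fdisc, mE]
    push_cast
    ring
  have x1 := p₁_one_zero D
  have y1 := p₂_one_zero D
  have x2 := p₁_zero_one D
  have y2 := p₂_zero_one D
  have c1 := sqrt_psq_one_zero hD
  have c2 := sqrt_psq_zero_one hD
  have sub₁ : ∀ x y, p₁ D (x - y) = p₁ D x - p₁ D y := fun x y => by
    rw [sub_eq_add_neg, p₁_add, p₁_neg, sub_eq_add_neg]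
  have sub₂ : ∀ x y, p₂ D (x - y) = p₂ D x - p₂ D y := fun x y => by
    rw [sub_eq_add_neg, p₂_add, p₂_neg, sub_eq_add_neg]
  have hN : nPlus D = psq D (n + n') := by
    rcases hn with ⟨rfl, rfl⟩ | ⟨rfl, rfl⟩ <;>
    · rw [psq, p₁_add, p₂_add, x1, x2, y1, y2, nPlus]
      ring
  have hM : nMinus D = psq D (n - n') := by
    rcases hn with ⟨rfl, rfl⟩ | ⟨rfl, rfl⟩ <;>
    · rw [psq, sub₁, sub₂, x1, x2, y1, y2, nMinus]
      ring
  have hΔ := hd (n + n')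
  have hΔ' := hd (n - n')
  have e1 : fdisc D β (n + n', 2 * (q : ℤ)) = d₁ D β q := by rw [hd₁, ← hN, d₁]
  have e2 : fdisc D β (n - n', 2 * (q : ℤ)) = d₂ D β q := by rw [hd₁, ← hM, d₂]
  rw [e1] at hΔ
  rw [e2] at hΔ'
  -- The b and r have denominators 2d where the response coefficients have 4d, hence the halves.
  rw [mixed_interaction hβ hq hd hn (a := √(psq D n)) (b := √(psq D n')) rfl rfl
    (g := D.k₁ * D.k₂ * (1 - D.τ₁ * D.τ₂)) (N := nPlus D) (M := nMinus D) (e := ePlus D)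
    (f := eMinus D) (η := b₁ D β q / 2) (w := rPlus D β q / 2) (η' := b₄ D β q / 2)
    (w' := rMinus D β q / 2)]
  · rw [l₂, b₂, b₃, b₅, b₆, ePlus, eMinus]
    field_simp
    ring
  · rcases hn with ⟨rfl, rfl⟩ | ⟨rfl, rfl⟩ <;>
    · rw [x1, x2, y1, y2]
      ring
  · exact hN
  · exact hM
  · rcases hn with ⟨rfl, rfl⟩ | ⟨rfl, rfl⟩ <;>
    · rw [p₁_add, p₂_add, x1, x2, y1, y2, c1, c2, ePlus]
      ring
  · rcases hn with ⟨rfl, rfl⟩ | ⟨rfl, rfl⟩ <;>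
    · rw [sub₁, sub₂, x1, x2, y1, y2, c1, c2, eMinus]
      ring
  · rw [e1, b₁]
    field_simp
    ring
  · rw [e1, rPlus]
    field_simp
    ring
  · rw [e2, b₄]
    field_simp
    ring
  · rw [e2, rMinus]
    field_simp
    ring

/-! ### The linear part of the bifurcation function -/

/-- The assumptions on the parameters. -/
structure Resonant (D : Params) (β : ℝ) (q : ℕ) : Prop where
  pos : D.IsPos
  β_pos : 0 < β
  set_eq : resonanceSet D β = {((1, 0), q), ((-1, 0), q), ((0, 1), q), ((0, -1), q)}

namespace Resonant

variable {D : Params} {β : ℝ} {q : ℕ}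

lemma mem_one_zero (h : Resonant D β q) : (((1, 0), q) : Mode) ∈ resonanceSet D β := by
  rw [h.set_eq]; simp

lemma mem_zero_one (h : Resonant D β q) : (((0, 1), q) : Mode) ∈ resonanceSet D β := by
  rw [h.set_eq]; simp

lemma q_pos (h : Resonant D β q) : 0 < q := h.mem_one_zero.1

/-- A difference of squares. For m ≠ 0 the second factor is positive, so the discriminant vanishes
exactly when |m| satisfies the resonance relation. -/
lemma fdisc_eq {D : Params} {β : ℝ} (k : Freq) :
    fdisc D β k = (|(k.2 : ℝ)| * (1 + D.ω * psq D k.1) - β * √(psq D k.1)) *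
      (|(k.2 : ℝ)| * (1 + D.ω * psq D k.1) + β * √(psq D k.1)) := by
  have h1 := Real.sq_sqrt (psq_nonneg D k.1)
  have h2 := sq_abs (k.2 : ℝ)
  rw [fdisc, mE]
  linear_combination β ^ 2 * h1 - (1 + D.ω * psq D k.1) ^ 2 * h2

lemma fdisc_eq_zero_iff (h : Resonant D β q) {k : Freq} (hk : k.2 ≠ 0) :
    fdisc D β k = 0 ↔ k ∈ waveSupp q (1, 0) ∨ k ∈ waveSupp q (0, 1) := by
  have hp := psq_nonneg D k.1
  have hω := h.pos.ω
  have hβ := h.β_pos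
  have ha : 0 < |(k.2 : ℝ)| := abs_pos.2 (by exact_mod_cast hk)
  have hs := Real.sqrt_nonneg (psq D k.1)
  have h2 : |(k.2 : ℝ)| * (1 + D.ω * psq D k.1) + β * √(psq D k.1) ≠ 0 := by positivity
  have h3 : fdisc D β k = 0 ↔ ((k.1, k.2.natAbs) : Mode) ∈ resonanceSet D β := by
    rw [fdisc_eq, mul_eq_zero, or_iff_left h2]
    have e : ((k.2.natAbs : ℕ) : ℝ) = |(k.2 : ℝ)| := by rw [Nat.cast_natAbs, Int.cast_abs]
    constructor
    · exact fun h0 => ⟨Int.natAbs_pos.2 hk, by rw [e]; exact h0⟩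
    · intro h0
      have := h0.2
      rwa [e] at this
  rw [h3, h.set_eq]
  obtain ⟨x, m⟩ := k
  have h4 : ∀ y : ℤ × ℤ, ((x, m.natAbs) : Mode) = (y, q) ↔
      ((x, m) : Freq) = (y, (q : ℤ)) ∨ ((x, m) : Freq) = (y, -(q : ℤ)) := by
    intro y
    simp only [Prod.mk.injEq, ← and_or_left]
    refine and_congr_right fun _ => ?_
    omega
  have n1 : (-(1, 0) : ℤ × ℤ) = (-1, 0) := rfl
  have n2 : (-(0, 1) : ℤ × ℤ) = (0, -1) := rfl
  simp only [waveSupp, Set.mem_insert_iff, Set.mem_singleton_iff, Finset.mem_insert,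
    Finset.mem_singleton, h4, n1, n2]
  constructor
  · rintro ((h | h) | (h | h) | (h | h) | (h | h)) <;> simp [h]
  · rintro ((h | h | h | h) | (h | h | h | h)) <;> simp [h]

/-- Resonances occur only at the time frequencies ±q. So at 2q the operator 𝒯 is a genuine inverse
and the denominators in the l_j are nonzero. -/
lemma fdisc_two (h : Resonant D β q) (x : ℤ × ℤ) : fdisc D β (x, 2 * q) ≠ 0 := by
  have hq := h.q_pos
  intro h0
  have := (h.fdisc_eq_zero_iff (k := (x, 2 * (q : ℤ))) (by simp; omega)).1 h0
  simp only [waveSupp, Finset.mem_insert, Finset.mem_singleton, Prod.mk.injEq] at this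
  omega

lemma dispersion_one_zero (h : Resonant D β q) :
    (q : ℝ) * (1 + D.ω * psq D (1, 0)) = β * √(psq D (1, 0)) := sub_eq_zero.1 h.mem_one_zero.2

lemma dispersion_zero_one (h : Resonant D β q) :
    (q : ℝ) * (1 + D.ω * psq D (0, 1)) = β * √(psq D (0, 1)) := sub_eq_zero.1 h.mem_zero_one.2

end Resonant

section Derivative

variable {D : Params} {β s K : ℝ} {q : ℕ}

lemma summable_wt_of_finite {u : Freq → Coef} {S : Finset Freq} (hu : ∀ k ∉ S, u k = 0) :
    Summable fun k => wt s k * ‖u k‖ :=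
  summable_of_ne_finset_zero (s := S) fun k hk => by rw [hu k hk, norm_zero, mul_zero]

/-- The wave, as an element of `Wiener`. -/
def waveE (D : Params) (s : ℝ) (q : ℕ) (n : ℤ × ℤ) : Wiener :=
  ofCoef s (wave D q n) (summable_wt_of_finite fun _ => wave_eq_zero)

/-- The constant elevation, as an element of `Wiener`. -/
def elevE (s : ℝ) : Wiener :=
  ofCoef s unitElev (summable_wt_of_finite fun _ => unitElev_eq_zero)

lemma coef_waveE (n : ℤ × ℤ) : coef s (waveE D s q n) = wave D q n := coef_ofCoef _

lemma coef_elevE : coef s (elevE s) = unitElev := coef_ofCoef _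

/-- The solvability functional at `(n, q)` on `Wiener`. -/
def solvE (D : Params) (hs : 0 ≤ s) (q : ℕ) (n : ℤ × ℤ) : Wiener →L[ℝ] ℝ :=
  (solv D n).comp (evalCoef hs (n, (q : ℤ)))

lemma solvE_apply (hs : 0 ≤ s) (n : ℤ × ℤ) (x : Wiener) :
    solvE D hs q n x = solv D n (coef s x (n, q)) := rfl

lemma solvE_symm (hs : 0 ≤ s) (n : ℤ × ℤ) (x y : Wiener) :
    solvE D hs q n (opB hs x y + opB hs y x) =
      solv D n (convSymm (coef s x) (coef s y) (n, q)) := by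
  rw [solvE_apply, coef_add, coef_opB, coef_opB]
  rfl

lemma solvE_wave (hs : 0 ≤ s) (hq : 0 < q) (n : ℤ × ℤ) :
    solvE D hs q n (waveE D s q n) = psq D n := by
  have h1 := wave_mul (D := D) hq n n 1
  simp only [true_or, and_self, if_true, one_mul] at h1
  rw [solvE_apply, coef_waveE, h1, solv_wave]

/-- The diagonal coefficients l₁ and l₃ come from the response of E to the square of the wave
itself. The off-diagonal l₂ comes entirely from D, because the response of E to the square of the
other wave does not contribute. -/
lemma fderiv_bif_waves (h : Resonant D β q) (hs : 0 ≤ s) (hK : ∀ k F, ‖tk D β k F‖ ≤ K * ‖F‖)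
    {z : Par → Wiener × Wiener × Wiener × Wiener} (hz : ContDiffAt ℝ 2 z 0)
    (hz0 : z 0 = base (opT s hK) (opB hs) β (waveE D s q (1, 0)) (waveE D s q (0, 1)))
    (hr : ∀ᶠ y in nhds 0, residual (opT s hK) (opB hs) β (elevE s) (waveE D s q (1, 0))
      (waveE D s q (0, 1)) (y, z y) = 0) (y : Par) :
    fderiv ℝ (bifFun (solvE D hs q (1, 0)) (solvE D hs q (0, 1)) (opB hs) β z) 0 y =
      ((psq D (1, 0) * (2 * y.1.1 + y.1.2 * β) -
          β * (l₁ D β q * y.2.1 + l₂ D β q * y.2.2)) / 2,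
        (psq D (0, 1) * (2 * y.1.1 + y.1.2 * β) -
          β * (l₂ D β q * y.2.1 + l₃ D β q * y.2.2)) / 2) := by
  have hq := h.q_pos
  have hβ := h.β_pos.ne'
  have hd := h.fdisc_two
  rw [fderiv_bif hz hz0 hr _ _ y rfl rfl]
  have key : ∀ (n n' : ℤ × ℤ) (L : ℝ), (n = (1, 0) ∧ n' = (0, 1) ∨ n = (0, 1) ∧ n' = (1, 0)) →
      solv D n (convSymm (wave D q n) (fun k => tk D β k (cconv (wave D q n) (wave D q n) k))
        (n, q)) = L / (2 * β) → ∀ (a a' : ℝ) (V : Wiener),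
      V = a • opB hs (waveE D s q n) (waveE D s q n) + a' • opB hs (waveE D s q n') (waveE D s q n') →
      ∀ W : Wiener, W = opB hs (waveE D s q n) (waveE D s q n') +
        opB hs (waveE D s q n') (waveE D s q n) →
      solvE D hs q n (y.1.1 • waveE D s q n + β • (opB hs (y.1.2 • elevE s - β • opT s hK V)
          (waveE D s q n) + opB hs (waveE D s q n) (y.1.2 • elevE s - β • opT s hK V) +
        a' • (opB hs (waveE D s q n') (-(β • opT s hK W)) +
          opB hs (-(β • opT s hK W)) (waveE D s q n')))) =
      (psq D n * (2 * y.1.1 + y.1.2 * β) - β * (L * a + l₂ D β q * a')) / 2 := by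
    intro n n' L hn hL a a' V hV W hW
    have i0 := solvE_symm (D := D) (q := q) hs n (elevE s) (waveE D s q n)
    have i1 := solvE_symm (D := D) (q := q) hs n (waveE D s q n)
      (opT s hK (opB hs (waveE D s q n) (waveE D s q n)))
    have i2 := solvE_symm (D := D) (q := q) hs n (waveE D s q n)
      (opT s hK (opB hs (waveE D s q n') (waveE D s q n')))
    have i3 := solvE_symm (D := D) (q := q) hs n (waveE D s q n') (opT s hK W)
    have e3 : (fun k => tk D β k (coef s W k)) =
        fun k => tk D β k (convSymm (wave D q n) (wave D q n') k) := by
      rw [hW, coef_add, coef_opB, coef_opB, coef_waveE, coef_waveE]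
      rfl
    rw [coef_elevE, coef_waveE, solv_unitElev hq] at i0
    rw [coef_opT, coef_opB, coef_waveE, hL] at i1
    rw [coef_opT, coef_opB, coef_waveE, coef_waveE, square_interaction hq hn, map_zero] at i2
    rw [coef_opT, e3, coef_waveE, mixed_interaction_eq h.pos hβ hq hd hn] at i3
    have i4 := solvE_wave (D := D) hs hq n
    rw [map_add] at i0 i1 i2 i3
    rw [hV]
    simp only [map_add, map_smul, map_sub, map_neg, sub_apply, neg_apply, smul_apply, add_apply,
      smul_eq_mul, i4]
    have c : β * (L / (2 * β)) = L / 2 := by field_simp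
    have c' : β * (l₂ D β q / (2 * β)) = l₂ D β q / 2 := by field_simp
    linear_combination β * y.1.2 * i0 - β ^ 2 * a * i1 - β ^ 2 * a' * i2 - β ^ 2 * a' * i3 -
      β * a * c - β * a' * c'
  rw [key (1, 0) (0, 1) (l₁ D β q) (Or.inl ⟨rfl, rfl⟩)
      (self_interaction hβ hq hd h.pos.k₁ (Or.inl rfl) (p₁_one_zero D) (by rw [p₂_one_zero]))
      y.2.1 y.2.2 _ rfl _ rfl,
    key (0, 1) (1, 0) (l₃ D β q) (Or.inr ⟨rfl, rfl⟩)
      (self_interaction hβ hq hd h.pos.k₂ (Or.inr rfl) (p₁_zero_one D)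
        (by rw [p₂_zero_one, neg_sq])) y.2.2 y.2.1 _ (add_comm _ _) _ (add_comm _ _)]
  congr 2
  ring

end Derivative

/-! ### Properties of the solutions on the branch -/

/-- Coefficients of `X(C, A₁, A₂)`. -/
def leadCoef (D : Params) (q : ℕ) (C A₁ A₂ : ℝ) : Freq → Coef :=
  C • unitElev + A₁ • wave D q (1, 0) + A₂ • wave D q (0, 1)

/-- `X(C, A₁, A₂)` as an element of `Wiener`. -/
def leadE (D : Params) (s : ℝ) (q : ℕ) (C A₁ A₂ : ℝ) : Wiener :=
  C • elevE s + A₁ • waveE D s q (1, 0) + A₂ • waveE D s q (0, 1)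

lemma coef_leadE (D : Params) (s : ℝ) (q : ℕ) (C A₁ A₂ : ℝ) :
    coef s (leadE D s q C A₁ A₂) = leadCoef D q C A₁ A₂ := by
  simp only [leadE, leadCoef, coef_add, coef_smul, coef_elevE, coef_waveE]

/-- Translation in space. -/
def shiftSym (D : Params) (β : ℝ) (σ : ℝ × ℝ) : CoefSym D β :=
  phaseSym D β (fun k => expMode D k.1 σ) (fun k => norm_expMode D k.1 σ)
    (fun j k => by rw [Prod.fst_add, expMode_add])

lemma shiftSym_act (D : Params) (β : ℝ) (σ : ℝ × ℝ) (u : Freq → Coef) (k : Freq) :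
    (shiftSym D β σ).act u k = expMode D k.1 σ • u k := rfl

lemma expMode_cellPoint {D : Params} (hD : D.IsPos) (n : ℤ × ℤ) (y₁ y₂ : ℝ) :
    expMode D n (cellPoint D y₁ y₂) =
      Complex.exp (I * (n.1 * y₁ : ℝ)) * Complex.exp (I * (n.2 * y₂ : ℝ)) := by
  simpa [char] using char_cellPoint hD (n, 0) y₁ y₂ 0

lemma expMode_neg (D : Params) (n : ℤ × ℤ) (x : ℝ × ℝ) :
    expMode D (-n) x = (expMode D n x)⁻¹ := by
  refine eq_inv_of_mul_eq_one_left ?_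
  rw [← expMode_add, neg_add_cancel, expMode_zero]

/-- As r⁻¹ = r, the phase is the same at n and -n, so the translation multiplies the whole wave by
r. Thus half-period translations flip the signs of amplitudes. -/
lemma smul_wave {D : Params} {q : ℕ} {n : ℤ × ℤ} {σ : ℝ × ℝ} {r : ℝ} (hr : r ^ 2 = 1)
    (h : expMode D n σ = r) (k : Freq) :
    expMode D k.1 σ • wave D q n k = r • wave D q n k := by
  rw [wave]
  split_ifs with hk
  · have h' : expMode D k.1 σ = (r : ℂ) := by
      rcases hk.1 with hk | hk
      · rw [hk, h]
      · rw [hk, expMode_neg, h]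
        refine inv_eq_of_mul_eq_one_left ?_
        rw [← sq]
        exact_mod_cast hr
    rw [h', Complex.coe_smul]
  · simp

lemma shiftSym_lead {D : Params} {β : ℝ} {q : ℕ} {C A₁ A₂ r₁ r₂ : ℝ} {σ : ℝ × ℝ}
    (h₁ : r₁ ^ 2 = 1) (h₂ : r₂ ^ 2 = 1) (e₁ : expMode D (1, 0) σ = r₁)
    (e₂ : expMode D (0, 1) σ = r₂) :
    (shiftSym D β σ).act (leadCoef D q C A₁ A₂) = leadCoef D q C (r₁ * A₁) (r₂ * A₂) := by
  funext k
  have h0 : expMode D k.1 σ • unitElev k = unitElev k := by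
    rw [unitElev]
    split_ifs with hk
    · rw [hk, Prod.fst_zero, expMode_zero, one_smul]
    · rw [smul_zero]
  simp only [shiftSym_act, leadCoef, Pi.add_apply, Pi.smul_apply, smul_add]
  rw [smul_comm _ C, smul_comm _ A₁, smul_comm _ A₂, h0, smul_wave h₁ e₁, smul_wave h₂ e₂,
    smul_smul, smul_smul, mul_comm A₁, mul_comm A₂]

lemma conjL_rv (a b c : ℝ) : conjL (rv a b c) = rv a b c := by
  simp [conjL_apply, rv]

lemma refl_rv (a b c : ℝ) : refl (rv a b c) = rv a (-b) (-c) := by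
  simp [refl, rv]

lemma unitElev_apply (k : Freq) : unitElev k = rv (if k = 0 then 1 else 0) 0 0 := by
  rw [unitElev]
  split_ifs <;> simp [rv, Prod.ext_iff]

lemma conjSym_lead (D : Params) (β : ℝ) (q : ℕ) (C A₁ A₂ : ℝ) :
    (conjSym D β).act (leadCoef D q C A₁ A₂) = leadCoef D q C A₁ A₂ := by
  have hw : ∀ n k, conjL (wave D q n k) = wave D q n k := fun n k => by
    rw [wave]
    split_ifs
    · rw [waveCoef, conjL_rv]
    · rw [map_zero]
  funext k
  change conjL (leadCoef D q C A₁ A₂ k) = _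
  simp only [leadCoef, Pi.add_apply, Pi.smul_apply, map_add, map_smul, hw, unitElev_apply, conjL_rv]

lemma timeSym_lead (D : Params) (β : ℝ) (q : ℕ) (C A₁ A₂ : ℝ) :
    (timeSym D β).act (leadCoef D q C A₁ A₂) = leadCoef D q C A₁ A₂ := by
  have hw : ∀ n k, reflL (wave D q n (timeNeg k)) = wave D q n k := fun n k => by
    have e : (k.2 = -(q : ℤ) ∨ k.2 = q) ↔ (k.2 = q ∨ k.2 = -(q : ℤ)) := or_comm
    simp only [wave, timeNeg_apply, neg_inj, neg_eq_iff_eq_neg (b := (q : ℤ)), e]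
    split_ifs
    · rw [waveCoef, waveCoef, reflL_apply, refl_rv]
      simp [Int.sign_neg, neg_div]
    · rw [map_zero]
  funext k
  change reflL (leadCoef D q C A₁ A₂ (timeNeg k)) = _
  simp only [leadCoef, Pi.add_apply, Pi.smul_apply, map_add, map_smul, hw]
  simp [unitElev_apply, reflL_apply, refl_rv]

lemma spaceSym_lead (D : Params) (β : ℝ) (q : ℕ) (C A₁ A₂ : ℝ) :
    (spaceSym D β).act (leadCoef D q C A₁ A₂) = leadCoef D q C A₁ A₂ := by
  have hw : ∀ n k, reflL (wave D q n (spaceNeg k)) = wave D q n k := fun n k => by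
    have e : (k.1 = -n ∨ k.1 = n) ↔ (k.1 = n ∨ k.1 = -n) := or_comm
    simp only [wave, spaceNeg_apply, neg_inj, neg_eq_iff_eq_neg (b := n), e]
    split_ifs
    · rw [waveCoef, waveCoef, reflL_apply, refl_rv, psq_neg, p₁_neg, p₂_neg]
      congr 1 <;> ring
    · rw [map_zero]
  funext k
  change reflL (leadCoef D q C A₁ A₂ (spaceNeg k)) = _
  simp only [leadCoef, Pi.add_apply, Pi.smul_apply, map_add, map_smul, hw]
  simp [unitElev_apply, reflL_apply, refl_rv]

/-- The dispersion relation q(1 + ω|p|²) = β|p| at P₁ and P₂ makes the waves null vectors; for m =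
-q the sign enters only through its square. -/
lemma inKer_lead {D : Params} {β : ℝ} {q : ℕ} (h : Resonant D β q) (C A₁ A₂ : ℝ) :
    InKer D β (leadCoef D q C A₁ A₂) := by
  have hw : ∀ n, (q : ℝ) * (1 + D.ω * psq D n) = β * √(psq D n) → InKer D β (wave D q n) := by
    intro n hn k
    rw [wave]
    split_ifs with hk
    · have hm : mE D k = k.2.sign * (β * √(psq D k.1)) := by
        have hp : psq D k.1 = psq D n := by
          rcases hk.1 with hk | hk <;> rw [hk]
          rw [psq_neg]
        have hsq : (k.2 : ℝ) = k.2.sign * q := by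
          have hqs : (q : ℤ).sign = 1 := Int.sign_eq_one_of_pos (by exact_mod_cast h.q_pos)
          rcases hk.2 with hk | hk <;> rw [hk] <;> simp [Int.sign_neg, hqs]
        rw [mE, hp, hsq, mul_assoc, hn]
      have hs : ((k.2.sign : ℝ)) ^ 2 = 1 := by
        have hqs : (q : ℤ).sign = 1 := Int.sign_eq_one_of_pos (by exact_mod_cast h.q_pos)
        rcases hk.2 with hk | hk <;> rw [hk] <;> simp [Int.sign_neg, hqs]
      have ha := Real.sq_sqrt (psq_nonneg D k.1)
      simp only [waveCoef, rv, pdot, hm]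
      generalize (k.2.sign : ℝ) = σ at *
      generalize √(psq D k.1) = a at *
      rw [psq] at ha
      have ha' : (a : ℂ) ^ 2 = p₁ D k.1 ^ 2 + p₂ D k.1 ^ 2 := by exact_mod_cast ha
      have hs' : (σ : ℂ) ^ 2 = 1 := by exact_mod_cast hs
      push_cast
      refine ⟨?_, ?_, ?_⟩
      · linear_combination (σ : ℂ) * β / 2 * ha'
      · linear_combination -(β : ℂ) * a * p₁ D k.1 / 2 * hs'
      · linear_combination -(β : ℂ) * a * p₂ D k.1 / 2 * hs'
    · simp [pdot]
  have h0 : InKer D β unitElev := by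
    intro k
    rw [unitElev]
    split_ifs with hk
    · simp [hk, mE, pdot, p₁, p₂]
    · simp [pdot]
  intro k
  obtain ⟨a1, a2, a3⟩ := h0 k
  obtain ⟨b1, b2, b3⟩ := hw _ h.dispersion_one_zero k
  obtain ⟨c1, c2, c3⟩ := hw _ h.dispersion_zero_one k
  simp only [leadCoef, Pi.add_apply, Pi.smul_apply, pdot_add, pdot_smul, Prod.fst_add,
    Prod.snd_add, Prod.smul_fst, Prod.smul_snd, Complex.real_smul]
  refine ⟨?_, ?_, ?_⟩
  · linear_combination (C : ℂ) * a1 + (A₁ : ℂ) * b1 + (A₂ : ℂ) * c1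
  · linear_combination (C : ℂ) * a2 + (A₁ : ℂ) * b2 + (A₂ : ℂ) * c2
  · linear_combination (C : ℂ) * a3 + (A₁ : ℂ) * b3 + (A₂ : ℂ) * c3

/-! ### Symmetry of the branch and factorization of the solvability conditions -/

section Branch

variable {D : Params} {β s K η μ C A₁ A₂ : ℝ} {q : ℕ} {z : Wiener × Wiener × Wiener × Wiener}

lemma rhs_coef (hs : 0 ≤ s) (β μ : ℝ) (x : Wiener) :
    rhs β μ (coef s x) = coef s (μ • x + (β + μ) • opB hs x x) := by
  funext k
  rw [coef_add, coef_smul, coef_smul, coef_opB]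
  rfl

lemma fixed_iff (hs : 0 ≤ s) (hK : ∀ k F, ‖tk D β k F‖ ≤ K * ‖F‖) (X x : Wiener) :
    Fixed D β μ (coef s X) (coef s x) ↔
      x = X - opT s hK (μ • x + (β + μ) • opB hs x x) := by
  have e : ∀ k, coef s X k - tk D β k (rhs β μ (coef s x) k) =
      coef s (X - opT s hK (μ • x + (β + μ) • opB hs x x)) k := fun k => by
    rw [coef_sub, coef_opT, rhs_coef hs]
    rfl
  constructor
  · intro h
    exact coef_injective (s := s) (funext fun k => (h k).trans (e k))
  · intro h k
    rw [e, ← h]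

/-- The residual of the system for the components, for the resonant waves. -/
abbrev resid (s : ℝ) (q : ℕ) (hs : 0 ≤ s) (hK : ∀ k F, ‖tk D β k F‖ ≤ K * ‖F‖) :
    Par × (Wiener × Wiener × Wiener × Wiener) → Wiener × Wiener × Wiener × Wiener :=
  residual (opT s hK) (opB hs) β (elevE s) (waveE D s q (1, 0)) (waveE D s q (0, 1))

lemma assemble_eq_lead (hs : 0 ≤ s) (hK : ∀ k F, ‖tk D β k F‖ ≤ K * ‖F‖)
    (hr : resid s q hs hK (((μ, C), (A₁ ^ 2, A₂ ^ 2)), z) = 0) :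
    assemble A₁ A₂ z = leadE D s q C A₁ A₂ - opT s hK (μ • assemble A₁ A₂ z +
      (β + μ) • opB hs (assemble A₁ A₂ z) (assemble A₁ A₂ z)) := by
  have := assemble_eq (T := opT s hK) (B := opB hs) (y := ((μ, C), (A₁ ^ 2, A₂ ^ 2))) rfl hr
  rw [leadE]
  exact this

lemma fixed_assemble (hs : 0 ≤ s) (hK : ∀ k F, ‖tk D β k F‖ ≤ K * ‖F‖)
    (hr : resid s q hs hK (((μ, C), (A₁ ^ 2, A₂ ^ 2)), z) = 0) :
    Fixed D β μ (leadCoef D q C A₁ A₂) (coef s (assemble A₁ A₂ z)) := by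
  rw [← coef_leadE D s, fixed_iff hs hK]
  exact assemble_eq_lead hs hK hr

/-- The bound on the components that makes the fixed point problem contractive. -/
structure SmallBranch (K β μ η A₁ A₂ : ℝ) (z : Wiener × Wiener × Wiener × Wiener) : Prop where
  lt_one : K * (|μ| + |β + μ| * (2 * η)) < 1
  norm_le : ∀ r₁ r₂ : ℝ, r₁ ^ 2 = 1 → r₂ ^ 2 = 1 → ‖assemble (r₁ * A₁) (r₂ * A₂) z‖ ≤ η

lemma SmallBranch.norm_self (hη : SmallBranch K β μ η A₁ A₂ z) : ‖assemble A₁ A₂ z‖ ≤ η := by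
  simpa using hη.norm_le 1 1 (by norm_num) (by norm_num)

/-- The components z depend on the squares of the amplitudes, so the same z serves for every choice
of signs. Both sides are small fixed points with the same leading part, and uniqueness identifies
them. -/
lemma act_assemble (hs : 0 ≤ s) (hK : ∀ k F, ‖tk D β k F‖ ≤ K * ‖F‖) (hK0 : 0 ≤ K)
    (hr : resid s q hs hK (((μ, C), (A₁ ^ 2, A₂ ^ 2)), z) = 0)
    (hη : SmallBranch K β μ η A₁ A₂ z) (g : CoefSym D β) {r₁ r₂ : ℝ} (h₁ : r₁ ^ 2 = 1)
    (h₂ : r₂ ^ 2 = 1)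
    (hX : g.act (leadCoef D q C A₁ A₂) = leadCoef D q C (r₁ * A₁) (r₂ * A₂)) :
    g.act (coef s (assemble A₁ A₂ z)) = coef s (assemble (r₁ * A₁) (r₂ * A₂) z) := by
  have hr' : resid s q hs hK (((μ, C), ((r₁ * A₁) ^ 2, (r₂ * A₂) ^ 2)), z) = 0 := by
    rw [mul_pow, mul_pow, h₁, h₂, one_mul, one_mul, hr]
  have hsum := summable_coef hs (assemble A₁ A₂ z)
  refine fixed_unique hK hK0 (g.summable_act hsum) (summable_coef hs _) ?_
    (hX ▸ g.fixed_act hsum (fixed_assemble hs hK hr)) (fixed_assemble hs hK hr')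
  rw [g.tsum_act]
  refine lt_of_le_of_lt ?_ hη.lt_one
  have n1 := (tsum_coef_le hs (assemble A₁ A₂ z)).trans hη.norm_self
  have n2 := (tsum_coef_le hs (assemble (r₁ * A₁) (r₂ * A₂) z)).trans (hη.norm_le _ _ h₁ h₂)
  have n3 : ∑' k, ‖coef s (assemble A₁ A₂ z) k‖ +
    ∑' k, ‖coef s (assemble (r₁ * A₁) (r₂ * A₂) z) k‖ ≤ 2 * η := by linarith
  gcongr

lemma act_assemble_self (hs : 0 ≤ s) (hK : ∀ k F, ‖tk D β k F‖ ≤ K * ‖F‖) (hK0 : 0 ≤ K)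
    (hr : resid s q hs hK (((μ, C), (A₁ ^ 2, A₂ ^ 2)), z) = 0)
    (hη : SmallBranch K β μ η A₁ A₂ z) (g : CoefSym D β)
    (hX : g.act (leadCoef D q C A₁ A₂) = leadCoef D q C A₁ A₂) :
    g.act (coef s (assemble A₁ A₂ z)) = coef s (assemble A₁ A₂ z) := by
  have := act_assemble hs hK hK0 hr hη g (r₁ := 1) (r₂ := 1) (by norm_num) (by norm_num)
    (by simpa using hX)
  simpa using this

/-- The signs are realized by a translation through y_j ∈ {0, π}, which multiplies the coefficient
at n by the corresponding sign. -/
lemma solvE_sign (hD : D.IsPos) (hs : 0 ≤ s) (hK : ∀ k F, ‖tk D β k F‖ ≤ K * ‖F‖) (hK0 : 0 ≤ K)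
    (hr : resid s q hs hK (((μ, C), (A₁ ^ 2, A₂ ^ 2)), z) = 0)
    (hη : SmallBranch K β μ η A₁ A₂ z) {r₁ r₂ : ℝ} (h₁ : r₁ ^ 2 = 1) (h₂ : r₂ ^ 2 = 1)
    {r : ℝ} {n : ℤ × ℤ} (hrn : (n = (1, 0) ∧ r = r₁) ∨ (n = (0, 1) ∧ r = r₂)) :
    solvE D hs q n (assemble (r₁ * A₁) (r₂ * A₂)
        (nonlin (opB hs) β ((μ, C), (A₁ ^ 2, A₂ ^ 2)) z)) =
      r * solvE D hs q n (assemble A₁ A₂ (nonlin (opB hs) β ((μ, C), (A₁ ^ 2, A₂ ^ 2)) z)) := by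
  have hex : ∀ r : ℝ, r ^ 2 = 1 → ∃ y : ℝ, Complex.exp (I * (y : ℝ)) = r := fun r hr => by
    rcases mul_self_eq_one_iff.1 ((sq r).symm.trans hr) with rfl | rfl
    · exact ⟨0, by simp⟩
    · exact ⟨Real.pi, by rw [mul_comm]; simp [Complex.exp_pi_mul_I]⟩
  obtain ⟨y₁, hy₁⟩ := hex r₁ h₁
  obtain ⟨y₂, hy₂⟩ := hex r₂ h₂
  have e₁ : expMode D (1, 0) (cellPoint D y₁ y₂) = r₁ := by
    rw [expMode_cellPoint hD]; simpa using hy₁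
  have e₂ : expMode D (0, 1) (cellPoint D y₁ y₂) = r₂ := by
    rw [expMode_cellPoint hD]; simpa using hy₂
  have key := act_assemble hs hK hK0 hr hη (shiftSym D β (cellPoint D y₁ y₂)) h₁ h₂
    (shiftSym_lead h₁ h₂ e₁ e₂)
  have hrhs := (shiftSym D β (cellPoint D y₁ y₂)).rhs_act (μ := μ)
    (summable_coef hs (assemble A₁ A₂ z))
  rw [key, rhs_coef hs, rhs_coef hs] at hrhs
  have n1 := nonlin_assemble (B := opB hs) (β := β) (y := ((μ, C), (A₁ ^ 2, A₂ ^ 2)))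
    (A₁ := r₁ * A₁) (A₂ := r₂ * A₂) (by rw [mul_pow, mul_pow, h₁, h₂, one_mul, one_mul]) z
  have n2 := nonlin_assemble (B := opB hs) (β := β) (y := ((μ, C), (A₁ ^ 2, A₂ ^ 2)))
    (A₁ := A₁) (A₂ := A₂) rfl z
  dsimp only at n1 n2
  rw [n1, n2] at hrhs
  have hn : expMode D n (cellPoint D y₁ y₂) = r := by
    rcases hrn with ⟨rfl, rfl⟩ | ⟨rfl, rfl⟩
    · exact e₁
    · exact e₂
  rw [solvE_apply, hrhs, shiftSym_act, hn, Complex.coe_smul, map_smul, solvE_apply, smul_eq_mul]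

/-- The condition at P₁ is odd in A₁ and even in A₂. Three changes of sign eliminate the
contributions of E, A₂O₂ and A₁A₂D, and leave the multiple A₁ of that of O₁. The condition at P₂ is
treated in the same way. -/
lemma solvE_assemble (hD : D.IsPos) (hs : 0 ≤ s) (hK : ∀ k F, ‖tk D β k F‖ ≤ K * ‖F‖) (hK0 : 0 ≤ K)
    (hr : resid s q hs hK (((μ, C), (A₁ ^ 2, A₂ ^ 2)), z) = 0)
    (hη : SmallBranch K β μ η A₁ A₂ z) :
    solvE D hs q (1, 0) (μ • assemble A₁ A₂ z +
        (β + μ) • opB hs (assemble A₁ A₂ z) (assemble A₁ A₂ z)) =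
      A₁ * solvE D hs q (1, 0) (nonlin (opB hs) β ((μ, C), (A₁ ^ 2, A₂ ^ 2)) z).2.1 ∧
    solvE D hs q (0, 1) (μ • assemble A₁ A₂ z +
        (β + μ) • opB hs (assemble A₁ A₂ z) (assemble A₁ A₂ z)) =
      A₂ * solvE D hs q (0, 1) (nonlin (opB hs) β ((μ, C), (A₁ ^ 2, A₂ ^ 2)) z).2.2.1 := by
  have n2 := nonlin_assemble (B := opB hs) (β := β) (y := ((μ, C), (A₁ ^ 2, A₂ ^ 2)))
    (A₁ := A₁) (A₂ := A₂) rfl z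
  dsimp only at n2
  have S := fun {r₁ r₂ : ℝ} (h₁ : r₁ ^ 2 = 1) (h₂ : r₂ ^ 2 = 1) {r : ℝ} {n : ℤ × ℤ} hrn =>
    solvE_sign hD hs hK hK0 hr hη (r₁ := r₁) (r₂ := r₂) h₁ h₂ (r := r) (n := n) hrn
  have m1 : (-1 : ℝ) ^ 2 = 1 := by norm_num
  have p1 : (1 : ℝ) ^ 2 = 1 := by norm_num
  have a1 := S m1 p1 (Or.inl ⟨rfl, rfl⟩)
  have a2 := S p1 m1 (Or.inl ⟨rfl, rfl⟩)
  have a3 := S m1 m1 (Or.inl ⟨rfl, rfl⟩)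
  have b1 := S p1 m1 (Or.inr ⟨rfl, rfl⟩)
  have b2 := S m1 p1 (Or.inr ⟨rfl, rfl⟩)
  have b3 := S m1 m1 (Or.inr ⟨rfl, rfl⟩)
  rw [n2]
  generalize nonlin (opB hs) β ((μ, C), (A₁ ^ 2, A₂ ^ 2)) z = N at *
  simp only [assemble, map_add, map_smul, smul_eq_mul] at *
  constructor <;> linarith

end Branch

/-! ### Real-valued functions in terms of coefficients -/

lemma char_neg (D : Params) (k : Freq) (x : ℝ × ℝ) (t : ℝ) :
    char D (-k) x t = (starRingEnd ℂ) (char D k x t) := by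
  have h1 : char D (-k) x t * char D k x t = 1 := by
    rw [← char_add, neg_add_cancel, char_zero]
  have h2 : (starRingEnd ℂ) (char D k x t) * char D k x t = 1 := by
    rw [mul_comm, Complex.mul_conj, Complex.normSq_eq_norm_sq, norm_char]
    simp
  have h3 : char D k x t ≠ 0 := fun h => by rw [h, mul_zero] at h1; exact zero_ne_one h1
  exact mul_right_cancel₀ h3 (h1.trans h2.symm)

lemma conjL_smul (a : ℂ) (x : Coef) : conjL (a • x) = (starRingEnd ℂ) a • conjL x := by
  simp [conjL_apply]

lemma norm_conjL (x : Coef) : ‖conjL x‖ = ‖x‖ := by simp [conjL_apply, Prod.norm_def]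

namespace HasSeries

variable {D : Params} {U : Field} {c c' : Freq → Coef}

lemma conj (h : HasSeries D U c) :
    HasSeries D (fun x t => conjL (U x t)) (fun k => conjL (c (-k))) := by
  refine ⟨?_, fun x t => ?_⟩
  · simp only [norm_conjL]
    exact ((Equiv.neg Freq).summable_iff (f := fun k => ‖c k‖)).2 h.1
  · rw [← (Equiv.neg Freq).hasSum_iff]
    convert! (h.2 x t).mapL conjL using 2 with k
    simp only [Function.comp_apply, Equiv.neg_apply, neg_neg, conjL_smul, char_neg]

lemma unique_coef (hD : D.IsPos) (h : HasSeries D U c) (h' : HasSeries D U c') : c = c' := by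
  funext ⟨n, m⟩
  ext
  · rw [← h.eta.fourier_eq hD, ← h'.eta.fourier_eq hD]
  · rw [← h.vel₁.fourier_eq hD, ← h'.vel₁.fourier_eq hD]
  · rw [← h.vel₂.fourier_eq hD, ← h'.vel₂.fourier_eq hD]

lemma isRealField_iff (hD : D.IsPos) (h : HasSeries D U c) :
    IsRealField U ↔ ∀ k, conjL (c (-k)) = c k := by
  have e : IsRealField U ↔ (fun x t => conjL (U x t)) = U := by
    simp only [funext_iff, IsRealField, Boussinesq.eta, Boussinesq.vel₁, Boussinesq.vel₂,
      conjL_apply, Prod.ext_iff, Complex.conj_eq_iff_im]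
  rw [e]
  constructor
  · intro he k
    have := h.conj
    rw [he] at this
    exact congrFun (this.unique_coef hD h) k
  · intro hc
    have := h.conj
    simp only [hc] at this
    exact this.unique_fun h

end HasSeries

/-! ### From the bifurcation equations to a solution of the system -/

section Solution

variable {D : Params} {β s K η μ C A₁ A₂ : ℝ} {q : ℕ} {z : Wiener × Wiener × Wiener × Wiener}

/-- The solvability condition at `k`. -/
def Solvable (D : Params) (β : ℝ) (k : Freq) (F : Coef) : Prop := mE D k * F.1 = β * pdot D k F

lemma Solvable.time {k : Freq} {F : Coef} (h : Solvable D β k F) :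
    Solvable D β (timeNeg k) (refl F) := by
  simp only [Solvable, mE, pdot, timeNeg_apply, refl] at *
  push_cast at *
  linear_combination -h

lemma Solvable.space {k : Freq} {F : Coef} (h : Solvable D β k F) :
    Solvable D β (spaceNeg k) (refl F) := by
  simp only [Solvable, mE, pdot, spaceNeg_apply, refl, psq_neg, p₁_neg, p₂_neg] at *
  push_cast at *
  linear_combination h

/-- F has real components, so nothing is lost in the real part taken by `solv`; the dispersion
relation replaces m(1 + ω|p|²) by β|p|, and β factors out. -/
lemma solvable_of_solv {n : ℤ × ℤ} (hn : (q : ℝ) * (1 + D.ω * psq D n) = β * √(psq D n)) {F : Coef}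
    (hF : conjL F = F) (h : solv D n F = 0) : Solvable D β (n, (q : ℤ)) F := by
  rw [solv_apply] at h
  simp only [conjL_apply, Prod.ext_iff, Complex.conj_eq_iff_im] at hF
  obtain ⟨i1, i2, i3⟩ := hF
  have e1 := Complex.conj_eq_iff_re.1 (Complex.conj_eq_iff_im.2 i1)
  have e2 := Complex.conj_eq_iff_re.1 (Complex.conj_eq_iff_im.2 i2)
  have e3 := Complex.conj_eq_iff_re.1 (Complex.conj_eq_iff_im.2 i3)
  rw [Solvable, pdot, ← e1, ← e2, ← e3, mE]
  push_cast
  have hn' : (q : ℂ) * (1 + D.ω * psq D n) = β * (√(psq D n) : ℝ) := by exact_mod_cast hn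
  have h' : ((√(psq D n) : ℝ) : ℂ) * F.1.re - (p₁ D n * F.2.1.re + p₂ D n * F.2.2.re) = 0 := by
    exact_mod_cast h
  linear_combination (F.1.re : ℂ) * hn' + (β : ℂ) * h'

/-- Time reversal and point reflection carry the condition at (n, q) to the other three frequencies
of the wave. -/
lemma solvable_of_mem {n : ℤ × ℤ} {k : Freq} (hk : k ∈ waveSupp q n) {F : Freq → Coef}
    (ht : TimeSym F) (hsp : ∀ k, refl (F (spaceNeg k)) = F k)
    (h : Solvable D β (n, (q : ℤ)) (F (n, q))) : Solvable D β k (F k) := by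
  have h1 : Solvable D β (-n, (q : ℤ)) (F (-n, q)) := by
    have := h.space
    rwa [← hsp, refl_refl] at this
  have aux : ∀ x : ℤ × ℤ, Solvable D β (x, (q : ℤ)) (F (x, q)) →
      Solvable D β (x, -(q : ℤ)) (F (x, -(q : ℤ))) := fun x hx => by
    have := hx.time
    rwa [← ht] at this
  simp only [waveSupp, Finset.mem_insert, Finset.mem_singleton] at hk
  rcases hk with rfl | rfl | rfl | rfl
  · exact h
  · exact h1
  · exact aux _ h
  · exact aux _ h1

lemma timeSym_assemble (hs : 0 ≤ s) (hK : ∀ k F, ‖tk D β k F‖ ≤ K * ‖F‖) (hK0 : 0 ≤ K)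
    (hr : resid s q hs hK (((μ, C), (A₁ ^ 2, A₂ ^ 2)), z) = 0)
    (hη : SmallBranch K β μ η A₁ A₂ z) : TimeSym (coef s (assemble A₁ A₂ z)) :=
  (timeSym_act_iff (D := D) (β := β)).1
    (act_assemble_self hs hK hK0 hr hη _ (timeSym_lead D β q C A₁ A₂))

/-- The two reflections together give c(-k) = c(k), their sign changes of the velocity cancelling,
while conjugation symmetry makes the coefficients real. -/
lemma conjL_assemble (hs : 0 ≤ s) (hK : ∀ k F, ‖tk D β k F‖ ≤ K * ‖F‖) (hK0 : 0 ≤ K)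
    (hr : resid s q hs hK (((μ, C), (A₁ ^ 2, A₂ ^ 2)), z) = 0)
    (hη : SmallBranch K β μ η A₁ A₂ z) (k : Freq) :
    conjL (coef s (assemble A₁ A₂ z) (-k)) = coef s (assemble A₁ A₂ z) k := by
  have ht := timeSym_assemble hs hK hK0 hr hη
  have hc := congrFun (act_assemble_self hs hK hK0 hr hη _ (conjSym_lead D β q C A₁ A₂)) (-k)
  have hsp := congrFun (act_assemble_self hs hK hK0 hr hη _ (spaceSym_lead D β q C A₁ A₂)) k
  change conjL (coef s (assemble A₁ A₂ z) (-k)) = _ at hc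
  change refl (coef s (assemble A₁ A₂ z) (-k.1, k.2)) = _ at hsp
  rw [hc, ← hsp, ← ht]
  rfl

/-- The right-hand side inherits the symmetries of the fixed point. Time symmetry settles the
frequencies with m = 0, and the resonant frequencies reduce to one real condition for each wave. -/
lemma seqSol_assemble (h : Resonant D β q) (hs : 0 ≤ s) (hK : ∀ k F, ‖tk D β k F‖ ≤ K * ‖F‖)
    (hK0 : 0 ≤ K) (hr : resid s q hs hK (((μ, C), (A₁ ^ 2, A₂ ^ 2)), z) = 0)
    (hη : SmallBranch K β μ η A₁ A₂ z)
    (hb₁ : A₁ * solvE D hs q (1, 0) (nonlin (opB hs) β ((μ, C), (A₁ ^ 2, A₂ ^ 2)) z).2.1 = 0)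
    (hb₂ : A₂ * solvE D hs q (0, 1) (nonlin (opB hs) β ((μ, C), (A₁ ^ 2, A₂ ^ 2)) z).2.2.1 = 0) :
    SeqSol D (β + μ) (coef s (assemble A₁ A₂ z)) := by
  have hsum := summable_coef hs (assemble A₁ A₂ z)
  have hsym : ∀ g : CoefSym D β, g.act (leadCoef D q C A₁ A₂) = leadCoef D q C A₁ A₂ →
      g.act (rhs β μ (coef s (assemble A₁ A₂ z))) = rhs β μ (coef s (assemble A₁ A₂ z)) :=
    fun g hg => by rw [← g.rhs_act hsum, act_assemble_self hs hK hK0 hr hη g hg]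
  have ht := timeSym_act_iff.1 (hsym _ (timeSym_lead D β q C A₁ A₂))
  have hsp := congrFun (hsym _ (spaceSym_lead D β q C A₁ A₂))
  have hc := congrFun (hsym _ (conjSym_lead D β q C A₁ A₂))
  obtain ⟨s1, s2⟩ := solvE_assemble h.pos hs hK hK0 hr hη
  rw [hb₁, solvE_apply, ← rhs_coef hs] at s1
  rw [hb₂, solvE_apply, ← rhs_coef hs] at s2
  refine seqSol_of_fixed h.β_pos.ne' (inKer_lead h C A₁ A₂) (fixed_assemble hs hK hr) ?_ ?_
  · rintro ⟨n, m⟩ hm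
    dsimp only at hm
    subst hm
    exact ht.vel_zero n
  · intro k hk hd
    rcases (h.fdisc_eq_zero_iff hk).1 hd with hk | hk
    · exact solvable_of_mem hk ht hsp (solvable_of_solv h.dispersion_one_zero (hc _) s1)
    · exact solvable_of_mem hk ht hsp (solvable_of_solv h.dispersion_zero_one (hc _) s2)

end Solution

/-! ### The leading part and the partial inverse, on functions -/

section Leading

variable {D : Params} {β K : ℝ} {q : ℕ}

/-- The standing wave with spatial indices `±n`. -/
def waveField (D : Params) (q : ℕ) (n : ℤ × ℤ) : Field := fun x t =>
  (((2 * √(psq D n) * Real.cos (p₁ D n * x.1 + p₂ D n * x.2) * Real.cos (q * t) : ℝ) : ℂ),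
    ((2 * p₁ D n * Real.sin (p₁ D n * x.1 + p₂ D n * x.2) * Real.sin (q * t) : ℝ) : ℂ),
    ((2 * p₂ D n * Real.sin (p₁ D n * x.1 + p₂ D n * x.2) * Real.sin (q * t) : ℝ) : ℂ))

lemma hasSeries_of_finite {U : Field} {u : Freq → Coef} {S : Finset Freq} (hu : ∀ k ∉ S, u k = 0)
    (h : ∀ x t, ∑ k ∈ S, char D k x t • u k = U x t) : HasSeries D U u := by
  refine ⟨summable_of_ne_finset_zero (s := S) fun k hk => by rw [hu k hk, norm_zero], fun x t => ?_⟩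
  rw [← h]
  exact hasSum_sum_of_ne_finset_zero fun k hk => by rw [hu k hk, smul_zero]

lemma hasSeries_unitElev : HasSeries D (fun _ _ => (1, 0, 0)) unitElev :=
  hasSeries_of_finite (fun _ => unitElev_eq_zero) fun x t => by simp [unitElev, char_zero]

lemma hasSeries_wave (hq : 0 < q) {n : ℤ × ℤ} (hn : n ≠ -n) :
    HasSeries D (waveField D q n) (wave D q n) := by
  refine hasSeries_of_finite (fun _ => wave_eq_zero) fun x t => ?_
  have h1 := wave_mul (D := D) hq n n 1
  have h2 := wave_mul (D := D) hq n (-n) 1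
  have h3 := wave_mul (D := D) hq n n (-1)
  have h4 := wave_mul (D := D) hq n (-n) (-1)
  simp only [true_or, or_true, and_self, if_true, one_mul, neg_mul] at h1 h2 h3 h4
  have hq' : (q : ℤ) ≠ -q := by omega
  rw [waveSupp, Finset.sum_insert, Finset.sum_insert,
    Finset.sum_insert, Finset.sum_singleton, h1, h2, h3, h4]
  · have e1 : expMode D n x = Complex.exp (((p₁ D n * x.1 + p₂ D n * x.2 : ℝ) : ℂ) * I) := by
      rw [expMode, mul_comm]
    have e2 : expMode D (-n) x = Complex.exp (-((p₁ D n * x.1 + p₂ D n * x.2 : ℝ) : ℂ) * I) := by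
      rw [expMode_neg, e1, ← Complex.exp_neg, neg_mul]
    have f1 : Complex.exp (I * (((q : ℤ) * t : ℝ) : ℂ)) = Complex.exp (((q * t : ℝ) : ℂ) * I) := by
      rw [mul_comm, Int.cast_natCast]
    have f2 : Complex.exp (I * (((-(q : ℤ) : ℤ) * t : ℝ) : ℂ)) =
        Complex.exp (-((q * t : ℝ) : ℂ) * I) := by
      rw [mul_comm]; push_cast; ring_nf
    simp only [char, e1, e2, f1, f2, waveField, waveCoef, rv, psq_neg, p₁_neg, p₂_neg]
    generalize p₁ D n * x.1 + p₂ D n * x.2 = θ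
    generalize (q * t : ℝ) = φ
    simp only [Complex.ofReal_mul, Complex.ofReal_cos, Complex.ofReal_sin]
    simp only [Complex.cos, Complex.sin]
    generalize Complex.exp (θ * I) = a
    generalize Complex.exp (-θ * I) = b
    generalize Complex.exp (φ * I) = c
    generalize Complex.exp (-φ * I) = d
    refine Prod.ext ?_ (Prod.ext ?_ ?_) <;>
    · simp only [Prod.smul_mk, Prod.mk_add_mk, smul_eq_mul]
      push_cast
      ring_nf
      try simp only [I_sq]
      try ring_nf
  · simp [hn]
  · simp [hq']
  · simp [hn, hq']

lemma hasSeries_leading (hD : D.IsPos) (hq : 0 < q) (C A₁ A₂ : ℝ) :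
    HasSeries D (leading D q C A₁ A₂) (leadCoef D q C A₁ A₂) := by
  have h := ((hasSeries_unitElev.const_smul (C : ℂ)).add
    ((hasSeries_wave (D := D) hq (n := (1, 0)) (by decide)).const_smul (A₁ : ℂ))).add
    ((hasSeries_wave (D := D) hq (n := (0, 1)) (by decide)).const_smul (A₂ : ℂ))
  have e : leading D q C A₁ A₂ = (C : ℂ) • (fun _ _ => (1, 0, 0)) +
      (A₁ : ℂ) • waveField D q (1, 0) + (A₂ : ℂ) • waveField D q (0, 1) := by
    funext x t
    simp only [leading, waveField, Pi.add_apply, Pi.smul_apply, sqrt_psq_one_zero hD,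
      sqrt_psq_zero_one hD, p₁_one_zero, p₂_one_zero, p₁_zero_one, p₂_zero_one, neg_mul,
      ← sub_eq_add_neg, Prod.smul_mk, Prod.mk_add_mk, smul_eq_mul, Prod.mk.injEq]
    push_cast
    refine ⟨by ring, by ring, by ring⟩
  rw [e]
  exact h

/-- Passing from modes to characters scales elevations by 1 or 2 and velocities by 2i; this absorbs
the factors i in the formulas for 𝒯. -/
lemma invCoeff_eq (hD : D.IsPos) {U : Field} {c : Freq → Coef} (hU : HasSeries D U c)
    (hc : TimeSym c) (k : Mode) :
    invCoeff D β U k =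
      ((if k.2 = 0 then 1 else 2) * (tk D β (k.1, k.2) (c (k.1, k.2))).1,
        2 * I * (tk D β (k.1, k.2) (c (k.1, k.2))).2.1,
        2 * I * (tk D β (k.1, k.2) (c (k.1, k.2))).2.2) := by
  have hd : disc D β k = fdisc D β (k.1, (k.2 : ℤ)) := by
    rw [fdisc_eq_disc]; rfl
  simp only [invCoeff, hU.cosCoeff_eta hD hc, hU.sinCoeff_vel₁ hD hc, hU.sinCoeff_vel₂ hD hc, hd]
  by_cases h : k.2 ≠ 0 ∧ fdisc D β (k.1, (k.2 : ℤ)) ≠ 0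
  · rw [if_pos h, tk_of_ne (by simpa using h.1) h.2]
    simp only [mE, pdot, if_neg h.1, Prod.mk.injEq]
    push_cast
    refine ⟨?_, ?_, ?_⟩ <;>
    · field_simp
      ring_nf
      try simp only [I_sq]
      try ring_nf
  · rw [if_neg h]
    by_cases h0 : k = ((0, 0), 0)
    · rw [if_pos h0, h0]
      have : (((0, 0), ((0 : ℕ) : ℤ)) : Freq) = 0 := rfl
      simp only [this, tk_zero]
      simp
    · rw [if_neg h0]
      have h0' : (k.1, (k.2 : ℤ)) ≠ (0 : Freq) := by
        contrapose h0
        obtain ⟨n, m⟩ := k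
        simp only [Prod.ext_iff, Prod.fst_zero, Prod.snd_zero] at h0 ⊢
        exact ⟨h0.1, by exact_mod_cast h0.2⟩
      rw [tk_of_eq (by simp only [Nat.cast_eq_zero]; tauto) h0']
      simp only [mul_zero, Prod.mk.injEq, and_true]
      split_ifs <;> ring

lemma hasSeries_linInv (hD : D.IsPos) (hK : ∀ k F, ‖tk D β k F‖ ≤ K * ‖F‖) {U : Field}
    {c : Freq → Coef} (hU : HasSeries D U c) (hc : TimeSym c) :
    HasSeries D (linInv D β U) (fun k => tk D β k (c k)) := by
  have hs : Summable fun k => ‖tk D β k (c k)‖ :=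
    Summable.of_nonneg_of_le (fun _ => norm_nonneg _) (fun k => hK k _) (hU.1.mul_left K)
  have hV := hasSeries_tsum (D := D) hs
  have ht : TimeSym fun k => tk D β k (c k) := hc.tk
  convert! hV using 1
  funext x t
  simp only [linInv, invCoeff_eq hD hU hc]
  refine Prod.ext ?_ (Prod.ext ?_ ?_)
  · exact (hasSum_cos_of_even hV.eta (fun n m => (congrArg (fun w : Coef => w.1) (ht n m) :)) x t).tsum_eq
  · exact (hasSum_sin_of_odd hV.vel₁ (fun n m => congrArg (fun w : Coef => w.2.1) (ht n m)) x t).tsum_eq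
  · exact (hasSum_sin_of_odd hV.vel₂ (fun n m => congrArg (fun w : Coef => w.2.2) (ht n m)) x t).tsum_eq

end Leading

/-! ### Size of the remainder and of the branch -/

section Remainder

variable {𝓔 : Type*} [NormedAddCommGroup 𝓔] [NormedSpace ℝ 𝓔]

/-- Second order expansion of a small solution of the fixed point problem. -/
lemma norm_remainder_le {T : 𝓔 →L[ℝ] 𝓔} {B : 𝓔 →L[ℝ] 𝓔 →L[ℝ] 𝓔} {β μ K N : ℝ} (hβ : 0 ≤ β)
    (hK0 : 0 ≤ K) (hT : ∀ x, ‖T x‖ ≤ K * ‖x‖) (hB : ∀ x y, ‖B x y‖ ≤ ‖x‖ * ‖y‖) {X x : 𝓔}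
    (hx : x = X - T (μ • x + (β + μ) • B x x)) (hX : ‖X‖ ≤ N) (hμ : |μ| ≤ 1)
    (hsmall : K * (|μ| + |β + μ| * ‖x‖) ≤ 1 / 2) :
    ‖x - X + μ • T X + β • T (B X X)‖ ≤
      K * (|μ| * (K * (2 * |μ| * N + 4 * (β + 1) * N ^ 2)) + 4 * |μ| * N ^ 2 +
        β * (K * (2 * |μ| * N + 4 * (β + 1) * N ^ 2) * (3 * N))) := by
  have hN : 0 ≤ N := (norm_nonneg X).trans hX
  have hμ0 := abs_nonneg μ
  have hβμ : |β + μ| ≤ β + 1 := (abs_add_le _ _).trans (by rw [abs_of_nonneg hβ]; linarith)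
  have hd : x - X = -T (μ • x + (β + μ) • B x x) := by
    nth_rewrite 1 [hx]
    abel
  have h1 : ‖μ • x + (β + μ) • B x x‖ ≤ |μ| * ‖x‖ + |β + μ| * (‖x‖ * ‖x‖) := by
    refine (norm_add_le _ _).trans ?_
    rw [norm_smul, norm_smul, Real.norm_eq_abs, Real.norm_eq_abs]
    gcongr
    exact hB x x
  have h2 : ‖x - X‖ ≤ K * (|μ| * ‖x‖ + |β + μ| * (‖x‖ * ‖x‖)) := by
    rw [hd, norm_neg]
    exact (hT _).trans (by gcongr)
  have hx2 : ‖x‖ ≤ 2 * N := by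
    have h3 : ‖x‖ ≤ ‖X‖ + ‖x - X‖ := by
      have := norm_add_le X (x - X)
      rwa [add_sub_cancel] at this
    have h4 : K * (|μ| * ‖x‖ + |β + μ| * (‖x‖ * ‖x‖)) ≤ 1 / 2 * ‖x‖ := by
      calc _ = K * (|μ| + |β + μ| * ‖x‖) * ‖x‖ := by ring
        _ ≤ _ := by gcongr
    linarith
  have hd2 : ‖x - X‖ ≤ K * (2 * |μ| * N + 4 * (β + 1) * N ^ 2) := by
    refine h2.trans ?_
    have e : |μ| * ‖x‖ + |β + μ| * (‖x‖ * ‖x‖) ≤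
        |μ| * (2 * N) + (β + 1) * ((2 * N) * (2 * N)) := by gcongr
    calc _ ≤ K * (|μ| * (2 * N) + (β + 1) * ((2 * N) * (2 * N))) := by gcongr
      _ = _ := by ring
  have e : x - X + μ • T X + β • T (B X X) =
      -T (μ • (x - X) + μ • B x x + β • (B x (x - X) + B (x - X) X)) := by
    have e' : ∀ d, d = -T (μ • x + (β + μ) • B x x) → d + μ • T X + β • T (B X X) =
        -T (μ • (x - X) + μ • B x x + β • (B x (x - X) + B (x - X) X)) := by
      rintro _ rfl
      simp only [map_add, map_smul, map_sub, sub_apply]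
      module
    exact e' _ hd
  rw [e, norm_neg]
  refine (hT _).trans ?_
  gcongr
  refine (norm_add_le _ _).trans (add_le_add ((norm_add_le _ _).trans (add_le_add ?_ ?_)) ?_)
  · rw [norm_smul, Real.norm_eq_abs]
    gcongr
  · rw [norm_smul, Real.norm_eq_abs]
    calc |μ| * ‖B x x‖ ≤ |μ| * ((2 * N) * (2 * N)) := by
          gcongr
          exact (hB x x).trans (by gcongr)
      _ = _ := by ring
  · rw [norm_smul, Real.norm_eq_abs, abs_of_nonneg hβ]
    gcongr
    calc ‖B x (x - X) + B (x - X) X‖ ≤ ‖x‖ * ‖x - X‖ + ‖x - X‖ * ‖X‖ :=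
          (norm_add_le _ _).trans (add_le_add (hB _ _) (hB _ _))
      _ = ‖x - X‖ * (‖x‖ + ‖X‖) := by ring
      _ ≤ K * (2 * |μ| * N + 4 * (β + 1) * N ^ 2) * (3 * N) := by
          have : ‖x‖ + ‖X‖ ≤ 3 * N := by linarith
          gcongr

open Filter Topology in
lemma exists_radius {z : Par → 𝓔 × 𝓔 × 𝓔 × 𝓔} (hz : ContinuousAt z 0) (hz0 : (z 0).1 = 0)
    {P : Par → Prop} (hP : ∀ᶠ y in 𝓝 0, P y) {η : ℝ} (hη : 0 < η) :
    ∃ r > 0, ∀ y : Par, ‖y‖ < r → P y ∧ ∀ A₁ A₂ : ℝ, y.2 = (A₁ ^ 2, A₂ ^ 2) →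
      ‖assemble A₁ A₂ (z y)‖ < η := by
  have hc : ContinuousAt (fun w : Par × (ℝ × ℝ) => ‖assemble w.2.1 w.2.2 (z w.1)‖) (0, 0) := by
    have hz' : ContinuousAt (fun w : Par × (ℝ × ℝ) => z w.1) (0, 0) :=
      ContinuousAt.comp (g := z) (f := Prod.fst) hz continuousAt_fst
    unfold assemble
    fun_prop
  have h0 : ‖assemble 0 0 (z 0)‖ < η := by simpa [assemble, hz0] using hη
  obtain ⟨r₁, hr₁, hb₁⟩ := Metric.eventually_nhds_iff_ball.1 (hc.eventually (gt_mem_nhds h0))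
  obtain ⟨r₂, hr₂, hb₂⟩ := Metric.eventually_nhds_iff_ball.1 hP
  -- Only the squares A_j² are controlled by the parameter; the entry r₁² makes |A_j| < r₁.
  refine ⟨min r₂ (min r₁ (r₁ ^ 2)), by positivity, fun y hy => ?_⟩
  simp only [lt_min_iff] at hy
  refine ⟨hb₂ y (by simpa using hy.1), fun A₁ A₂ hA => ?_⟩
  have hA₁ : |A₁| < r₁ := by
    refine abs_lt_of_sq_lt_sq ?_ hr₁.le
    have := (norm_fst_le y.2).trans (norm_snd_le y)
    rw [hA, Real.norm_eq_abs, abs_of_nonneg (sq_nonneg _)] at this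
    exact this.trans_lt hy.2.2
  have hA₂ : |A₂| < r₁ := by
    refine abs_lt_of_sq_lt_sq ?_ hr₁.le
    have := (norm_snd_le y.2).trans (norm_snd_le y)
    rw [hA, Real.norm_eq_abs, abs_of_nonneg (sq_nonneg _)] at this
    exact this.trans_lt hy.2.2
  refine hb₁ (y, (A₁, A₂)) ?_
  rw [← Prod.zero_eq_mk, mem_ball_zero_iff]
  exact max_lt hy.2.1 (max_lt hA₁ hA₂)

end Remainder

/-! ### From an arbitrary solution back to the fixed point problem -/

section Reduction

variable {D : Params} {β μ C : ℝ} {q : ℕ} {c : Freq → Coef}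

lemma seqSol_shift {σ : ℝ × ℝ} {β' : ℝ} (hc : Summable fun k => ‖c k‖) (h : SeqSol D β c) :
    SeqSol D β ((shiftSym D β' σ).act c) := by
  intro k
  obtain ⟨h1, h2, h3⟩ := h k
  have hp : ∀ x : Coef, pdot D k (expMode D k.1 σ • x) = expMode D k.1 σ * pdot D k x := fun x => by
    simp only [pdot, Prod.smul_fst, Prod.smul_snd, smul_eq_mul]
    ring
  rw [CoefSym.cconv_act _ hc hc]
  simp only [shiftSym_act, hp, Prod.smul_fst, Prod.smul_snd, smul_eq_mul]
  refine ⟨?_, ?_, ?_⟩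
  · linear_combination expMode D k.1 σ * h1
  · linear_combination expMode D k.1 σ * h2
  · linear_combination expMode D k.1 σ * h3

lemma TimeSym.shift {σ : ℝ × ℝ} (h : TimeSym c) : TimeSym ((shiftSym D β σ).act c) := by
  intro n m
  simp only [shiftSym_act, h n m]
  simp [refl]

lemma conjL_shift {σ : ℝ × ℝ} (h : ∀ k, conjL (c (-k)) = c k) (k : Freq) :
    conjL ((shiftSym D β σ).act c (-k)) = (shiftSym D β σ).act c k := by
  have e : (starRingEnd ℂ) (expMode D (-k.1) σ) = expMode D k.1 σ := by
    have := char_neg D (-k) σ 0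
    simpa [char] using this.symm
  rw [shiftSym_act, shiftSym_act, conjL_smul, h, Prod.fst_neg, e]

/-- The equations at a resonant frequency. -/
lemma eq_of_resonant {k : Freq} {σ a B : ℝ} (hσ : σ ^ 2 = 1) (hβ : β ≠ 0) (ha : a ≠ 0)
    (hm : mE D k = σ * (β * a)) (hp : p₁ D k.1 ≠ 0) {x F : Coef}
    (h2 : mE D k * x.2.1 + β * p₁ D k.1 * x.1 + p₁ D k.1 * F.1 = 0)
    (h3 : mE D k * x.2.2 + β * p₂ D k.1 * x.1 + p₂ D k.1 * F.1 = 0)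
    (hv : x.2.1 = ((-(σ * B * p₁ D k.1) / 2 : ℝ) : ℂ)) :
    x = B • rv (a / 2) (-(σ * p₁ D k.1) / 2) (-(σ * p₂ D k.1) / 2) - (F.1 / β, 0, 0) := by
  have hβ' : (β : ℂ) ≠ 0 := by exact_mod_cast hβ
  have ha' : (a : ℂ) ≠ 0 := by exact_mod_cast ha
  have hp' : (p₁ D k.1 : ℂ) ≠ 0 := by exact_mod_cast hp
  have hσ' : (σ : ℂ) ^ 2 = 1 := by exact_mod_cast hσ
  have hσ0 : (σ : ℂ) ≠ 0 := fun h => by rw [h] at hσ'; norm_num at hσ'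
  rw [hv, hm] at h2
  rw [hm] at h3
  push_cast at h2 h3
  -- The prescribed first velocity determines the elevation through the second equation, as p₁ ≠ 0;
  -- the third equation then determines the other velocity.
  have e1 : (β : ℂ) * x.1 + F.1 = β * a * B / 2 := by
    refine mul_left_cancel₀ hp' ?_
    linear_combination h2 + (β * a * B * p₁ D k.1 / 2 : ℂ) * hσ'
  refine Prod.ext ?_ (Prod.ext ?_ ?_)
  · simp only [rv, Prod.fst_sub, Prod.smul_fst, Complex.real_smul]
    push_cast
    field_simp
    linear_combination 2 * e1
  · simp only [rv, Prod.fst_sub, Prod.snd_sub, Prod.smul_fst, Prod.smul_snd, Complex.real_smul, hv]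
    push_cast
    ring
  · simp only [rv, Prod.snd_sub, Prod.smul_snd, Complex.real_smul]
    push_cast
    refine mul_left_cancel₀ (mul_ne_zero hσ0 (mul_ne_zero hβ' ha')) ?_
    linear_combination h3 - (p₂ D k.1 : ℂ) * e1 + (β * a * B * p₂ D k.1 / 2 : ℂ) * hσ'

end Reduction

section Reduction

variable {D : Params} {β μ C B₁ B₂ B : ℝ} {q : ℕ} {c : Freq → Coef}

lemma SeqSol.linear_form (h : SeqSol D (β + μ) c) (k : Freq) :
    mE D k * (c k).1 + β * pdot D k (c k) + pdot D k (rhs β μ c k) = 0 ∧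
    mE D k * (c k).2.1 + β * p₁ D k.1 * (c k).1 + p₁ D k.1 * (rhs β μ c k).1 = 0 ∧
    mE D k * (c k).2.2 + β * p₂ D k.1 * (c k).1 + p₂ D k.1 * (rhs β μ c k).1 = 0 := by
  obtain ⟨h1, h2, h3⟩ := h k
  rw [pdot_rhs, rhs_fst]
  push_cast at h1 h2 h3
  refine ⟨?_, ?_, ?_⟩
  · linear_combination h1
  · linear_combination h2
  · linear_combination h3

lemma mE_of_mem_waveSupp {n : ℤ × ℤ} (hq : 0 < q)
    (hn : (q : ℝ) * (1 + D.ω * psq D n) = β * √(psq D n)) {k : Freq} (hk : k ∈ waveSupp q n) :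
    psq D k.1 = psq D n ∧ ((k.2.sign : ℤ) : ℝ) ^ 2 = 1 ∧
      mE D k = (k.2.sign : ℤ) * (β * √(psq D n)) := by
  have hq' : (q : ℤ).sign = 1 := Int.sign_eq_one_of_pos (by exact_mod_cast hq)
  simp only [waveSupp, Finset.mem_insert, Finset.mem_singleton] at hk
  rcases hk with rfl | rfl | rfl | rfl <;>
    simp only [mE, psq_neg, Int.sign_neg, hq', ← hn] <;> push_cast <;>
    exact ⟨trivial, by norm_num, by ring⟩

/-- At a resonance 𝒯 changes only the elevation, so the velocity of c must be that of a multiple of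
the wave. Its amplitude is read off from the first velocity at (n, q), and time symmetry and reality
transfer the value to the other three frequencies. -/
lemma eq_wave_sub_tk (hβ : β ≠ 0) (hq : 0 < q) {n : ℤ × ℤ}
    (hn : (q : ℝ) * (1 + D.ω * psq D n) = β * √(psq D n)) (hp : p₁ D n ≠ 0) (ht : TimeSym c)
    (hc : ∀ k, conjL (c (-k)) = c k) (hsol : SeqSol D (β + μ) c)
    (hv : (c (n, q)).2.1 = ((-(B * p₁ D n) / 2 : ℝ) : ℂ)) {k : Freq} (hk : k ∈ waveSupp q n) :
    c k = B • wave D q n k - tk D β k (rhs β μ c k) := by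
  have hpos : 0 < psq D n := by unfold psq; positivity
  obtain ⟨e1, e2, e3⟩ := mE_of_mem_waveSupp hq hn hk
  have hq0 : (q : ℤ) ≠ 0 := by exact_mod_cast hq.ne'
  have hq' : (q : ℤ).sign = 1 := Int.sign_eq_one_of_pos (by exact_mod_cast hq)
  have hs : k.1 = n ∨ k.1 = -n := by
    simp only [waveSupp, Finset.mem_insert, Finset.mem_singleton] at hk
    rcases hk with rfl | rfl | rfl | rfl <;> simp
  have hs2 : k.2 = q ∨ k.2 = -q := by
    simp only [waveSupp, Finset.mem_insert, Finset.mem_singleton] at hk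
    rcases hk with rfl | rfl | rfl | rfl <;> simp
  have hk0 : k ≠ 0 := by
    rintro rfl
    rcases hs2 with h | h <;> simp at h <;> omega
  have hfd : fdisc D β k = 0 := by
    rw [fdisc, e3, e1, mul_pow, mul_pow, Real.sq_sqrt hpos.le, e2]
    ring
  have hpk : p₁ D k.1 ≠ 0 := by
    rcases hs with h | h <;> rw [h] <;> simpa [p₁_neg] using hp
  have hw : wave D q n k = waveCoef D k.1 k.2.sign := if_pos ⟨hs, hs2⟩
  have e4 : (c (-n, -(q : ℤ))).2.1 = ((-(B * p₁ D n) / 2 : ℝ) : ℂ) := by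
    rw [← hc, conjL_apply]
    simp only [Prod.neg_mk, neg_neg]
    rw [hv, Complex.conj_ofReal]
  have hvk : (c k).2.1 = ((-(((k.2.sign : ℤ) : ℝ) * B * p₁ D k.1) / 2 : ℝ) : ℂ) := by
    simp only [waveSupp, Finset.mem_insert, Finset.mem_singleton] at hk
    rcases hk with rfl | rfl | rfl | rfl
    · rw [hv, hq']; push_cast; ring
    · have := ht (-n) (q : ℤ)
      rw [this] at e4
      simp only [refl] at e4
      rw [neg_eq_iff_eq_neg] at e4
      rw [e4, hq', p₁_neg]; push_cast; ring
    · rw [ht n q]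
      simp only [refl, hv, Int.sign_neg, hq']; push_cast; ring
    · rw [e4, Int.sign_neg, hq', p₁_neg]; push_cast; ring
  obtain ⟨-, h2, h3⟩ := hsol.linear_form k
  rw [hw, tk_of_eq (Or.inr hfd) hk0, waveCoef, e1]
  exact eq_of_resonant e2 hβ (Real.sqrt_ne_zero'.2 hpos) e3 hpk h2 h3 hvk

lemma notMem_waveSupp_of_mem {k : Freq} (hk : k ∈ waveSupp q (1, 0)) : k ∉ waveSupp q (0, 1) := by
  simp only [waveSupp, Finset.mem_insert, Finset.mem_singleton] at hk ⊢
  rcases hk with rfl | rfl | rfl | rfl <;> simp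

lemma ne_zero_of_mem_waveSupp {n : ℤ × ℤ} (hn : n ≠ 0) {k : Freq} (hk : k ∈ waveSupp q n) :
    k ≠ 0 := by
  simp only [waveSupp, Finset.mem_insert, Finset.mem_singleton] at hk
  rcases hk with rfl | rfl | rfl | rfl <;> simp [hn]

/-- A solution with prescribed mean and prescribed resonant velocities solves the fixed point
problem. -/
lemma fixed_of_seqSol (h : Resonant D β q) (ht : TimeSym c) (hc : ∀ k, conjL (c (-k)) = c k)
    (hsol : SeqSol D (β + μ) c) (h0 : (c 0).1 = C)
    (hv₁ : (c ((1, 0), q)).2.1 = ((-(B₁ * p₁ D (1, 0)) / 2 : ℝ) : ℂ))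
    (hv₂ : (c ((0, 1), q)).2.1 = ((-(B₂ * p₁ D (0, 1)) / 2 : ℝ) : ℂ)) :
    Fixed D β μ (leadCoef D q C B₁ B₂) c := by
  intro k
  have hlead : leadCoef D q C B₁ B₂ k =
    C • unitElev k + B₁ • wave D q (1, 0) k + B₂ • wave D q (0, 1) k := rfl
  have hu : k ≠ 0 → unitElev k = 0 := fun hk => unitElev_eq_zero (by simpa using hk)
  by_cases hk₁ : k ∈ waveSupp q (1, 0)
  · rw [hlead, hu (ne_zero_of_mem_waveSupp (by simp) hk₁),
      wave_eq_zero (notMem_waveSupp_of_mem hk₁), smul_zero, smul_zero, zero_add, add_zero]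
    refine eq_wave_sub_tk h.β_pos.ne' h.q_pos h.dispersion_one_zero ?_ ht hc hsol hv₁ hk₁
    simpa [p₁] using h.pos.k₁.ne'
  by_cases hk₂ : k ∈ waveSupp q (0, 1)
  · rw [hlead, hu (ne_zero_of_mem_waveSupp (by simp) hk₂),
      wave_eq_zero hk₁, smul_zero, smul_zero, zero_add, zero_add]
    refine eq_wave_sub_tk h.β_pos.ne' h.q_pos h.dispersion_zero_one ?_ ht hc hsol hv₂ hk₂
    simpa [p₁] using h.pos.k₂.ne'
  rw [hlead, wave_eq_zero hk₁, wave_eq_zero hk₂, smul_zero, smul_zero, add_zero, add_zero]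
  rcases eq_or_ne k 0 with rfl | hk0
  · rw [tk_zero, sub_zero]
    have hv := ht.vel_zero 0
    refine Prod.ext ?_ (Prod.ext ?_ ?_)
    · simp [unitElev, h0]
    · simpa [unitElev] using (show (c 0).2.1 = 0 from hv.1)
    · simpa [unitElev] using (show (c 0).2.2 = 0 from hv.2)
  · rw [hu hk0, smul_zero, zero_sub]
    obtain ⟨h1, h2, h3⟩ := hsol.linear_form k
    refine eq_neg_tk h.pos h.β_pos.ne' hk0 ?_ ?_ h1 h2 h3
    · by_cases hk : k.2 = 0
      · exact Or.inl hk
      · exact Or.inr fun hf => ((h.fdisc_eq_zero_iff hk).1 hf).elim hk₁ hk₂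
    · intro hk
      have := ht.vel_zero k.1
      rwa [← hk] at this

/-- The resonant components of the right-hand side of a solution satisfy the solvability
condition. -/
lemma solv_rhs_of_seqSol (hβ : 0 < β) {n : ℤ × ℤ}
    (hn : (q : ℝ) * (1 + D.ω * psq D n) = β * √(psq D n)) (hp : 0 < psq D n)
    (hsol : SeqSol D (β + μ) c) : solv D n (rhs β μ c (n, q)) = 0 := by
  obtain ⟨h1, h2, h3⟩ := hsol.linear_form (n, (q : ℤ))
  have hm : mE D (n, (q : ℤ)) = β * √(psq D n) := by rw [← hn]; simp [mE]
  generalize hF : rhs β μ c (n, (q : ℤ)) = F at *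
  generalize c (n, (q : ℤ)) = x at *
  have hs : (√(psq D n) : ℂ) ^ 2 = p₁ D n ^ 2 + p₂ D n ^ 2 := by
    exact_mod_cast Real.sq_sqrt hp.le
  have hs0 : (β * √(psq D n) : ℂ) ≠ 0 := by
    exact_mod_cast (mul_pos hβ (Real.sqrt_pos.2 hp)).ne'
  rw [hm] at h1 h2 h3
  push_cast at h1 h2 h3
  simp only [pdot] at h1
  -- At a resonance the linear operator is singular; this combination of the three equations
  -- eliminates x.
  have e : (√(psq D n) * F.1 : ℂ) = p₁ D n * F.2.1 + p₂ D n * F.2.2 := by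
    refine mul_left_cancel₀ hs0 ?_
    linear_combination (β : ℂ) * (p₁ D n * h2 + p₂ D n * h3) - (β * √(psq D n)) * h1 +
      (β * F.1 + β ^ 2 * x.1) * hs
  rw [solv_apply]
  have := congrArg Complex.re e
  simp only [Complex.add_re, Complex.re_ofReal_mul] at this
  linarith

/-- The cell coordinates y₁ and y₂ adjust the two phases independently. The target is negative
because a wave of positive amplitude has a negative first velocity coefficient at (n, q). -/
lemma exists_phase (hD : D.IsPos) (v w : ℂ) :
    ∃ σ : ℝ × ℝ, expMode D (1, 0) σ * v = -(‖v‖ : ℂ) ∧ expMode D (0, 1) σ * w = -(‖w‖ : ℂ) := by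
  have key : ∀ v : ℂ, Complex.exp (I * ((Real.pi - v.arg : ℝ) : ℂ)) * v = -(‖v‖ : ℂ) := fun v => by
    nth_rewrite 2 [← Complex.norm_mul_exp_arg_mul_I v]
    rw [mul_left_comm, ← Complex.exp_add]
    have : I * ((Real.pi - v.arg : ℝ) : ℂ) + v.arg * I = Real.pi * I := by push_cast; ring
    rw [this, Complex.exp_pi_mul_I]
    ring
  refine ⟨cellPoint D (Real.pi - v.arg) (Real.pi - w.arg), ?_, ?_⟩
  · rw [expMode_cellPoint hD]
    simpa using key v
  · rw [expMode_cellPoint hD]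
    simpa using key w

end Reduction

/-! ### Transfer from coefficients to functions -/

/-- The function with the coefficients `coef s x`. -/
def fieldOf (D : Params) (s : ℝ) (x : Wiener) : Field := fun p t => ∑' k, char D k p t • coef s x k

lemma hasSeries_fieldOf (D : Params) {s : ℝ} (hs : 0 ≤ s) (x : Wiener) :
    HasSeries D (fieldOf D s x) (coef s x) :=
  hasSeries_tsum (summable_coef hs x)

section Solution

variable {D : Params} {β s K η μ C A₁ A₂ : ℝ} {q : ℕ}

lemma psq_pos_one_zero (hD : D.IsPos) : 0 < psq D (1, 0) := by
  have := hD.k₁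
  rw [psq_one_zero]
  positivity

lemma psq_pos_zero_one (hD : D.IsPos) : 0 < psq D (0, 1) := by
  have := hD.k₂
  rw [psq_zero_one]
  positivity

section Fixed

variable {c : Freq → Coef}

lemma Fixed.mean (hf : Fixed D β μ (leadCoef D q C A₁ A₂) c) (hq : 0 < q) : (c 0).1 = C := by
  have h1 : ∀ n, wave D q n 0 = 0 := fun n => by
    refine wave_eq_zero fun hm => ?_
    simp only [waveSupp, Finset.mem_insert, Finset.mem_singleton, Prod.ext_iff, Prod.snd_zero] at hm
    omega
  rw [hf 0, tk_zero]
  simp [leadCoef, h1, unitElev]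

/-- At a resonance 𝒯 has no velocity component, so a fixed point keeps the velocity of its leading
part there. -/
lemma Fixed.vel_eq {X : Freq → Coef} (hf : Fixed D β μ X c) {k : Mode}
    (hk : k ∈ resonanceSet D β) :
    (c (k.1, k.2)).2 = (X (k.1, k.2)).2 := by
  have hk' : (k.2 : ℝ) * (1 + D.ω * psq D k.1) = β * √(psq D k.1) := sub_eq_zero.1 hk.2
  have hd : fdisc D β (k.1, (k.2 : ℤ)) = 0 := by
    rw [fdisc, mE, Int.cast_natCast, hk', mul_pow, Real.sq_sqrt (psq_nonneg _ _), sub_self]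
  have h0 : ((k.1, (k.2 : ℤ)) : Freq) ≠ 0 := by
    intro h
    have : (k.2 : ℤ) = 0 := congrArg Prod.snd h
    have := hk.1
    omega
  rw [hf, tk_of_eq (Or.inr hd) h0]
  simp

lemma leadCoef_one_zero (hq : 0 < q) :
    (leadCoef D q C A₁ A₂ ((1, 0), q)).2.1 = ((-(A₁ * D.k₁) / 2 : ℝ) : ℂ) := by
  have hq' : (q : ℤ).sign = 1 := Int.sign_eq_one_of_pos (by exact_mod_cast hq)
  have h1 : wave D q (0, 1) ((1, 0), (q : ℤ)) = 0 := wave_eq_zero (by simp [waveSupp])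
  have h2 : unitElev ((1, 0), (q : ℤ)) = 0 := unitElev_eq_zero (by simp)
  have h3 : wave D q (1, 0) ((1, 0), (q : ℤ)) = waveCoef D (1, 0) 1 := by simp [wave, hq']
  simp only [leadCoef, Pi.add_apply, Pi.smul_apply, h1, h2, h3, smul_zero, zero_add, add_zero,
    waveCoef, p₁_one_zero, rv, Prod.smul_fst, Prod.smul_snd, Complex.real_smul]
  push_cast
  ring

lemma leadCoef_zero_one (hq : 0 < q) :
    (leadCoef D q C A₁ A₂ ((0, 1), q)).2.1 = ((-(A₂ * D.k₂) / 2 : ℝ) : ℂ) := by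
  have hq' : (q : ℤ).sign = 1 := Int.sign_eq_one_of_pos (by exact_mod_cast hq)
  have h1 : wave D q (1, 0) ((0, 1), (q : ℤ)) = 0 := wave_eq_zero (by simp [waveSupp])
  have h2 : unitElev ((0, 1), (q : ℤ)) = 0 := unitElev_eq_zero (by simp)
  have h3 : wave D q (0, 1) ((0, 1), (q : ℤ)) = waveCoef D (0, 1) 1 := by simp [wave, hq']
  simp only [leadCoef, Pi.add_apply, Pi.smul_apply, h1, h2, h3, smul_zero, zero_add,
    waveCoef, p₁_zero_one, rv, Prod.smul_fst, Prod.smul_snd, Complex.real_smul]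
  push_cast
  ring

lemma timeSym_leadCoef (D : Params) (q : ℕ) (C A₁ A₂ : ℝ) : TimeSym (leadCoef D q C A₁ A₂) :=
  (timeSym_act_iff (D := D) (β := 0)).1 (timeSym_lead D 0 q C A₁ A₂)

lemma HasSeries.sinCoeff_sub_leading (h : Resonant D β q) {U : Field} (hU : HasSeries D U c)
    (ht : TimeSym c) (hf : Fixed D β μ (leadCoef D q C A₁ A₂) c) {k : Mode}
    (hk : k ∈ resonanceSet D β) :
    sinCoeff D (Boussinesq.vel₁ (U - leading D q C A₁ A₂)) k = 0 ∧
      sinCoeff D (Boussinesq.vel₂ (U - leading D q C A₁ A₂)) k = 0 := by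
  have hs := hU.sub (hasSeries_leading h.pos h.q_pos C A₁ A₂)
  have hts : TimeSym (c - leadCoef D q C A₁ A₂) := by
    have := ht.add ((timeSym_leadCoef D q C A₁ A₂).smul (-1))
    rwa [neg_one_smul, ← sub_eq_add_neg] at this
  have hv := hf.vel_eq hk
  rw [hs.sinCoeff_vel₁ h.pos hts, hs.sinCoeff_vel₂ h.pos hts]
  simp [hv]

lemma HasSeries.exists_vel_ne_zero (h : Resonant D β q) {U : Field} (hU : HasSeries D U c)
    (ht : TimeSym c) (hf : Fixed D β μ (leadCoef D q C A₁ A₂) c) (hA : 0 < A₁ ∨ 0 < A₂) :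
    ∃ x t, (U x t).2 ≠ 0 := by
  by_contra! hc
  have hv : Boussinesq.vel₁ U = 0 := by
    funext x t
    exact congrArg Prod.fst (hc x t)
  have h0 : ∀ k : Mode, (c (k.1, k.2)).2.1 = 0 := fun k => by
    have h1 := hU.sinCoeff_vel₁ h.pos ht k
    rw [hv] at h1
    simpa [sinCoeff, cellMean] using h1.symm
  rcases hA with hA | hA
  · have h1 := congrArg Prod.fst (hf.vel_eq h.mem_one_zero)
    rw [h0, leadCoef_one_zero h.q_pos] at h1
    have h2 := mul_pos hA h.pos.k₁
    have h3 : -(A₁ * D.k₁) / 2 = 0 := by exact_mod_cast h1.symm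
    linarith
  · have h1 := congrArg Prod.fst (hf.vel_eq h.mem_zero_one)
    rw [h0, leadCoef_zero_one h.q_pos] at h1
    have h2 := mul_pos hA h.pos.k₂
    have h3 : -(A₂ * D.k₂) / 2 = 0 := by exact_mod_cast h1.symm
    linarith

end Fixed

/-- The remainder in the expansion of a fixed point. -/
def remainder (hs : 0 ≤ s) (hK : ∀ k F, ‖tk D β k F‖ ≤ K * ‖F‖) (μ : ℝ) (X x : Wiener) : Wiener :=
  x - X + μ • opT s hK X + β • opT s hK (opB hs X X)

/-- The identity holds by the choice of the remainder; the content is that 𝒯 and B on functions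
correspond to those on coefficients, and that the remainder is time symmetric. -/
lemma expansion (h : Resonant D β q) (hs : 0 ≤ s) (hK : ∀ k F, ‖tk D β k F‖ ≤ K * ‖F‖)
    (μ C A₁ A₂ : ℝ) {x : Wiener} (ht : TimeSym (coef s x)) :
    TimeSym (coef s (remainder hs hK μ (leadE D s q C A₁ A₂) x)) ∧
    fieldOf D s x = leading D q C A₁ A₂ - (μ : ℂ) • linInv D β (leading D q C A₁ A₂)
      - (β : ℂ) • linInv D β (quad (leading D q C A₁ A₂))
      + fieldOf D s (remainder hs hK μ (leadE D s q C A₁ A₂) x) := by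
  have hl := hasSeries_leading h.pos h.q_pos C A₁ A₂
  have htl := timeSym_leadCoef D q C A₁ A₂
  have htq : TimeSym (cconv (leadCoef D q C A₁ A₂) (leadCoef D q C A₁ A₂)) := htl.cconv htl hl.1 hl.1
  have hT := hasSeries_linInv h.pos hK hl htl
  have hQ := hasSeries_linInv h.pos hK hl.quad htq
  have hR := hasSeries_fieldOf D hs (remainder hs hK μ (leadE D s q C A₁ A₂) x)
  have e : coef s (remainder hs hK μ (leadE D s q C A₁ A₂) x) =
      coef s x + (-1 : ℂ) • leadCoef D q C A₁ A₂ +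
        (μ : ℂ) • (fun k => tk D β k (leadCoef D q C A₁ A₂ k)) +
        (β : ℂ) • (fun k => tk D β k (cconv (leadCoef D q C A₁ A₂) (leadCoef D q C A₁ A₂) k)) := by
    simp only [remainder, coef_add, coef_sub, coef_smul, coef_opT, coef_opB, coef_leadE]
    rw [neg_one_smul, ← sub_eq_add_neg]
    rfl
  constructor
  · rw [e]
    exact ((ht.add (htl.smul _)).add (htl.tk.smul _)).add (htq.tk.smul _)
  · have h1 := ((hl.sub (hT.const_smul μ)).sub (hQ.const_smul β)).add hR
    refine HasSeries.unique_fun (hasSeries_fieldOf D hs x) ?_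
    convert! h1 using 1
    rw [e]
    module

variable {z : Wiener × Wiener × Wiener × Wiener}

/-- All spatial shifts of a real solution on the branch are solutions in `Q_s`. -/
lemma shift_fieldOf (h : Resonant D β q) (hs : 0 ≤ s) {x : Wiener} {β' : ℝ}
    (hmem : ∀ (U : Field) (c : Freq → Coef), HasSeries D U c → TimeSym c →
      Summable (fun k => wt s k * ‖c k‖) → MemQ D s U)
    (ht : TimeSym (coef s x)) (hsol : SeqSol D β' (coef s x)) (σ : ℝ × ℝ) :
    MemQ D s (shift σ (fieldOf D s x)) ∧ IsSolution D β' (shift σ (fieldOf D s x)) := by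
  have hser := (hasSeries_fieldOf D hs x).shift σ
  refine ⟨hmem _ _ hser (ht.shift (D := D) (β := β)) ?_,
    (isSolution_iff h.pos hser _).2 (seqSol_shift (β' := β) (summable_coef hs x) hsol)⟩
  refine (summable_wt_coef s x).congr fun k => ?_
  rw [norm_smul, norm_expMode, one_mul]

/-- A small solution with nonzero resonant velocities is a shift of the one on the branch. -/
lemma eq_shift_of_seqSol (h : Resonant D β q) (hs : 0 ≤ s) (hK : ∀ k F, ‖tk D β k F‖ ≤ K * ‖F‖)
    (hK0 : 0 ≤ K) {W : Field} {c : Freq → Coef} (hW : HasSeries D W c) (ht : TimeSym c)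
    (hc : ∀ k, conjL (c (-k)) = c k) (hsol : SeqSol D (β + μ) c) (h0 : (c 0).1 = C)
    (hv₁ : (c ((1, 0), q)).2.1 ≠ 0) (hv₂ : (c ((0, 1), q)).2.1 ≠ 0) (hη : ∑' k, ‖c k‖ ≤ η)
    {z : Par → Wiener × Wiener × Wiener × Wiener}
    (hz : ∀ B₁ B₂ : ℝ, 0 < B₁ → 0 < B₂ → B₁ ≤ 2 / D.k₁ * ∑' k, ‖c k‖ →
      B₂ ≤ 2 / D.k₂ * ∑' k, ‖c k‖ →
      resid s q hs hK (((μ, C), (B₁ ^ 2, B₂ ^ 2)), z ((μ, C), (B₁ ^ 2, B₂ ^ 2))) = 0 ∧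
      SmallBranch K β μ η B₁ B₂ (z ((μ, C), (B₁ ^ 2, B₂ ^ 2))) ∧
      (bifFun (solvE D hs q (1, 0)) (solvE D hs q (0, 1)) (opB hs) β z
        ((μ, C), (B₁ ^ 2, B₂ ^ 2)) = 0 → B₁ = A₁ ∧ B₂ = A₂)) :
    ∃ σ : ℝ × ℝ, W = shift σ (fieldOf D s (assemble A₁ A₂ (z ((μ, C), (A₁ ^ 2, A₂ ^ 2))))) := by
  obtain ⟨σ, hσ₁, hσ₂⟩ := exists_phase h.pos (c ((1, 0), q)).2.1 (c ((0, 1), q)).2.1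
  have hk₁ := h.pos.k₁
  have hk₂ := h.pos.k₂
  have hle : ∀ k, ‖(c k).2.1‖ ≤ ∑' k, ‖c k‖ := fun k =>
    (norm_vel₁_le _).trans (hW.1.le_tsum k fun _ _ => norm_nonneg _)
  -- A wave of amplitude B has first velocity coefficient -Bk/2, so these are the amplitudes of the
  -- aligned solution.
  have hB₁ : 0 < 2 / D.k₁ * ‖(c ((1, 0), q)).2.1‖ := by positivity
  have hB₂ : 0 < 2 / D.k₂ * ‖(c ((0, 1), q)).2.1‖ := by positivity
  obtain ⟨hr, hb, hA⟩ := hz _ _ hB₁ hB₂ (by gcongr; exact hle _) (by gcongr; exact hle _)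
  obtain ⟨B₁, e₁⟩ : ∃ B, B = 2 / D.k₁ * ‖(c ((1, 0), q)).2.1‖ := ⟨_, rfl⟩
  obtain ⟨B₂, e₂⟩ : ∃ B, B = 2 / D.k₂ * ‖(c ((0, 1), q)).2.1‖ := ⟨_, rfl⟩
  rw [← e₁, ← e₂] at hr hb hA
  rw [← e₁] at hB₁
  rw [← e₂] at hB₂
  have hser := hW.shift σ
  have ht' : TimeSym ((shiftSym D β σ).act c) := ht.shift
  have hsol' : SeqSol D (β + μ) ((shiftSym D β σ).act c) := seqSol_shift hW.1 hsol
  have hfix : Fixed D β μ (leadCoef D q C B₁ B₂) ((shiftSym D β σ).act c) := by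
    refine fixed_of_seqSol h ht' (conjL_shift hc) hsol' ?_ ?_ ?_
    · simp [shiftSym_act, h0, expMode_zero]
    · rw [shiftSym_act, Prod.smul_snd, Prod.smul_fst, smul_eq_mul, hσ₁, p₁_one_zero, e₁]
      have : (D.k₁ : ℂ) ≠ 0 := by exact_mod_cast hk₁.ne'
      push_cast
      field_simp
    · rw [shiftSym_act, Prod.smul_snd, Prod.smul_fst, smul_eq_mul, hσ₂, p₁_zero_one, e₂]
      have : (D.k₂ : ℂ) ≠ 0 := by exact_mod_cast hk₂.ne'
      push_cast
      field_simp
  have heq : (shiftSym D β σ).act c = coef s (assemble B₁ B₂ (z ((μ, C), (B₁ ^ 2, B₂ ^ 2)))) := by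
    refine fixed_unique hK hK0 (CoefSym.summable_act _ hW.1) (summable_coef hs _)
      (lt_of_le_of_lt ?_ hb.lt_one) hfix (fixed_assemble hs hK hr)
    rw [CoefSym.tsum_act, two_mul]
    gcongr
    exact (tsum_coef_le hs _).trans hb.norm_self
  rw [heq] at hsol'
  have hsolv₁ := solv_rhs_of_seqSol h.β_pos h.dispersion_one_zero (psq_pos_one_zero h.pos) hsol'
  have hsolv₂ := solv_rhs_of_seqSol h.β_pos h.dispersion_zero_one (psq_pos_zero_one h.pos) hsol'
  rw [rhs_coef hs, ← solvE_apply hs] at hsolv₁ hsolv₂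
  obtain ⟨g₁, g₂⟩ := solvE_assemble h.pos hs hK hK0 hr hb
  rw [g₁] at hsolv₁
  rw [g₂] at hsolv₂
  -- Both resonant velocities being nonzero, B₁ and B₂ can be divided out of the solvability
  -- conditions, which leaves the bifurcation equations.
  obtain ⟨rfl, rfl⟩ := hA (Prod.ext ((mul_eq_zero.1 hsolv₁).resolve_left hB₁.ne')
    ((mul_eq_zero.1 hsolv₂).resolve_left hB₂.ne'))
  have hWU : (fun x t => W (x + σ) t) =
      fieldOf D s (assemble B₁ B₂ (z ((μ, C), (B₁ ^ 2, B₂ ^ 2)))) := by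
    refine HasSeries.unique_fun (c := (shiftSym D β σ).act c) hser ?_
    rw [heq]
    exact hasSeries_fieldOf D hs _
  refine ⟨-σ, ?_⟩
  rw [← hWU]
  funext x t
  simp [shift]

end Solution

/-! ### Choice of the constants and proof of the theorem -/

lemma polynomial_bound {β K L u r : ℝ} (hβ : 0 ≤ β) (hK : 0 ≤ K) (hL : 0 ≤ L) (hu : 0 ≤ u)
    (hr : 0 ≤ r) :
    K * (u * (K * (2 * u * (L * r) + 4 * (β + 1) * (L * r) ^ 2)) + 4 * u * (L * r) ^ 2 +
        β * (K * (2 * u * (L * r) + 4 * (β + 1) * (L * r) ^ 2) * (3 * (L * r)))) ≤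
      K * (2 * K * L + 4 * K * (β + 1) * L ^ 2 + (4 * L ^ 2 + 6 * β * K * L ^ 2) +
        12 * β * (β + 1) * K * L ^ 3) * (u ^ 2 * r + u * r ^ 2 + r ^ 3) := by
  obtain ⟨a, ha⟩ : ∃ a, a = 2 * K * L := ⟨_, rfl⟩
  obtain ⟨b, hb⟩ : ∃ b, b = 4 * K * (β + 1) * L ^ 2 := ⟨_, rfl⟩
  obtain ⟨d, hd⟩ : ∃ d, d = 4 * L ^ 2 + 6 * β * K * L ^ 2 := ⟨_, rfl⟩
  obtain ⟨e, he⟩ : ∃ e, e = 12 * β * (β + 1) * K * L ^ 3 := ⟨_, rfl⟩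
  have ha0 : 0 ≤ a := by rw [ha]; positivity
  have hb0 : 0 ≤ b := by rw [hb]; positivity
  have hd0 : 0 ≤ d := by rw [hd]; positivity
  have he0 : 0 ≤ e := by rw [he]; positivity
  calc _ = K * (a * (u ^ 2 * r) + b * (u * r ^ 2) + d * (u * r ^ 2) + e * r ^ 3) := by
        rw [ha, hb, hd, he]; ring
    _ ≤ K * ((a + b + d + e) * (u ^ 2 * r + u * r ^ 2 + r ^ 3)) := by
        refine mul_le_mul_of_nonneg_left ?_ hK
        have : 0 ≤ (b + d + e) * (u ^ 2 * r) + (a + e) * (u * r ^ 2) + (a + b + d) * r ^ 3 := by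
          positivity
        linarith
    _ = _ := by rw [ha, hb, hd, he]; ring

section Main

variable {D : Params} {β s K : ℝ} {q : ℕ}

lemma norm_leadE_le (D : Params) (s : ℝ) (q : ℕ) {C A₁ A₂ : ℝ} (h₁ : 0 ≤ A₁) (h₂ : 0 ≤ A₂) :
    ‖leadE D s q C A₁ A₂‖ ≤
      (‖elevE s‖ + ‖waveE D s q (1, 0)‖ + ‖waveE D s q (0, 1)‖) * (|C| + A₁ + A₂) := by
  have h := norm_add₃_le (a := C • elevE s) (b := A₁ • waveE D s q (1, 0))
    (c := A₂ • waveE D s q (0, 1))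
  rw [norm_smul, norm_smul, norm_smul, Real.norm_eq_abs, Real.norm_eq_abs, Real.norm_eq_abs,
    abs_of_nonneg h₁, abs_of_nonneg h₂] at h
  refine h.trans ?_
  have hx := norm_nonneg (elevE s)
  have hy := norm_nonneg (waveE D s q (1, 0))
  have hw := norm_nonneg (waveE D s q (0, 1))
  have hC := abs_nonneg C
  generalize ‖elevE s‖ = x at *
  generalize ‖waveE D s q (1, 0)‖ = y at *
  generalize ‖waveE D s q (0, 1)‖ = w at *
  have : 0 ≤ x * (A₁ + A₂) + y * (|C| + A₂) + w * (|C| + A₁) := by positivity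
  linarith

lemma exists_norm_remainder_le (hβ : 0 < β) (hs : 0 ≤ s) (hK : ∀ k F, ‖tk D β k F‖ ≤ K * ‖F‖)
    (hK0 : 0 ≤ K) (q : ℕ) :
    ∃ M > 0, ∀ (μ C A₁ A₂ : ℝ) (x : Wiener), 0 ≤ A₁ → 0 ≤ A₂ → |μ| ≤ 1 →
      K * (|μ| + |β + μ| * ‖x‖) ≤ 1 / 2 →
      x = leadE D s q C A₁ A₂ - opT s hK (μ • x + (β + μ) • opB hs x x) →
      ‖remainder hs hK μ (leadE D s q C A₁ A₂) x‖ ≤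
        M * (|μ| ^ 2 * (|C| + A₁ + A₂) + |μ| * (|C| + A₁ + A₂) ^ 2 + (|C| + A₁ + A₂) ^ 3) := by
  obtain ⟨L, hL⟩ : ∃ L, L = ‖elevE s‖ + ‖waveE D s q (1, 0)‖ + ‖waveE D s q (0, 1)‖ := ⟨_, rfl⟩
  have hL0 : 0 ≤ L := by rw [hL]; positivity
  refine ⟨K * (2 * K * L + 4 * K * (β + 1) * L ^ 2 + (4 * L ^ 2 + 6 * β * K * L ^ 2) +
    12 * β * (β + 1) * K * L ^ 3) + 1, by positivity, fun μ C A₁ A₂ x h₁ h₂ hμ hsm hx => ?_⟩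
  have hr : 0 ≤ |C| + A₁ + A₂ := by positivity
  have hX := norm_leadE_le D s q (C := C) h₁ h₂
  rw [← hL] at hX
  refine (norm_remainder_le hβ.le hK0 (norm_opT_le hK) (norm_opB_le hs) hx hX hμ hsm).trans ?_
  refine (polynomial_bound hβ.le hK0 hL0 (abs_nonneg μ) hr).trans ?_
  gcongr
  linarith

lemma smallBranch_of {μ η A₁ A₂ : ℝ} {y : Par} {z : Wiener × Wiener × Wiener × Wiener}
    (hy : y.2 = (A₁ ^ 2, A₂ ^ 2)) (hlt : K * (|μ| + |β + μ| * (2 * η)) < 1)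
    (h : ∀ B₁ B₂ : ℝ, y.2 = (B₁ ^ 2, B₂ ^ 2) → ‖assemble B₁ B₂ z‖ < η) :
    SmallBranch K β μ η A₁ A₂ z :=
  ⟨hlt, fun r₁ r₂ h₁ h₂ => (h _ _ (by rw [hy, mul_pow, mul_pow, h₁, h₂, one_mul, one_mul])).le⟩

/-- With |β + μ| ≤ β + 1, each of the two terms contributes at most 1/8. -/
lemma smallness {μ : ℝ} (hβ : 0 < β) (hK0 : 0 < K) (h1 : |μ| ≤ 1) (hμ : |μ| ≤ 1 / (8 * K)) :
    K * (|μ| + |β + μ| * (2 * (1 / (16 * K * (β + 1))))) ≤ 1 / 4 := by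
  have hβμ : |β + μ| ≤ β + 1 := (abs_add_le _ _).trans (by rw [abs_of_pos hβ]; linarith)
  calc _ ≤ K * (1 / (8 * K) + (β + 1) * (2 * (1 / (16 * K * (β + 1))))) := by gcongr
    _ = 1 / 4 := by field_simp; norm_num

lemma exists_delta {k₁ k₂ K₂ η m : ℝ} (hη : 0 < η) (hm : 0 < m) : ∃ δ > 0, K₂ * δ ≤ η ∧ (2 / k₁ * (K₂ * δ)) ^ 2 < m ∧
      (2 / k₂ * (K₂ * δ)) ^ 2 < m := by
  have key : ∀ k : ℝ, ∀ᶠ δ in nhdsWithin (0 : ℝ) (Set.Ioi 0), (2 / k * (K₂ * δ)) ^ 2 < m :=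
    fun k => nhdsWithin_le_nhds (Continuous.tendsto' (by fun_prop) 0 0 (by simp) |>.eventually
      (gt_mem_nhds hm))
  have h0 : ∀ᶠ δ in nhdsWithin (0 : ℝ) (Set.Ioi 0), K₂ * δ ≤ η :=
    nhdsWithin_le_nhds ((Continuous.tendsto' (by fun_prop) 0 0 (by simp) |>.eventually
      (gt_mem_nhds hη)).mono fun _ h => h.le)
  obtain ⟨δ, ⟨⟨h1, h2⟩, h3⟩, h4⟩ :=
    (((h0.and (key k₁)).and (key k₂)).and self_mem_nhdsWithin).exists
  exact ⟨δ, h4, h1, h2, h3⟩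

end Main

end Boussinesq

end

open Boussinesq in
theorem mainTheorem1 (D : Boussinesq.Params)
    (hω : 0 < D.ω) (hk₁ : 0 < D.k₁) (hk₂ : 0 < D.k₂) (hτ₁ : 0 < D.τ₁) (hτ₂ : 0 < D.τ₂)
    (β₀ : ℝ) (hβ₀ : 0 < β₀) (q : ℕ)
    (hΩ : Boussinesq.resonanceSet D β₀ =
      {((1, 0), q), ((-1, 0), q), ((0, 1), q), ((0, -1), q)})
    (hl : Boussinesq.lDet D β₀ q ≠ 0)
    (s : ℝ) (hs : 2 ≤ s) :
    ∃ ε > 0, ∃ δ > 0, ∃ M > 0, ∀ μ C : ℝ, |μ| + |C| < ε →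
      0 ≤ Boussinesq.ampSq₁ D β₀ q μ C → 0 ≤ Boussinesq.ampSq₂ D β₀ q μ C →
      ∃ (A₁ A₂ : ℝ) (U : Boussinesq.Field),
        -- the amplitudes
        0 ≤ A₁ ∧ 0 ≤ A₂ ∧
        |A₁ ^ 2 - Boussinesq.ampSq₁ D β₀ q μ C| ≤ M * (|μ| + |C|) ^ 2 ∧
        |A₂ ^ 2 - Boussinesq.ampSq₂ D β₀ q μ C| ≤ M * (|μ| + |C|) ^ 2 ∧
        -- all spatial shifts of `U` are real solutions in `Q_s`
        Boussinesq.IsRealField U ∧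
        (∀ σ : ℝ × ℝ, Boussinesq.MemQ D s (Boussinesq.shift σ U) ∧
          Boussinesq.IsSolution D (β₀ + μ) (Boussinesq.shift σ U)) ∧
        Boussinesq.normQ D s U < δ ∧
        -- the mean elevation is `C`, and `U - X` has no velocity in the resonant modes
        Boussinesq.cellMean D (Boussinesq.eta U) = C ∧
        (∀ k ∈ Boussinesq.resonanceSet D β₀,
          Boussinesq.sinCoeff D
            (Boussinesq.vel₁ (U - Boussinesq.leading D q C A₁ A₂)) k = 0 ∧
          Boussinesq.sinCoeff D
            (Boussinesq.vel₂ (U - Boussinesq.leading D q C A₁ A₂)) k = 0) ∧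
        -- the expansion `U = X - V₁ - V₂ + R`
        (∃ R : Boussinesq.Field,
          U = Boussinesq.leading D q C A₁ A₂
            - (μ : ℂ) • Boussinesq.linInv D β₀ (Boussinesq.leading D q C A₁ A₂)
            - (β₀ : ℂ) • Boussinesq.linInv D β₀
                (Boussinesq.quad (Boussinesq.leading D q C A₁ A₂)) + R ∧
          Boussinesq.MemQ D s R ∧
          Boussinesq.normQ D s R ≤ M * (|μ| ^ 2 * (|C| + A₁ + A₂)
            + |μ| * (|C| + A₁ + A₂) ^ 2 + (|C| + A₁ + A₂) ^ 3)) ∧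
        -- nontriviality
        (M * (|μ| + |C|) ^ 2 < Boussinesq.ampSq₁ D β₀ q μ C → 0 < A₁) ∧
        (M * (|μ| + |C|) ^ 2 < Boussinesq.ampSq₂ D β₀ q μ C → 0 < A₂) ∧
        (0 < A₁ ∨ 0 < A₂ → ∃ x t, (U x t).2 ≠ 0) ∧
        -- uniqueness up to a spatial shift
        (∀ W : Boussinesq.Field, Boussinesq.IsRealField W → Boussinesq.MemQ D s W →
          Boussinesq.IsSolution D (β₀ + μ) W →
          Boussinesq.cellMean D (Boussinesq.eta W) = C →
          Boussinesq.normQ D s W < δ →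
          Boussinesq.sinCoeff D (Boussinesq.vel₁ W) ((1, 0), q) ≠ 0 →
          Boussinesq.sinCoeff D (Boussinesq.vel₁ W) ((0, 1), q) ≠ 0 →
          ∃ σ : ℝ × ℝ, W = Boussinesq.shift σ U) := by
  have h : Resonant D β₀ q := ⟨⟨hω, hk₁, hk₂, hτ₁, hτ₂⟩, hβ₀, hΩ⟩
  have hs0 : 0 ≤ s := by linarith
  obtain ⟨K, hK0, hK⟩ := exists_norm_tk_le h.pos hβ₀
  obtain ⟨K₁, hK₁0, hK₁⟩ := memQ_of_series h.pos hs0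
  obtain ⟨K₂, hK₂0, hK₂⟩ := series_of_memQ h.pos hs
  obtain ⟨M₀, hM₀0, hM₀⟩ := exists_norm_remainder_le hβ₀ hs0 hK hK0.le q
  obtain ⟨z, hz, hz0, hzr⟩ := exists_components (opT s hK) (opB hs0) β₀ (elevE s)
    (waveE D s q (1, 0)) (waveE D s q (0, 1))
  obtain ⟨ρ, hρ, ε₁, hε₁, M₁, hM₁, hamp⟩ := exists_amplitudes (contDiffAt_bif hz _ _)
    (bif_zero hz0 _ _) hβ₀ (psq_pos_one_zero h.pos) (psq_pos_zero_one h.pos) hl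
    (fderiv_bif_waves h hs0 hK hz hz0 hzr)
  -- Fixed points of norm at most η fall under the contraction estimate, with factor at most 1/4 by
  -- `smallness`.
  obtain ⟨η, hηe⟩ : ∃ η, η = 1 / (16 * K * (β₀ + 1)) := ⟨_, rfl⟩
  have hη : 0 < η := by rw [hηe]; positivity
  have hz1 : (z 0).1 = 0 := by rw [hz0]; rfl
  -- The order of choices avoids circularity. The radius r₀ makes the branch available to competing
  -- solutions, then δ puts the squared amplitudes of any W below r₀ and ρ, and only then r₁ makes U
  -- itself smaller than δ.
  obtain ⟨r₀, hr₀, hR₀⟩ := exists_radius hz.continuousAt hz1 hzr hη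
  obtain ⟨δ, hδ, hδη, hδ₁, hδ₂⟩ := exists_delta (k₁ := D.k₁) (k₂ := D.k₂) (K₂ := K₂) hη
    (lt_min hρ hr₀)
  obtain ⟨r₁, hr₁, hR₁⟩ := exists_radius hz.continuousAt hz1 hzr
    (lt_min hη (div_pos hδ hK₁0))
  -- As a_j ≤ M₁(|μ| + |C|), the bound r₁/M₁ keeps the squared amplitudes below r₁. The constant M₁
  -- + K₁M₀ serves both the amplitudes and the remainder.
  refine ⟨min (min ε₁ (min r₀ r₁)) (min (r₁ / M₁) (min 1 (1 / (8 * K)))), by positivity, δ, hδ,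
    M₁ + K₁ * M₀, by positivity, fun μ C hμC hα₁ hα₂ => ?_⟩
  simp only [lt_min_iff] at hμC
  obtain ⟨⟨hε, hlt₀, hlt₁⟩, hltM, hlt_one, hltK⟩ := hμC
  have hμ0 := abs_nonneg μ
  have hC0 := abs_nonneg C
  have hμ1 : |μ| ≤ 1 := by linarith
  have hsm : K * (|μ| + |β₀ + μ| * (2 * η)) ≤ 1 / 4 := by
    rw [hηe]
    exact smallness hβ₀ hK0 hμ1 (by linarith)
  obtain ⟨a₁, a₂, ha₁, ha₂, hd₁, hd₂, hb₁, hb₂, hc₁, hc₂, huniq⟩ := hamp μ C _ _ hε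
    (by rw [psq_one_zero, psq_zero_one]; unfold ampSq₁ lDet; ring_nf)
    (by rw [psq_one_zero, psq_zero_one]; unfold ampSq₂ lDet; ring_nf) hα₁ hα₂
  obtain ⟨A₁, hA₁, rfl⟩ : ∃ A, 0 ≤ A ∧ a₁ = A ^ 2 :=
    ⟨√a₁, Real.sqrt_nonneg _, (Real.sq_sqrt ha₁).symm⟩
  obtain ⟨A₂, hA₂, rfl⟩ : ∃ A, 0 ≤ A ∧ a₂ = A ^ 2 :=
    ⟨√a₂, Real.sqrt_nonneg _, (Real.sq_sqrt ha₂).symm⟩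
  have hMr : M₁ * (|μ| + |C|) < r₁ := by rwa [lt_div_iff₀' hM₁] at hltM
  have hy : ‖(((μ, C), (A₁ ^ 2, A₂ ^ 2)) : Par)‖ < r₁ := by
    refine max_lt (max_lt ?_ ?_) (max_lt ?_ ?_) <;> simp only [Real.norm_eq_abs]
    · linarith
    · linarith
    · rw [abs_of_nonneg ha₁]; linarith
    · rw [abs_of_nonneg ha₂]; linarith
  obtain ⟨hr, hsmall⟩ := hR₁ _ hy
  have hb : SmallBranch K β₀ μ η A₁ A₂ (z ((μ, C), (A₁ ^ 2, A₂ ^ 2))) :=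
    smallBranch_of rfl (by linarith) fun B₁ B₂ e => (hsmall B₁ B₂ e).trans_le (min_le_left _ _)
  have hnorm : ‖assemble A₁ A₂ (z ((μ, C), (A₁ ^ 2, A₂ ^ 2)))‖ < δ / K₁ :=
    (hsmall A₁ A₂ rfl).trans_le (min_le_right _ _)
  have ht := timeSym_assemble hs0 hK hK0.le hr hb
  have hfix := fixed_assemble hs0 hK hr
  have hlead := assemble_eq_lead hs0 hK hr
  have hconj := conjL_assemble hs0 hK hK0.le hr hb
  have hzero : ∀ A : ℝ, A ^ 2 = 0 → A = 0 := fun A => pow_eq_zero_iff two_ne_zero |>.1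
  -- Either A_j = 0 or the j-th bifurcation function vanishes; in both cases the product is zero.
  have hsol := seqSol_assemble h hs0 hK hK0.le hr hb
    (hc₁.elim (fun e => by rw [hzero _ e, zero_mul]) fun e => mul_eq_zero_of_right _ e)
    (hc₂.elim (fun e => by rw [hzero _ e, zero_mul]) fun e => mul_eq_zero_of_right _ e)
  have hpos : ∀ {A α : ℝ}, 0 ≤ A → |A ^ 2 - α| ≤ M₁ * (|μ| + |C|) ^ 2 →
      (M₁ + K₁ * M₀) * (|μ| + |C|) ^ 2 < α → 0 < A := fun {A α} hA hd hlt => by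
    refine hA.lt_of_ne ?_
    rintro rfl
    have h1 := (abs_le.1 hd).1
    have h2 : 0 ≤ K₁ * M₀ * (|μ| + |C|) ^ 2 := by positivity
    linarith
  have hle : ∀ t : ℝ, 0 ≤ t → M₁ * t ≤ (M₁ + K₁ * M₀) * t := fun t ht => by
    have : 0 ≤ K₁ * M₀ * t := by positivity
    linarith
  have hser := hasSeries_fieldOf D hs0 (assemble A₁ A₂ (z ((μ, C), (A₁ ^ 2, A₂ ^ 2))))
  obtain ⟨htR, hexp⟩ := expansion h hs0 hK μ C A₁ A₂ ht
  refine ⟨A₁, A₂, fieldOf D s (assemble A₁ A₂ (z ((μ, C), (A₁ ^ 2, A₂ ^ 2)))), hA₁, hA₂,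
    hd₁.trans (hle _ (by positivity)), hd₂.trans (hle _ (by positivity)),
    (hser.isRealField_iff h.pos).2 hconj,
    shift_fieldOf h hs0 (fun U c h1 h2 h3 => (hK₁ U c h1 h2 h3).1) ht hsol, ?_,
    (hser.eta.cellMean_eq h.pos).trans (hfix.mean h.q_pos),
    fun k hk => hser.sinCoeff_sub_leading h ht hfix hk, ⟨_, hexp, ?_⟩,
    hpos hA₁ hd₁, hpos hA₂ hd₂, hser.exists_vel_ne_zero h ht hfix, ?_⟩
  · refine (hK₁ _ _ hser ht (summable_wt_coef s _)).2.trans_lt ?_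
    rw [tsum_wt_coef]
    rwa [lt_div_iff₀' hK₁0] at hnorm
  · obtain ⟨hm, hn⟩ := hK₁ _ _ (hasSeries_fieldOf D hs0 _) htR (summable_wt_coef s _)
    refine ⟨hm, hn.trans ?_⟩
    rw [tsum_wt_coef]
    have hx : K * (|μ| + |β₀ + μ| * ‖assemble A₁ A₂ (z ((μ, C), (A₁ ^ 2, A₂ ^ 2)))‖) ≤ 1 / 2 := by
      have h1 : K * (|μ| + |β₀ + μ| * ‖assemble A₁ A₂ (z ((μ, C), (A₁ ^ 2, A₂ ^ 2)))‖) ≤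
          K * (|μ| + |β₀ + μ| * (2 * η)) := by
        have := hb.norm_self
        gcongr
        linarith
      linarith
    have h2 := hM₀ μ C A₁ A₂ _ hA₁ hA₂ hμ1 hx hlead
    have hS : 0 ≤ |μ| ^ 2 * (|C| + A₁ + A₂) + |μ| * (|C| + A₁ + A₂) ^ 2 + (|C| + A₁ + A₂) ^ 3 := by
      positivity
    refine (mul_le_mul_of_nonneg_left h2 hK₁0.le).trans ?_
    rw [← mul_assoc]
    gcongr
    linarith
  · intro W hWr hWm hWs hWC hWn hW₁ hW₂
    obtain ⟨c, hc, htc, hcn⟩ := hK₂ W hWm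
    have hcδ : ∑' k, ‖c k‖ ≤ K₂ * δ := hcn.trans (by gcongr)
    refine eq_shift_of_seqSol h hs0 hK hK0.le hc htc ((hc.isRealField_iff h.pos).1 hWr)
      ((isSolution_iff h.pos hc _).1 hWs) ((hc.eta.cellMean_eq h.pos).symm.trans hWC)
      (fun e => hW₁ (by rw [hc.sinCoeff_vel₁ h.pos htc]; simp [e]))
      (fun e => hW₂ (by rw [hc.sinCoeff_vel₁ h.pos htc]; simp [e])) (hcδ.trans hδη) ?_
    intro B₁ B₂ hB₁ hB₂ hl₁ hl₂
    -- The resonant amplitudes of W are bounded by its ℓ¹ norm, hence by δ; both the components at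
    -- these amplitudes and the uniqueness of the zero are then available.
    have e₁ : B₁ ^ 2 < min ρ r₀ := by
      refine lt_of_le_of_lt ?_ hδ₁
      have : B₁ ≤ 2 / D.k₁ * (K₂ * δ) := hl₁.trans (by gcongr)
      gcongr
    have e₂ : B₂ ^ 2 < min ρ r₀ := by
      refine lt_of_le_of_lt ?_ hδ₂
      have : B₂ ≤ 2 / D.k₂ * (K₂ * δ) := hl₂.trans (by gcongr)
      gcongr
    rw [lt_min_iff] at e₁ e₂
    have hy' : ‖(((μ, C), (B₁ ^ 2, B₂ ^ 2)) : Par)‖ < r₀ := by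
      refine max_lt (max_lt ?_ ?_) (max_lt ?_ ?_) <;> simp only [Real.norm_eq_abs]
      · linarith
      · linarith
      · rw [abs_of_nonneg (sq_nonneg _)]; exact e₁.2
      · rw [abs_of_nonneg (sq_nonneg _)]; exact e₂.2
    obtain ⟨hr', hsmall'⟩ := hR₀ _ hy'
    refine ⟨hr', smallBranch_of rfl (by linarith) hsmall', fun hbif => ?_⟩
    obtain ⟨f₁, f₂⟩ := huniq _ _ (by positivity) e₁.1 (by positivity) e₂.1 hbif
    exact ⟨(pow_left_inj₀ hB₁.le hA₁ two_ne_zero).1 f₁, (pow_left_inj₀ hB₂.le hA₂ two_ne_zero).1 f₂⟩
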